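/- \textbf{Setting.} Let $\mathrm{Aff}=\{(a,b):a>0,\ b\in\mathbb R\}$ with product $(a,b)(a',b')=(aa',ab'+b)$ and Haar measures $d_lg=da\,db/a^2$, $d_rg=da\,db/a$. Put $\lambda(t)=t/(1-e^{-t})$, $\lambda(0)=1$, so that $\exp(uX_1+vX_2)=(e^u,v/\lambda(-u))$ is the exponential map from the Lie algebra, and write $\langle z,uX_1+vX_2\rangle=ux+vy$ for $z=(x,y)=x+iy$ in its dual. The coadjoint action is $(a,b)\cdot(x,y)=(x+by/a,\,y/a)$, with open orbits $\pm\Pi=\{\pm y>0\}$; let $d\omega=d_lz=dx\,dy/|y|$ and $d_rz=dx\,dy/y^2$, let $z^{-1}=(-x/y,1/y)$, and let $z\triangleleft h=(h^{-1}\cdot z^{-1})^{-1}$. On $\mathcal K_\pm=L^2((0,\pm\infty),dr/|r|)$ let $U_\pm(a,b)\psi(r)=e^{2\pi ibr}\psi(ar)$. For $z\in\pm\Pi$, $\Omega(z)$ is the sesquilinear form $$\langle\phi,\Omega(z)\psi\rangle=|y|\iint_{\mathbb R^2}e^{-2\pi i(ux+vy)}\,\langle\phi,U_\pm(\exp(uX_1+vX_2))\psi\rangle\,du\,dv$$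 on smooth functions $\phi,\psi$ with compact support in the open half-line, and $\Omega^R(z)=\Omega(z^{-1})$. For a function $F$ on $\pm\Pi$, $Q(F)=\int_{\pm\Pi}F\,\Omega\,d\omega$ denotes the bounded operator (if there is one) with $\langle\phi,Q(F)\psi\rangle=\int_{\pm\Pi}F(z)\langle\phi,\Omega(z)\psi\rangle\,d\omega(z)$ for all such $\phi,\psi$. For a bounded operator $A$ on $\mathcal K_\pm$, ``$\operatorname{Tr}(\Omega(z)A)=W(z)$'' means that $W$ is locally integrable on $\pm\Pi$ and that, for every test function $f\in C_c^\infty(\pm\Pi)$, $Q(f)$ exists, $Q(f)A$ is trace class and $\operatorname{Tr}(Q(f)A)=\int_{\pm\Pi}fW\,d\omega$. The twisted product $F\star G$ is $\operatorname{Tr}(\Omega(\cdot)\,Q(F)Q(G))$. The notions $Q_R$, $\operatorname{Tr}(\Omega^R(z)A)$ and $\star^R$ are defined in the same way from $\Omega^R$ and $d_rz$. \textbf{Theorem (left transform).} There is a function $E(z,g)$, $z\in\Pi\cup-\Pi$, $g\in\mathrm{Aff}$, continuous in $z$, with $E(z,g)=\operatorname{Tr}(\Omega(z)U_\pm(g))$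 for $z\in\pm\Pi$. It is unique, and for $z=x+iy\in\pm\Pi$ and $g=(a,b)$ it is $$E(z,g)=\exp\bigl(2\pi i(x\log a+y\,b\,\lambda(\log a)/a)\bigr),\qquad E(z,\exp X)=e^{2\pi i\langle z,X\rangle}.$$ With $\mathcal F[f](z)=\int_{\mathrm{Aff}}E(z,g)f(g)\,d_lg$: \begin{itemize} \item \emph{Hermiticity:} $\overline{E(z,g)}=E(z,g^{-1})$. \item \emph{Covariance:} $E(z,g)=E(h\cdot z,hgh^{-1})$ for all $h\in\mathrm{Aff}$. \item \emph{Character formula:} $\int_{\pm\Pi}E(z,g)\,d\omega(z)=\operatorname{Tr}U_\pm(g)$ as generalized functions of $g$; that is, for every $f\in C_c^\infty(\mathrm{Aff})$ with $\int_{\mathbb R} f(a,b)\,db=0$ for all $a$, the operator $U_\pm(f)=\int f(g)U_\pm(g)\,d_lg$ is trace class, $\mathcal F[f]$ is $\omega$-integrable on $\pm\Pi$, and $\operatorname{Tr}U_\pm(f)=\int_{\pm\Pi}\mathcal F[f]\,d\omega$. \item \emph{Convolution theorem:} $\mathcal F[f*h]=\mathcal F[f]\star\mathcal F[h]$ on each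 of $\pm\Pi$, for all $f,h\in L^1(\mathrm{Aff},d_lg)$, where $(f*h)(g)=\int f(k)h(k^{-1}g)\,d_lk$. In particular, the operators $Q(\mathcal F[f])$ and $Q(\mathcal F[h])$ exist. \end{itemize} \textbf{Theorem (right transform).} Likewise there is a unique function $E_R(z,g)$, continuous in $z\in\pm\Pi$, with $E_R(z,g)=\operatorname{Tr}(\Omega^R(z)U_\pm(g))$ on $\pm\Pi$, and $$E_R(z,g)=\exp\bigl(2\pi i(-x\log a+b\,\lambda(\log a)/a)/y\bigr),\qquad E_R(z,\exp X)=e^{2\pi i\langle z^{-1},X\rangle}.$$ With $\mathcal F^r[f](z)=\int_{\mathrm{Aff}}E_R(z,g)f(g)\,d_rg$ one has: \begin{itemize} \item $\overline{E_R(z,g)}=E_R(z,g^{-1})$; \item $E_R(z,g)=E_R(z\triangleleft h,h^{-1}gh)$ for all $h\in\mathrm{Aff}$; \item $\int_{\pm\Pi}E_R(z,g)\,d_rz=\operatorname{Tr}U_\pm(g)$ in the same sense, with $d_rg$, $\mathcal F^r$ and $d_rz$ in place of $d_lg$, $\mathcal F$ and $d\omega$; \item $\mathcal F^r[f*_rh]=\mathcal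 F^r[f]\star^R\mathcal F^r[h]$ on each of $\pm\Pi$, for all $f,h\in L^1(\mathrm{Aff},d_rg)$, where $(f*_rh)(g)=\int f(gk^{-1})h(k)\,d_rk$. \end{itemize} -/

import Mathlib

open MeasureTheory
open scoped ContDiff

noncomputable section

/-! ### The affine group, its exponential map and its Haar measures -/

/-- The group of matrices `(a b; 0 1)` with `a > 0` and `b` real. -/
@[ext]
structure Aff where
  a : ℝ
  b : ℝ
  a_pos : 0 < a

namespace Aff

instance : Mul Aff := ⟨fun g h => ⟨g.a * h.a, g.a * h.b + g.b, mul_pos g.a_pos h.a_pos⟩⟩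
instance : One Aff := ⟨⟨1, 0, one_pos⟩⟩
instance : Inv Aff := ⟨fun g => ⟨g.a⁻¹, -g.b / g.a, inv_pos.2 g.a_pos⟩⟩

@[simp] theorem mul_a (g h : Aff) : (g * h).a = g.a * h.a := rfl
@[simp] theorem mul_b (g h : Aff) : (g * h).b = g.a * h.b + g.b := rfl
@[simp] theorem one_a : (1 : Aff).a = 1 := rfl
@[simp] theorem one_b : (1 : Aff).b = 0 := rfl
@[simp] theorem inv_a (g : Aff) : (g⁻¹).a = g.a⁻¹ := rfl
@[simp] theorem inv_b (g : Aff) : (g⁻¹).b = -g.b / g.a := rfl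

instance : Group Aff :=
  Group.ofLeftAxioms
    (fun g h k => by ext <;> simp <;> ring)
    (fun g => by ext <;> simp)
    (fun g => by
      have := g.a_pos.ne'
      ext
      · simp [this]
      · simp; field_simp; ring)

/-- The matrix of a group element. -/
def toMatrix (g : Aff) : Matrix (Fin 2) (Fin 2) ℝ := !![g.a, g.b; 0, 1]

theorem toMatrix_mul (g h : Aff) : (g * h).toMatrix = g.toMatrix * h.toMatrix := by
  ext i j; fin_cases i <;> fin_cases j <;> simp [toMatrix, Matrix.mul_apply, Fin.sum_univ_two]

/-- The Borel structure of the open half-plane `a > 0`. -/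
instance : MeasurableSpace Aff :=
  MeasurableSpace.comap (fun g : Aff => (g.a, g.b)) inferInstance

/-- Left Haar measure `da db / a²`. -/
def leftHaar : Measure Aff :=
  Measure.comap (fun g : Aff => (g.a, g.b))
    ((volume : Measure (ℝ × ℝ)).withDensity fun p => ENNReal.ofReal (1 / p.1 ^ 2))

/-- Right Haar measure `da db / a`. -/
def rightHaar : Measure Aff :=
  Measure.comap (fun g : Aff => (g.a, g.b))
    ((volume : Measure (ℝ × ℝ)).withDensity fun p => ENNReal.ofReal (1 / p.1))

/-- Smooth compactly supported functions on the group, read in the global chart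
`(t, b) ↦ (exp t, b)`. -/
def IsTestFunction (f : Aff → ℂ) : Prop :=
  ContDiff ℝ ∞ (fun p : ℝ × ℝ => f ⟨Real.exp p.1, p.2, Real.exp_pos _⟩) ∧
    HasCompactSupport (fun p : ℝ × ℝ => f ⟨Real.exp p.1, p.2, Real.exp_pos _⟩)

/-- Convolution with respect to left Haar measure. -/
def leftConv (f h : Aff → ℂ) (g : Aff) : ℂ := ∫ k, f k * h (k⁻¹ * g) ∂leftHaar

/-- Convolution with respect to right Haar measure. -/
def rightConv (f h : Aff → ℂ) (g : Aff) : ℂ := ∫ k, f (g * k⁻¹) * h k ∂rightHaar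

end Aff

/-- `lam t = t / (1 - exp (-t))`, with `lam 0 = 1`. -/
def lam (t : ℝ) : ℝ := if t = 0 then 1 else t / (1 - Real.exp (-t))

/-- The exponential map: `exp (u X₁ + v X₂) = (e^u, v (e^u - 1) / u)`, where
`(e^u - 1) / u = 1 / lam (-u)`. -/
def expAff (X : ℝ × ℝ) : Aff := ⟨Real.exp X.1, X.2 / lam (-X.1), Real.exp_pos _⟩

/-- `expAff` is the matrix exponential of `u X₁ + v X₂ = (u v; 0 0)`. -/
theorem toMatrix_expAff (X : ℝ × ℝ) :
    (expAff X).toMatrix = NormedSpace.exp (!![X.1, X.2; 0, 0] : Matrix (Fin 2) (Fin 2) ℝ) := by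
  obtain ⟨u, v⟩ := X
  by_cases hu : u = 0
  · subst hu
    have h2 : (!![0, v; 0, 0] : Matrix (Fin 2) (Fin 2) ℝ) ^ 2 = 0 := by
      ext i j; fin_cases i <;> fin_cases j <;> simp [pow_two]
    have h3 : ∀ n ∉ Finset.range 2,
        ((n.factorial : ℝ)⁻¹) • (!![0, v; 0, 0] : Matrix (Fin 2) (Fin 2) ℝ) ^ n = 0 := by
      intro n hn
      obtain ⟨k, rfl⟩ := Nat.exists_eq_add_of_le (not_lt.1 (by simpa using hn) : 2 ≤ n)
      rw [pow_add, h2]; simp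
    rw [NormedSpace.exp_eq_tsum ℝ]
    change _ = ∑' n : ℕ, _
    rw [tsum_eq_sum h3]
    ext i j; fin_cases i <;> fin_cases j <;>
      simp [expAff, Aff.toMatrix, lam, Finset.sum_range_succ]
  · have hP : IsUnit (!![1, -v / u; 0, 1] : Matrix (Fin 2) (Fin 2) ℝ) := by
      rw [Matrix.isUnit_iff_isUnit_det]; simp [Matrix.det_fin_two]
    have hinv : (!![1, -v / u; 0, 1] : Matrix (Fin 2) (Fin 2) ℝ)⁻¹ = !![1, v / u; 0, 1] := by
      apply Matrix.inv_eq_right_inv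
      ext i j; fin_cases i <;> fin_cases j <;> simp; ring
    have hd : ∀ p q : ℝ, Matrix.diagonal ![p, q] = !![p, 0; 0, q] := by
      intro p q
      ext i j; fin_cases i <;> fin_cases j <;> rfl
    have hM : (!![u, v; 0, 0] : Matrix (Fin 2) (Fin 2) ℝ)
        = !![1, -v / u; 0, 1] * Matrix.diagonal ![u, 0] * (!![1, -v / u; 0, 1])⁻¹ := by
      rw [hinv, hd]
      ext i j
      fin_cases i <;> fin_cases j <;> simp
      field_simp
    have he : NormedSpace.exp ![u, 0] = ![Real.exp u, 1] := by
      ext i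
      rw [Pi.coe_exp]
      fin_cases i <;> simp [← Real.exp_eq_exp_ℝ]
    rw [hM, Matrix.exp_conj _ _ hP, Matrix.exp_diagonal, hinv, he, hd]
    ext i j
    fin_cases i <;> fin_cases j <;> simp [expAff, Aff.toMatrix, lam, hu]
    have h1 : 1 - Real.exp u ≠ 0 := fun h =>
      hu (Real.exp_eq_one_iff u |>.1 (by linarith))
    field_simp
    ring

/-! ### Coadjoint orbits.  The sign `s = ±1` selects the orbit `±Π`. -/

/-- The half-plane `±Π = {(x, y) : ± y > 0}` of the dual of the Lie algebra. -/
def orbit (s : ℤˣ) : Set (ℝ × ℝ) := {z | 0 < ((s : ℤ) : ℝ) * z.2}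

/-- The pairing `⟨(x, y), u X₁ + v X₂⟩ = u x + v y`. -/
def pairing (z X : ℝ × ℝ) : ℝ := X.1 * z.1 + X.2 * z.2

/-- The coadjoint action `(a, b) ▹ (x, y) = (x + b y / a, y / a)`. -/
def coadj (h : Aff) (z : ℝ × ℝ) : ℝ × ℝ := (z.1 + h.b * z.2 / h.a, z.2 / h.a)

/-- The inversion `z⁻¹ = -x / y + i / y`. -/
def orbInv (z : ℝ × ℝ) : ℝ × ℝ := (-z.1 / z.2, 1 / z.2)

/-- The right action `z ◃ h = (h⁻¹ ▹ z⁻¹)⁻¹`. -/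
def rightCoadj (z : ℝ × ℝ) (h : Aff) : ℝ × ℝ := orbInv (coadj h⁻¹ (orbInv z))

/-- The measure `dω = d_l z = dx dy / |y|`. -/
def leftMeas : Measure (ℝ × ℝ) :=
  (volume : Measure (ℝ × ℝ)).withDensity fun z => ENNReal.ofReal (1 / |z.2|)

/-- The measure `d_r z = dx dy / y²`. -/
def rightMeas : Measure (ℝ × ℝ) :=
  (volume : Measure (ℝ × ℝ)).withDensity fun z => ENNReal.ofReal (1 / z.2 ^ 2)

/-! ### The representations `U_±` on `L²((0, ±∞), dr / |r|)` -/

/-- The half-line `(0, ±∞)`. -/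
def halfLine (s : ℤˣ) : Set ℝ := {r | 0 < ((s : ℤ) : ℝ) * r}

/-- The measure `dr / |r|` on the half-line `(0, ±∞)`. -/
def halfMeas (s : ℤˣ) : Measure ℝ :=
  ((volume : Measure ℝ).restrict (halfLine s)).withDensity fun r => ENNReal.ofReal (1 / |r|)

/-- The Hilbert space `L²((0, ±∞), dr / |r|)`. -/
abbrev HilbK (s : ℤˣ) : Type := Lp ℂ 2 (halfMeas s)

theorem measurableSet_halfLine (s : ℤˣ) : MeasurableSet (halfLine s) :=
  measurableSet_lt measurable_const (measurable_id.const_mul _)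

theorem halfMeas_dilation (s : ℤˣ) (a : ℝ) (ha : 0 < a) :
    MeasurePreserving (fun r : ℝ => a * r) (halfMeas s) (halfMeas s) := by
  refine ⟨measurable_const_mul a, ?_⟩
  have hD : Measurable fun r : ℝ => ENNReal.ofReal (1 / |r|) := by fun_prop
  ext S hS
  have hpre : MeasurableSet ((fun r : ℝ => a * r) ⁻¹' S) := (measurable_const_mul a) hS
  rw [Measure.map_apply (measurable_const_mul a) hS, halfMeas, withDensity_apply _ hpre,
    withDensity_apply _ hS, Measure.restrict_restrict hpre, Measure.restrict_restrict hS]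
  have hset : (fun r : ℝ => a * r) ⁻¹' S ∩ halfLine s
      = (fun r : ℝ => a * r) ⁻¹' (S ∩ halfLine s) := by
    ext r
    simp only [halfLine, Set.mem_inter_iff, Set.mem_preimage, Set.mem_ofPred_eq]
    rw [mul_left_comm, mul_pos_iff_of_pos_left ha]
  have hT : MeasurableSet (S ∩ halfLine s) := hS.inter (measurableSet_halfLine s)
  have hpt : ∀ r : ℝ, ENNReal.ofReal (1 / |r|)
      = ENNReal.ofReal a * ENNReal.ofReal (1 / |a * r|) := by
    intro r
    rw [← ENNReal.ofReal_mul ha.le, abs_mul, abs_of_pos ha]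
    congr 1
    rcases eq_or_ne |r| 0 with h | h
    · simp [h]
    · field_simp
  rw [hset, lintegral_congr hpt, lintegral_const_mul _ (by fun_prop)]
  rw [← setLIntegral_map (g := fun r : ℝ => a * r) hT hD (measurable_const_mul a),
    Real.map_volume_mul_left ha.ne', Measure.restrict_smul, lintegral_smul_measure, smul_eq_mul,
    ← mul_assoc, ← ENNReal.ofReal_mul ha.le, abs_of_pos (inv_pos.2 ha), mul_inv_cancel₀ ha.ne']
  simp

/-- The phase `r ↦ exp (2 π i b r)`. -/
def phase (b r : ℝ) : ℂ := Complex.exp (2 * Real.pi * Complex.I * ((b * r : ℝ) : ℂ))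

theorem norm_phase (b r : ℝ) : ‖phase b r‖ = 1 := by
  have h : (2 * Real.pi * Complex.I * ((b * r : ℝ) : ℂ))
      = ((2 * Real.pi * (b * r) : ℝ) : ℂ) * Complex.I := by push_cast; ring
  rw [phase, h, Complex.norm_exp_ofReal_mul_I]

theorem continuous_phase (b : ℝ) : Continuous (phase b) := by
  unfold phase; fun_prop

theorem rep_memLp (s : ℤˣ) (g : Aff) (ψ : HilbK s) :
    MemLp (fun r => phase g.b r * ψ (g.a * r)) 2 (halfMeas s) := by
  have h1 : MemLp (fun r => ψ (g.a * r)) 2 (halfMeas s) :=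
    (Lp.memLp ψ).comp_measurePreserving (halfMeas_dilation s g.a g.a_pos)
  refine h1.of_le ((continuous_phase g.b).aestronglyMeasurable.mul h1.1) ?_
  exact Filter.Eventually.of_forall fun r => by rw [norm_mul, norm_phase, one_mul]

theorem rep_norm (s : ℤˣ) (g : Aff) (ψ : HilbK s) :
    ‖(rep_memLp s g ψ).toLp‖ = ‖ψ‖ := by
  rw [Lp.norm_toLp, Lp.norm_def]
  congr 1
  have hmp := halfMeas_dilation s g.a g.a_pos
  rw [← eLpNorm_comp_measurePreserving (Lp.aestronglyMeasurable ψ) hmp]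
  refine eLpNorm_congr_norm_ae (Filter.Eventually.of_forall fun r => ?_)
  simp [norm_phase]

/-- The unitary irreducible representation `U_±(a, b) ψ (r) = exp (2 π i b r) ψ (a r)`. -/
def rep (s : ℤˣ) (g : Aff) : HilbK s →L[ℂ] HilbK s :=
  LinearMap.mkContinuous
    { toFun := fun ψ => (rep_memLp s g ψ).toLp
      map_add' := fun ψ χ => by
        rw [← MemLp.toLp_add]
        apply MemLp.toLp_congr
        have hq := (halfMeas_dilation s g.a g.a_pos).quasiMeasurePreserving.ae (Lp.coeFn_add ψ χ)
        filter_upwards [hq] with r hr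
        simp only [Pi.add_apply] at hr ⊢
        rw [hr, mul_add]
      map_smul' := fun c ψ => by
        rw [RingHom.id_apply, ← MemLp.toLp_const_smul]
        apply MemLp.toLp_congr
        have hq := (halfMeas_dilation s g.a g.a_pos).quasiMeasurePreserving.ae (Lp.coeFn_smul c ψ)
        filter_upwards [hq] with r hr
        simp only [Pi.smul_apply, smul_eq_mul] at hr ⊢
        rw [hr]; ring }
    1 (fun ψ => by rw [one_mul]; exact (rep_norm s g ψ).le)

/-- Vectors of `L²((0, ±∞), dr / |r|)` represented by smooth functions with compact support in the
open half-line. -/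
def IsTestVector (s : ℤˣ) (ψ : HilbK s) : Prop :=
  ∃ f : ℝ → ℂ, ContDiff ℝ ∞ f ∧ HasCompactSupport f ∧ tsupport f ⊆ halfLine s ∧
    ψ =ᵐ[halfMeas s] f

/-! ### Trace-class operators -/

/-- Trace-class (nuclear) operators: the matrix elements `⟨e_i, T f_i⟩` are absolutely summable for
every pair of orthonormal systems. -/
def IsTraceClass {H : Type} [NormedAddCommGroup H] [InnerProductSpace ℂ H]
    (T : H →L[ℂ] H) : Prop :=
  ∀ (ι : Type) (e f : ι → H), Orthonormal ℂ e → Orthonormal ℂ f →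
    Summable fun i => ‖inner ℂ (e i) (T (f i))‖

/-- `T` is trace class with `Tr T = t`. -/
def HasTrace {H : Type} [NormedAddCommGroup H] [InnerProductSpace ℂ H]
    (T : H →L[ℂ] H) (t : ℂ) : Prop :=
  IsTraceClass T ∧
    ∀ (ι : Type) (e : HilbertBasis ι ℂ H), HasSum (fun i => inner ℂ (e i) (T (e i))) t

/-! ### The quantizers, quantization, dequantization and twisted products -/

/-- The left quantizer as a family of sesquilinear forms on test vectors, given by the Weyl formula
`⟨φ, Ω(z) ψ⟩ = |y| ∬ exp (-2 π i (u x + v y)) ⟨φ, U(exp (u X₁ + v X₂)) ψ⟩ du dv`. -/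
def quantL (s : ℤˣ) (z : ℝ × ℝ) (φ ψ : HilbK s) : ℂ :=
  ((|z.2| : ℝ) : ℂ) * ∫ X : ℝ × ℝ,
    Complex.exp (-(2 * Real.pi * Complex.I * (pairing z X : ℂ))) * inner ℂ φ (rep s (expAff X) ψ)

/-- The right quantizer `Ω^R(z) = Ω(z⁻¹)`. -/
def quantR (s : ℤˣ) (z : ℝ × ℝ) (φ ψ : HilbK s) : ℂ := quantL s (orbInv z) φ ψ

/-- A family of sesquilinear forms indexed by the points of the orbits `±Π`, such as the two
quantizers above. -/
abbrev FormFamily : Type := (s : ℤˣ) → ℝ × ℝ → HilbK s → HilbK s → ℂ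

/-- `A` is the quantization `Q(F) = ∫_{±Π} F(z) Ω(z) dm(z)`, as a weak integral on test vectors. -/
def IsQuantization (Ω : FormFamily) (m : Measure (ℝ × ℝ)) (s : ℤˣ) (F : ℝ × ℝ → ℂ)
    (A : HilbK s →L[ℂ] HilbK s) : Prop :=
  ∀ φ ψ : HilbK s, IsTestVector s φ → IsTestVector s ψ →
    IntegrableOn (fun z => F z * Ω s z φ ψ) (orbit s) m ∧
      ∫ z in orbit s, F z * Ω s z φ ψ ∂m = inner ℂ φ (A ψ)

/-- `W(z) = Tr (Ω(z) A)` as a distribution on the orbit: `Tr (Q(f) A) = ∫_{±Π} f(z) W(z) dm(z)` for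
every test function `f`, with `Q(f) A` trace class. -/
def IsSymbol (Ω : FormFamily) (m : Measure (ℝ × ℝ)) (s : ℤˣ) (A : HilbK s →L[ℂ] HilbK s)
    (W : ℝ × ℝ → ℂ) : Prop :=
  LocallyIntegrableOn W (orbit s) volume ∧
    ∀ f : ℝ × ℝ → ℂ, ContDiff ℝ ∞ f → HasCompactSupport f → tsupport f ⊆ orbit s →
      ∃ Q : HilbK s →L[ℂ] HilbK s, IsQuantization Ω m s f Q ∧
        HasTrace (Q.comp A) (∫ z in orbit s, f z * W z ∂m)

/-- `P = F ⋆ G` on the orbit `±Π`: `P` is the dequantization of the operator `Q(F) Q(G)`. -/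
def IsMoyalProduct (Ω : FormFamily) (m : Measure (ℝ × ℝ)) (s : ℤˣ) (F G P : ℝ × ℝ → ℂ) : Prop :=
  ∃ A B : HilbK s →L[ℂ] HilbK s,
    IsQuantization Ω m s F A ∧ IsQuantization Ω m s G B ∧ IsSymbol Ω m s (A.comp B) P

/-! ### Fourier–Moyal kernels and transformations -/

/-- `E(z, g) = Tr (Ω(z) U_±(g))` for `z ∈ ±Π`: for every `g`, the function `E(·, g)` is continuous on
each orbit and represents the distribution `Tr (Ω(·) U_±(g))`. -/
def IsFourierMoyalKernel (Ω : FormFamily) (m : Measure (ℝ × ℝ)) (E : ℝ × ℝ → Aff → ℂ) : Prop :=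
  ∀ (s : ℤˣ) (g : Aff), ContinuousOn (fun z => E z g) (orbit s) ∧
    IsSymbol Ω m s (rep s g) (fun z => E z g)

/-- The transformation `F[f](z) = ∫ E(z, g) f(g) dμ(g)`. -/
def fourierMoyal (E : ℝ × ℝ → Aff → ℂ) (μ : Measure Aff) (f : Aff → ℂ) (z : ℝ × ℝ) : ℂ :=
  ∫ g, E z g * f g ∂μ

/-- `A = U_±(f) = ∫ f(g) U_±(g) dμ(g)`, as a weak integral. -/
def IsIntegratedRep (s : ℤˣ) (μ : Measure Aff) (f : Aff → ℂ)
    (A : HilbK s →L[ℂ] HilbK s) : Prop :=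
  ∀ φ ψ : HilbK s, Integrable (fun g => f g * inner ℂ φ (rep s g ψ)) μ ∧
    ∫ g, f g * inner ℂ φ (rep s g ψ) ∂μ = inner ℂ φ (A ψ)

/-- The identity `∫_{±Π} E(z, ·) dm(z) = Tr U_±(·)` of distributions on the group.  Paired with `f`
it reads `∫_{±Π} F[f] dm = Tr U_±(f)`; here `f` is a test function of zero mean in `b`, because
`Tr U_±(f)` makes sense only for such test functions. -/
def CharacterFormula (m : Measure (ℝ × ℝ)) (μ : Measure Aff) (E : ℝ × ℝ → Aff → ℂ) : Prop :=
  ∀ (s : ℤˣ) (f : Aff → ℂ), Aff.IsTestFunction f →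
    (∀ (a : ℝ) (ha : 0 < a), ∫ b : ℝ, f ⟨a, b, ha⟩ = 0) →
      ∃ A : HilbK s →L[ℂ] HilbK s, IsIntegratedRep s μ f A ∧
        IntegrableOn (fourierMoyal E μ f) (orbit s) m ∧
          HasTrace A (∫ z in orbit s, fourierMoyal E μ f z ∂m)

end

/-!
On test vectors the quantizer is an explicit partial Fourier transform. Integrating the Weyl formula
first over the coordinate `v` gives `⟨φ, Ω(x, y) ψ⟩ = ∫ e^(-2πixu) conj φ(y λ(-u)) ψ(y λ(u)) du`
(`quantL_eq`, with the integrand `weylFun`). In logarithmic coordinates `r = ± e^p` the quantization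
of a test function `f` is therefore an integral operator: the substitution `p = η + log λ(-u)`,
`q = η + log λ(u)`, which satisfies `q - p = u` because `λ(u) = e^u λ(-u)`, has unit Jacobian and
turns the symbol into the kernel `quantKer`.

Trace class is obtained without singular values. A kernel that is differentiable in `p` and decays
together with its derivative is a superposition
`K(p, q) = ∫ 1_{p < t} e^(p-t) (K - ∂K)(t, q) dt` of kernels of rank one
(`IsTraceKernel.integral_expTail_mul`). Since this integral of operators of rank one converges in
norm, Bessel's inequality and Parseval's identity give, for every bounded `A`, trace class and the
trace of the product with `A` (`hasTrace_comp_of_rankOne`). For `quantKer`, and `A = U(g)` or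
`A = U(F)`, this shows `Tr (Q(f) U(g)) = ∫ f E(·, g) dω` for the explicit phase `E = kerE`, and
the corresponding statement for `U(F)` (`exists_quantization`). So `kerE` is a Fourier–Moyal kernel.
It is the only one: test vectors are dense, so `Q(f)` is determined by its matrix elements, and a
continuous function is determined by its integrals against test functions (`IsSymbol.eqOn`).

The convolution theorem says that `F ↦ U(F)` is multiplicative. By Fourier inversion `U(F)` is the
quantization of the transform of `F` (`isQuantization_fourierMoyal`), and the transform of `F` is the
symbol of `U(F)` (`isSymbol_fourierMoyal`).

For the character formula, `U(f)` has the integral kernel `repKer`, a partial Fourier transform of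
`f` at frequency `∓ e^p`. The zero mean of `f` in `b` makes it decay as `p → -∞`, so that it is again
a trace kernel, and its trace is the integral over the diagonal. The transform of `f` is a double
Fourier integral in exponential coordinates of the group; it is integrable on the orbit, and Fourier
inversion in `x` reduces its integral to the same expression (`exists_trace_integratedRep`).

The right theory is the image of the left one under the inversion `z ↦ z⁻¹`, which carries `d_r z` to
`dω` and `Ω^R` to `Ω`; on the group, `d_r g = a d_l g`, and the two convolutions are the same
function.
-/

/-! ### Weak integrals of operators and traces -/

section Trace

variable {H : Type} [NormedAddCommGroup H] [InnerProductSpace ℂ H]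
  {X : Type*} [MeasurableSpace X] {μ : Measure X}

theorem integrable_inner_apply {T : X → H →L[ℂ] H} {c : X → ℝ} (hc : Integrable c μ)
    (hT : ∀ x, ‖T x‖ ≤ c x)
    (hm : ∀ φ ψ : H, AEStronglyMeasurable (fun x => inner ℂ φ (T x ψ)) μ) (φ ψ : H) :
    Integrable (fun x => inner ℂ φ (T x ψ)) μ := by
  refine (hc.mul_const (‖φ‖ * ‖ψ‖)).mono' (hm φ ψ) (Filter.Eventually.of_forall fun x => ?_)
  calc ‖inner ℂ φ (T x ψ)‖ ≤ ‖φ‖ * ‖T x ψ‖ := norm_inner_le_norm _ _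
    _ ≤ ‖φ‖ * (c x * ‖ψ‖) := by
        gcongr
        exact (T x).le_of_opNorm_le (hT x) ψ
    _ = c x * (‖φ‖ * ‖ψ‖) := by ring

/-- A weakly measurable family of operators with integrable norm bound has a weak integral. -/
theorem exists_weakIntegral [CompleteSpace H] (T : X → H →L[ℂ] H) {c : X → ℝ}
    (hc : Integrable c μ) (hT : ∀ x, ‖T x‖ ≤ c x)
    (hm : ∀ φ ψ : H, AEStronglyMeasurable (fun x => inner ℂ φ (T x ψ)) μ) :
    ∃ A : H →L[ℂ] H, ∀ φ ψ : H, ∫ x, inner ℂ φ (T x ψ) ∂μ = inner ℂ φ (A ψ) := by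
  have hi := integrable_inner_apply hc hT hm
  let B₀ : H →ₛₗ[starRingEnd ℂ] H →ₗ[ℂ] ℂ :=
    LinearMap.mk₂'ₛₗ (starRingEnd ℂ) (RingHom.id ℂ) (fun φ ψ => ∫ x, inner ℂ φ (T x ψ) ∂μ)
      (fun φ φ' ψ => by simp only [inner_add_left]; exact integral_add (hi _ _) (hi _ _))
      (fun k φ ψ => by
        simp only [inner_smul_left, smul_eq_mul]; exact integral_const_mul _ _)
      (fun φ ψ ψ' => by
        simp only [map_add, inner_add_right]; exact integral_add (hi _ _) (hi _ _))
      (fun k φ ψ => by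
        simp only [map_smul, inner_smul_right, smul_eq_mul, RingHom.id_apply]
        exact integral_const_mul _ _)
  let B : H →L⋆[ℂ] H →L[ℂ] ℂ := B₀.mkContinuous₂ (∫ x, c x ∂μ) (fun φ ψ => by
    calc ‖∫ x, inner ℂ φ (T x ψ) ∂μ‖ ≤ ∫ x, c x * (‖φ‖ * ‖ψ‖) ∂μ := by
          refine norm_integral_le_of_norm_le (hc.mul_const _)
            (Filter.Eventually.of_forall fun x => ?_)
          calc ‖inner ℂ φ (T x ψ)‖ ≤ ‖φ‖ * ‖T x ψ‖ := norm_inner_le_norm _ _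
            _ ≤ ‖φ‖ * (c x * ‖ψ‖) := by
                gcongr
                exact (T x).le_of_opNorm_le (hT x) ψ
            _ = c x * (‖φ‖ * ‖ψ‖) := by ring
      _ = (∫ x, c x ∂μ) * ‖φ‖ * ‖ψ‖ := by rw [integral_mul_const]; ring)
  refine ⟨ContinuousLinearMap.adjoint (InnerProductSpace.continuousLinearMapOfBilin B),
    fun φ ψ => ?_⟩
  rw [ContinuousLinearMap.adjoint_inner_right,
    InnerProductSpace.continuousLinearMapOfBilin_apply]
  rfl

/-- The balls of radius `1 / 2` around the members of an orthonormal family are disjoint. -/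
theorem Orthonormal.countable_of_separable [TopologicalSpace.SeparableSpace H] {ι : Type*}
    {e : ι → H} (he : Orthonormal ℂ e) : Countable ι := by
  rw [← Set.countable_univ_iff]
  refine Set.PairwiseDisjoint.countable_of_isOpen (s := fun i => Metric.ball (e i) (1 / 2)) ?_
    (fun _ _ => Metric.isOpen_ball) (fun i _ => ⟨e i, Metric.mem_ball_self (by norm_num)⟩)
  intro i _ j _ hij
  refine Metric.ball_disjoint_ball ?_
  have h : ‖e i - e j‖ ^ 2 = 2 := by
    rw [@norm_sub_sq ℂ, he.1 i, he.1 j, he.2 hij]; norm_num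
  rw [dist_eq_norm]
  nlinarith [norm_nonneg (e i - e j)]

/-- Bessel's inequality for both factors of an operator of rank one. -/
theorem sum_norm_inner_mul_inner_le {ι : Type*} {e f : ι → H} (he : Orthonormal ℂ e)
    (hf : Orthonormal ℂ f) (a b : H) (F : Finset ι) :
    ∑ i ∈ F, ‖inner ℂ (e i) a * inner ℂ b (f i)‖ ≤ ‖a‖ * ‖b‖ := by
  have h := Real.sum_mul_le_sqrt_mul_sqrt F (fun i => ‖inner ℂ (e i) a‖)
    (fun i => ‖inner ℂ (f i) b‖)
  have h1 : √(∑ i ∈ F, ‖inner ℂ (e i) a‖ ^ 2) ≤ ‖a‖ :=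
    Real.sqrt_le_iff.2 ⟨norm_nonneg _, he.sum_inner_products_le a⟩
  have h2 : √(∑ i ∈ F, ‖inner ℂ (f i) b‖ ^ 2) ≤ ‖b‖ :=
    Real.sqrt_le_iff.2 ⟨norm_nonneg _, hf.sum_inner_products_le b⟩
  calc ∑ i ∈ F, ‖inner ℂ (e i) a * inner ℂ b (f i)‖
      = ∑ i ∈ F, ‖inner ℂ (e i) a‖ * ‖inner ℂ (f i) b‖ :=
        Finset.sum_congr rfl fun i _ => by rw [norm_mul, norm_inner_symm b]
    _ ≤ _ := h
    _ ≤ ‖a‖ * ‖b‖ := mul_le_mul h1 h2 (Real.sqrt_nonneg _) (norm_nonneg _)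

/-- An absolutely convergent weak integral `∫ |a x⟩⟨b x| dμ(x)` of operators of rank one is trace
class, and so is its product with a bounded operator `A`.  The trace is computed by Bessel's
inequality and Parseval's identity inside the integral. -/
theorem hasTrace_comp_of_rankOne [CompleteSpace H] [TopologicalSpace.SeparableSpace H]
    {a b : X → H} {c : X → ℝ}
    (hc : Integrable c μ) (hab : ∀ x, ‖a x‖ * ‖b x‖ ≤ c x)
    (ha : ∀ φ : H, AEStronglyMeasurable (fun x => inner ℂ φ (a x)) μ)
    (hb : ∀ φ : H, AEStronglyMeasurable (fun x => inner ℂ (b x) φ) μ)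
    {T : H →L[ℂ] H}
    (hT : ∀ φ ψ : H, ∫ x, inner ℂ φ (a x) * inner ℂ (b x) ψ ∂μ = inner ℂ φ (T ψ))
    (A : H →L[ℂ] H) :
    HasTrace (T.comp A) (∫ x, inner ℂ (b x) (A (a x)) ∂μ) := by
  have hA : ∀ x ψ, inner ℂ (b x) (A ψ) = inner ℂ (ContinuousLinearMap.adjoint A (b x)) ψ :=
    fun x ψ => (ContinuousLinearMap.adjoint_inner_left A ψ (b x)).symm
  have hbA : ∀ x, ‖a x‖ * ‖ContinuousLinearMap.adjoint A (b x)‖ ≤ ‖A‖ * c x := fun x => by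
    calc ‖a x‖ * ‖ContinuousLinearMap.adjoint A (b x)‖ ≤ ‖a x‖ * (‖A‖ * ‖b x‖) := by
          gcongr
          refine (ContinuousLinearMap.adjoint A).le_of_opNorm_le (le_of_eq ?_) _
          exact LinearIsometryEquiv.norm_map _ _
      _ = ‖A‖ * (‖a x‖ * ‖b x‖) := by ring
      _ ≤ _ := by gcongr; exact hab x
  have hmeas : ∀ φ ψ : H,
      AEStronglyMeasurable (fun x => inner ℂ φ (a x) * inner ℂ (b x) (A ψ)) μ :=
    fun φ ψ => (ha φ).mul (hb (A ψ))
  have hint : ∀ φ ψ : H, Integrable (fun x => inner ℂ φ (a x) * inner ℂ (b x) (A ψ)) μ := by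
    intro φ ψ
    refine ((hc.const_mul ‖A‖).mul_const (‖φ‖ * ‖ψ‖)).mono' (hmeas φ ψ)
      (Filter.Eventually.of_forall fun x => ?_)
    rw [norm_mul, hA]
    calc _ ≤ (‖φ‖ * ‖a x‖) * (‖ContinuousLinearMap.adjoint A (b x)‖ * ‖ψ‖) := by
          gcongr <;> exact norm_inner_le_norm _ _
      _ = (‖a x‖ * ‖ContinuousLinearMap.adjoint A (b x)‖) * (‖φ‖ * ‖ψ‖) := by ring
      _ ≤ _ := mul_le_mul_of_nonneg_right (hbA x) (by positivity)
  have hsum : ∀ (ι : Type) (e f : ι → H), Orthonormal ℂ e → Orthonormal ℂ f →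
      Summable fun i => ∫ x, ‖inner ℂ (e i) (a x) * inner ℂ (b x) (A (f i))‖ ∂μ := by
    intro ι e f he hf
    refine summable_of_sum_le (c := ∫ x, ‖A‖ * c x ∂μ)
      (fun i => integral_nonneg fun x => norm_nonneg _) fun F => ?_
    rw [← integral_finsetSum _ fun i _ => (hint (e i) (f i)).norm]
    refine integral_mono (integrable_finsetSum _ fun i _ => (hint (e i) (f i)).norm)
      (hc.const_mul _) fun x => ?_
    simp only [hA]
    exact (sum_norm_inner_mul_inner_le he hf _ _ F).trans (hbA x)
  refine ⟨fun ι e f he hf => ?_, fun ι e => ?_⟩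
  · refine (hsum ι e f he hf).of_nonneg_of_le (fun i => norm_nonneg _) fun i => ?_
    rw [ContinuousLinearMap.comp_apply, ← hT]
    exact norm_integral_le_integral_norm _
  · have := e.orthonormal.countable_of_separable
    have h := hasSum_integral_of_summable_integral_norm (μ := μ)
      (F := fun i x => inner ℂ (e i) (a x) * inner ℂ (b x) (A (e i)))
      (fun i => hint (e i) (e i)) (hsum ι e e e.orthonormal e.orthonormal)
    simp only [hT] at h
    have heq : ∀ x, inner ℂ (b x) (A (a x))
        = ∑' i, inner ℂ (e i) (a x) * inner ℂ (b x) (A (e i)) := fun x => by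
      simp only [hA]
      rw [← e.tsum_inner_mul_inner]
      exact tsum_congr fun i => mul_comm _ _
    simp only [heq]
    exact h

/-- The trace of an operator is unique. -/
theorem HasTrace.unique [CompleteSpace H] {T : H →L[ℂ] H} {t t' : ℂ} (h : HasTrace T t)
    (h' : HasTrace T t') : t = t' := by
  obtain ⟨w, b, -⟩ := exists_hilbertBasis ℂ H
  exact (h.2 w b).unique (h'.2 w b)

end Trace

/-! ### Logarithmic coordinates on half-lines and orbits -/

/-- The sign `s` as a real number. -/
noncomputable abbrev sgnR (s : ℤˣ) : ℝ := ((s : ℤ) : ℝ)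

theorem sgnR_mul_self (s : ℤˣ) : sgnR s * sgnR s = 1 := by
  rcases Int.units_eq_one_or s with h | h <;> simp [sgnR, h]

theorem sgnR_ne_zero (s : ℤˣ) : sgnR s ≠ 0 := fun h => by simpa [h] using sgnR_mul_self s

theorem abs_sgnR (s : ℤˣ) : |sgnR s| = 1 := by
  rcases Int.units_eq_one_or s with h | h <;> simp [sgnR, h]

/-- The parametrization `p ↦ ± e^p` of the half-line `(0, ±∞)`. -/
noncomputable def sexp (s : ℤˣ) (p : ℝ) : ℝ := sgnR s * Real.exp p

theorem abs_sexp (s : ℤˣ) (p : ℝ) : |sexp s p| = Real.exp p := by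
  rw [sexp, abs_mul, abs_sgnR, one_mul, Real.abs_exp]

theorem sexp_ne_zero (s : ℤˣ) (p : ℝ) : sexp s p ≠ 0 :=
  mul_ne_zero (sgnR_ne_zero s) (Real.exp_ne_zero p)

theorem sexp_mem_halfLine (s : ℤˣ) (p : ℝ) : sexp s p ∈ halfLine s := by
  change 0 < sgnR s * (sgnR s * Real.exp p)
  rw [← mul_assoc, sgnR_mul_self, one_mul]
  exact Real.exp_pos p

theorem sexp_add (s : ℤˣ) (p q : ℝ) : sexp s (p + q) = Real.exp q * sexp s p := by
  rw [sexp, sexp, Real.exp_add]; ring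

theorem sexp_log_abs {s : ℤˣ} {r : ℝ} (hr : r ∈ halfLine s) : sexp s (Real.log |r|) = r := by
  have h : 0 < sgnR s * r := hr
  have h0 : r ≠ 0 := by rintro rfl; simp at h
  have h1 : |r| = sgnR s * r := by
    rw [← abs_of_pos h, abs_mul, abs_sgnR, one_mul]
  rw [sexp, Real.exp_log (abs_pos.2 h0), h1, ← mul_assoc, sgnR_mul_self, one_mul]

theorem continuous_sexp (s : ℤˣ) : Continuous (sexp s) := by unfold sexp; fun_prop

theorem hasDerivAt_sexp (s : ℤˣ) (p : ℝ) : HasDerivAt (sexp s) (sexp s p) p :=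
  (Real.hasDerivAt_exp p).const_mul _

theorem sexp_injective (s : ℤˣ) : Function.Injective (sexp s) := fun _ _ h =>
  Real.exp_injective (mul_left_cancel₀ (sgnR_ne_zero s) h)

theorem range_sexp (s : ℤˣ) : Set.range (sexp s) = halfLine s := by
  ext r
  refine ⟨?_, fun h => ⟨_, sexp_log_abs h⟩⟩
  rintro ⟨p, rfl⟩
  exact sexp_mem_halfLine s p

theorem measurableEmbedding_sexp (s : ℤˣ) : MeasurableEmbedding (sexp s) :=
  (continuous_sexp s).measurableEmbedding (sexp_injective s)

theorem measurePreserving_sexp (s : ℤˣ) : MeasurePreserving (sexp s) volume (halfMeas s) := by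
  refine ⟨(continuous_sexp s).measurable, ?_⟩
  have hD : Measurable fun r : ℝ => ENNReal.ofReal (1 / |r|) := by fun_prop
  ext S hS
  rw [Measure.map_apply (continuous_sexp s).measurable hS, halfMeas, withDensity_apply _ hS,
    Measure.restrict_restrict hS, ← lintegral_indicator (hS.inter (measurableSet_halfLine s))]
  have h := lintegral_image_eq_lintegral_abs_deriv_mul (f := sexp s) (f' := sexp s)
    MeasurableSet.univ (fun p _ => (hasDerivAt_sexp s p).hasDerivWithinAt)
    (sexp_injective s).injOn (S.indicator fun r => ENNReal.ofReal (1 / |r|))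
  rw [Set.image_univ, range_sexp, ← lintegral_indicator (measurableSet_halfLine s),
    Set.indicator_indicator, Set.inter_comm] at h
  rw [h, Measure.restrict_univ,
    ← lintegral_indicator_one ((continuous_sexp s).measurable hS)]
  refine lintegral_congr fun p => ?_
  by_cases hp : sexp s p ∈ S
  · rw [Set.indicator_of_mem hp, Set.indicator_of_mem (by exact hp),
      ← ENNReal.ofReal_mul (abs_nonneg _), mul_one_div_cancel (abs_pos.2 (sexp_ne_zero s p)).ne']
    simp
  · rw [Set.indicator_of_notMem hp, Set.indicator_of_notMem (by exact hp), mul_zero]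

instance sigmaFinite_halfMeas (s : ℤˣ) : SigmaFinite (halfMeas s) := by
  unfold halfMeas
  exact SigmaFinite.withDensity_of_ne_top' fun r => ENNReal.ofReal_ne_top

instance separableSpace_hilbK (s : ℤˣ) : TopologicalSpace.SeparableSpace (HilbK s) :=
  have : Fact ((2 : ENNReal) ≠ ⊤) := ⟨by norm_num⟩
  inferInstance

theorem integral_halfMeas (s : ℤˣ) (F : ℝ → ℂ) :
    ∫ r, F r ∂halfMeas s = ∫ p, F (sexp s p) :=
  ((measurePreserving_sexp s).integral_comp (measurableEmbedding_sexp s) F).symm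

theorem inner_hilbK (s : ℤˣ) (φ ψ : HilbK s) :
    inner ℂ φ ψ = ∫ p, (starRingEnd ℂ) (φ (sexp s p)) * ψ (sexp s p) := by
  rw [L2.inner_def, integral_halfMeas]
  simp [mul_comm]

theorem ae_sexp {s : ℤˣ} {P : ℝ → Prop} (h : ∀ᵐ r ∂halfMeas s, P r) :
    ∀ᵐ p : ℝ, P (sexp s p) :=
  (measurePreserving_sexp s).quasiMeasurePreserving.ae h

theorem rep_coe (s : ℤˣ) (g : Aff) (ψ : HilbK s) :
    (rep s g ψ : ℝ → ℂ) =ᵐ[halfMeas s] fun r => phase g.b r * ψ (g.a * r) :=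
  MemLp.coeFn_toLp (rep_memLp s g ψ)

theorem norm_rep_le (s : ℤˣ) (g : Aff) : ‖rep s g‖ ≤ 1 :=
  LinearMap.mkContinuous_norm_le _ zero_le_one _

theorem inner_rep (s : ℤˣ) (g : Aff) (φ ψ : HilbK s) :
    inner ℂ φ (rep s g ψ) = ∫ p, (starRingEnd ℂ) (φ (sexp s p)) *
      (phase g.b (sexp s p) * ψ (sexp s (p + Real.log g.a))) := by
  rw [inner_hilbK]
  refine integral_congr_ae ?_
  filter_upwards [ae_sexp (rep_coe s g ψ)] with p hp
  rw [hp, sexp_add, Real.exp_log g.a_pos]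

/-- Log coordinates `(x, η) ↦ (x, ± e^η)` on the orbit `±Π`. -/
noncomputable def orbitParam (s : ℤˣ) (p : ℝ × ℝ) : ℝ × ℝ := (p.1, sexp s p.2)

theorem orbitParam_mem (s : ℤˣ) (p : ℝ × ℝ) : orbitParam s p ∈ orbit s :=
  sexp_mem_halfLine s p.2

theorem continuous_orbitParam (s : ℤˣ) : Continuous (orbitParam s) := by
  have := continuous_sexp s
  unfold orbitParam; fun_prop

theorem orbitParam_injective (s : ℤˣ) : Function.Injective (orbitParam s) := by
  intro p q h
  obtain ⟨h1, h2⟩ := Prod.ext_iff.1 h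
  exact Prod.ext h1 (sexp_injective s h2)

theorem measurableEmbedding_orbitParam (s : ℤˣ) : MeasurableEmbedding (orbitParam s) :=
  (continuous_orbitParam s).measurableEmbedding (orbitParam_injective s)

theorem isOpen_orbit (s : ℤˣ) : IsOpen (orbit s) :=
  isOpen_lt continuous_const (continuous_const.mul continuous_snd)

theorem orbit_eq_prod (s : ℤˣ) : orbit s = Set.univ ×ˢ halfLine s := by
  ext z; simp [orbit, halfLine]

theorem leftMeas_restrict (s : ℤˣ) :
    leftMeas.restrict (orbit s) = (volume : Measure ℝ).prod (halfMeas s) := by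
  have hD : Measurable fun r : ℝ => ENNReal.ofReal (1 / |r|) := by fun_prop
  rw [leftMeas, restrict_withDensity (isOpen_orbit s).measurableSet, orbit_eq_prod,
    Measure.volume_eq_prod, ← Measure.prod_restrict, halfMeas, prod_withDensity_right hD,
    Measure.restrict_univ]

theorem measurePreserving_orbitParam (s : ℤˣ) :
    MeasurePreserving (orbitParam s) volume (leftMeas.restrict (orbit s)) := by
  rw [leftMeas_restrict, Measure.volume_eq_prod]
  exact (MeasurePreserving.id (volume : Measure ℝ)).prod (measurePreserving_sexp s)

theorem integral_leftMeas (s : ℤˣ) (F : ℝ × ℝ → ℂ) :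
    ∫ z in orbit s, F z ∂leftMeas = ∫ p, F (orbitParam s p) :=
  ((measurePreserving_orbitParam s).integral_comp (measurableEmbedding_orbitParam s) F).symm

theorem integrableOn_leftMeas (s : ℤˣ) (F : ℝ × ℝ → ℂ) :
    IntegrableOn F (orbit s) leftMeas ↔ Integrable (fun p => F (orbitParam s p)) :=
  ((measurePreserving_orbitParam s).integrable_comp_emb (measurableEmbedding_orbitParam s)).symm

/-! #### The right measure -/

theorem orbInv_orbInv {s : ℤˣ} {z : ℝ × ℝ} (hz : z ∈ orbit s) : orbInv (orbInv z) = z := by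
  have h : z.2 ≠ 0 := by
    rintro h
    simp [orbit, h] at hz
  ext
  · simp only [orbInv]; field_simp
  · simp only [orbInv]; field_simp

theorem orbInv_mem {s : ℤˣ} {z : ℝ × ℝ} (hz : z ∈ orbit s) : orbInv z ∈ orbit s := by
  have h : 0 < sgnR s * z.2 := hz
  change 0 < sgnR s * (1 / z.2)
  have h2 : sgnR s * (1 / z.2) = sgnR s * z.2 / z.2 ^ 2 := by
    have : z.2 ≠ 0 := by rintro h'; simp [h'] at h
    field_simp
  have : z.2 ≠ 0 := by rintro h'; simp [h'] at h
  rw [h2]; positivity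

theorem orbInv_orbitParam (s : ℤˣ) (p : ℝ × ℝ) :
    orbInv (orbitParam s p) = (-(p.1 * sexp s (-p.2)), sexp s (-p.2)) := by
  have h : 1 / sexp s p.2 = sexp s (-p.2) := by
    rw [sexp, sexp, Real.exp_neg, one_div, mul_inv]
    congr 1
    exact inv_eq_of_mul_eq_one_left (sgnR_mul_self s)
  rw [orbInv, orbitParam, h, neg_div, div_eq_mul_one_div p.1, h]

theorem measurableEmbedding_orbInv_orbitParam (s : ℤˣ) :
    MeasurableEmbedding fun p => orbInv (orbitParam s p) := by
  refine Continuous.measurableEmbedding ?_ ?_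
  · have := continuous_sexp s
    simp only [orbInv_orbitParam]; fun_prop
  · intro p q h
    have h' := congrArg orbInv h
    rw [orbInv_orbInv (orbitParam_mem s p), orbInv_orbInv (orbitParam_mem s q)] at h'
    exact orbitParam_injective s h'

theorem measurePreserving_orbInv_orbitParam (s : ℤˣ) :
    MeasurePreserving (fun p => orbInv (orbitParam s p)) volume
      (rightMeas.restrict (orbit s)) := by
  refine ⟨(measurableEmbedding_orbInv_orbitParam s).measurable, ?_⟩
  have hD : Measurable fun z : ℝ × ℝ => ENNReal.ofReal (1 / |z.2|) := by fun_prop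
  have hR : rightMeas.restrict (orbit s)
      = (leftMeas.restrict (orbit s)).withDensity fun z => ENNReal.ofReal (1 / |z.2|) := by
    rw [rightMeas, leftMeas, restrict_withDensity (isOpen_orbit s).measurableSet,
      restrict_withDensity (isOpen_orbit s).measurableSet, ← withDensity_mul _ hD hD]
    congr 1
    ext z
    rw [Pi.mul_apply, ← ENNReal.ofReal_mul (by positivity), ← sq_abs]
    congr 1
    ring
  ext S hS
  rw [Measure.map_apply (measurableEmbedding_orbInv_orbitParam s).measurable hS, hR,
    withDensity_apply _ hS, ← lintegral_indicator hS,
    ← (measurePreserving_orbitParam s).lintegral_comp (hD.indicator hS),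
    ← lintegral_indicator_one ((measurableEmbedding_orbInv_orbitParam s).measurable hS)]
  have hm1 : Measurable fun p => S.indicator (fun z : ℝ × ℝ => ENNReal.ofReal (1 / |z.2|))
      (orbitParam s p) := (hD.indicator hS).comp (continuous_orbitParam s).measurable
  have hm2 : Measurable (((fun p => orbInv (orbitParam s p)) ⁻¹' S).indicator
      (1 : ℝ × ℝ → ENNReal)) :=
    measurable_one.indicator ((measurableEmbedding_orbInv_orbitParam s).measurable hS)
  rw [Measure.volume_eq_prod, lintegral_prod_symm' _ hm1, lintegral_prod_symm' _ hm2]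
  rw [← lintegral_neg_eq_self]
  refine lintegral_congr fun η => ?_
  have h0 := sexp_ne_zero s η
  -- the substitution `x ↦ -x y` on the line of height `y = ± e^η`
  have key : ∀ G : ℝ → ENNReal, Measurable G →
      ∫⁻ x, G (-(x * sexp s η)) = ENNReal.ofReal (1 / |sexp s η|) * ∫⁻ x, G x := by
    intro G hG
    have h1 := lintegral_map (μ := volume) hG (measurable_const_mul (-sexp s η))
    rw [Real.map_volume_mul_left (neg_ne_zero.2 h0), lintegral_smul_measure, abs_inv, abs_neg,
      ← one_div, smul_eq_mul] at h1
    rw [h1]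
    refine lintegral_congr fun x => ?_
    congr 1; ring
  have hG : Measurable fun x => S.indicator (1 : ℝ × ℝ → ENNReal) (x, sexp s η) :=
    (measurable_one.indicator hS).comp (by fun_prop)
  have e1 : ∀ x : ℝ, ((fun p => orbInv (orbitParam s p)) ⁻¹' S).indicator
      (1 : ℝ × ℝ → ENNReal) (x, -η)
      = (fun x => S.indicator (1 : ℝ × ℝ → ENNReal) (x, sexp s η)) (-(x * sexp s η)) := by
    intro x
    have := orbInv_orbitParam s (x, -η)
    simp only [neg_neg] at this
    have hmem : (x, -η) ∈ (fun p => orbInv (orbitParam s p)) ⁻¹' S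
        ↔ (-(x * sexp s η), sexp s η) ∈ S := by rw [Set.mem_preimage, this]
    by_cases h : (-(x * sexp s η), sexp s η) ∈ S
    · exact (Set.indicator_of_mem (hmem.2 h) 1).trans (Set.indicator_of_mem h 1).symm
    · exact (Set.indicator_of_notMem (mt hmem.1 h) 1).trans
        (Set.indicator_of_notMem h 1).symm
  have e2 : ∀ x : ℝ, S.indicator (fun z : ℝ × ℝ => ENNReal.ofReal (1 / |z.2|))
      (orbitParam s (x, η)) = ENNReal.ofReal (1 / |sexp s η|) *
        S.indicator (1 : ℝ × ℝ → ENNReal) (x, sexp s η) := by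
    intro x
    by_cases h : (x, sexp s η) ∈ S
    · rw [Set.indicator_of_mem h, orbitParam, Set.indicator_of_mem h]; simp
    · rw [Set.indicator_of_notMem h, orbitParam, Set.indicator_of_notMem h, mul_zero]
  simp only [e1, e2]
  rw [key _ hG, lintegral_const_mul _ hG]

/-- The inversion of the orbit carries the right measure to the left measure. -/
theorem integral_rightMeas (s : ℤˣ) (F : ℝ × ℝ → ℂ) :
    ∫ z in orbit s, F z ∂rightMeas = ∫ z in orbit s, F (orbInv z) ∂leftMeas := by
  rw [integral_leftMeas]
  exact ((measurePreserving_orbInv_orbitParam s).integral_comp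
    (measurableEmbedding_orbInv_orbitParam s) F).symm

theorem integrableOn_rightMeas (s : ℤˣ) (F : ℝ × ℝ → ℂ) :
    IntegrableOn F (orbit s) rightMeas ↔
      IntegrableOn (fun z => F (orbInv z)) (orbit s) leftMeas := by
  rw [integrableOn_leftMeas]
  exact ((measurePreserving_orbInv_orbitParam s).integrable_comp_emb
    (measurableEmbedding_orbInv_orbitParam s)).symm

/-! ### The function `lam` -/

/-- `lam` is the inverse of the divided difference of the exponential function; this gives its
smoothness at `0`. -/
theorem lam_eq_inv_dslope (t : ℝ) : lam t = ((dslope Complex.exp 0 (-t : ℝ)).re)⁻¹ := by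
  by_cases h : t = 0
  · simp [h, lam, dslope_same]
  · have h2 : (((-t : ℝ)) : ℂ) ≠ 0 := by exact_mod_cast neg_ne_zero.2 h
    rw [dslope_of_ne _ h2, lam, if_neg h, slope_def_field, Complex.exp_zero, sub_zero,
      ← Complex.ofReal_exp, ← Complex.ofReal_one, ← Complex.ofReal_sub, ← Complex.ofReal_div,
      Complex.ofReal_re, inv_div, neg_div, ← div_neg, neg_sub]

theorem lam_pos (t : ℝ) : 0 < lam t := by
  rcases lt_trichotomy t 0 with h | h | h
  · rw [lam, if_neg h.ne]
    have : 1 < Real.exp (-t) := Real.one_lt_exp_iff.2 (by linarith)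
    exact div_pos_of_neg_of_neg h (by linarith)
  · simp [h, lam]
  · rw [lam, if_neg h.ne']
    have : Real.exp (-t) < 1 := Real.exp_lt_one_iff.2 (by linarith)
    exact div_pos h (by linarith)

theorem lam_zero : lam 0 = 1 := if_pos rfl

theorem lam_eq_exp_mul (t : ℝ) : lam t = Real.exp t * lam (-t) := by
  by_cases h : t = 0
  · simp [h, lam]
  · have h1 : 1 - Real.exp t ≠ 0 := fun h' => h ((Real.exp_eq_one_iff t).1 (by linarith))
    have h2 : 1 - Real.exp (-t) ≠ 0 := fun h' =>
      h (neg_eq_zero.1 ((Real.exp_eq_one_iff (-t)).1 (by linarith)))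
    rw [lam, lam, if_neg h, if_neg (neg_ne_zero.2 h), neg_neg]
    rw [Real.exp_neg] at *
    have := Real.exp_pos t
    field_simp
    field_simp at h2
    have h3 : Real.exp t - 1 ≠ 0 := fun h' => h1 (by linarith)
    field_simp
    ring

theorem lam_log_mul {a : ℝ} (ha : 0 < a) :
    lam (Real.log a) / a = lam (-Real.log a) := by
  rw [lam_eq_exp_mul, Real.exp_log ha, mul_div_cancel_left₀ _ ha.ne']

theorem contDiff_lam : ContDiff ℝ ∞ lam := by
  have h1 : Differentiable ℂ (dslope Complex.exp 0) := by
    rw [← differentiableOn_univ, Complex.differentiableOn_dslope Filter.univ_mem,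
      differentiableOn_univ]
    exact Complex.differentiable_exp
  have h2 : ContDiff ℝ ∞ (dslope Complex.exp 0) := (h1.contDiff (n := ∞)).restrict_scalars ℝ
  have h3 : ContDiff ℝ ∞ fun t : ℝ => (dslope Complex.exp 0 (-t : ℝ)).re :=
    Complex.reCLM.contDiff.comp (h2.comp (Complex.ofRealCLM.contDiff.comp contDiff_neg))
  have h4 : lam = fun t : ℝ => ((dslope Complex.exp 0 (-t : ℝ)).re)⁻¹ :=
    funext lam_eq_inv_dslope
  rw [h4]
  refine h3.inv fun t h => ?_
  have := lam_pos t
  rw [lam_eq_inv_dslope, h, inv_zero] at this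
  exact this.false

theorem lam_monotone : Monotone lam := by
  -- `lam (t)⁻¹` is the slope at `0` of the convex function `exp`, evaluated at `-t`
  have h : ∀ t : ℝ, t ≠ 0 → lam t = ((Real.exp (-t) - Real.exp 0) / (-t - 0))⁻¹ := by
    intro t ht
    rw [lam, if_neg ht, inv_div, Real.exp_zero, sub_zero, neg_div, ← div_neg, neg_sub]
  have hmono : ∀ t u : ℝ, t ≠ 0 → u ≠ 0 → t < u → lam t ≤ lam u := by
    intro t u ht hu htu
    have hs := convexOn_exp.secant_mono (Set.mem_univ 0) (Set.mem_univ (-u)) (Set.mem_univ (-t))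
      (neg_ne_zero.2 hu) (neg_ne_zero.2 ht) (by linarith)
    have hp : 0 < (Real.exp (-u) - Real.exp 0) / (-u - 0) := by
      have := lam_pos u
      rw [h u hu] at this
      exact inv_pos.1 this
    rw [h t ht, h u hu]
    exact inv_anti₀ hp hs
  have hd : Dense ({0}ᶜ : Set ℝ) := dense_compl_singleton 0
  have hc : Continuous lam := contDiff_lam.continuous
  intro t u htu
  rcases htu.eq_or_lt with rfl | htu
  · exact le_rfl
  by_cases ht : t = 0
  · subst ht
    refine le_of_tendsto (f := lam) (x := nhdsWithin (0 : ℝ) (Set.Ioi 0))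
      (hc.continuousAt.mono_left nhdsWithin_le_nhds) ?_
    filter_upwards [Ioo_mem_nhdsGT htu] with x hx
    exact hmono x u hx.1.ne' htu.ne' hx.2
  by_cases hu : u = 0
  · subst hu
    refine ge_of_tendsto (f := lam) (x := nhdsWithin (0 : ℝ) (Set.Iio 0))
      (hc.continuousAt.mono_left nhdsWithin_le_nhds) ?_
    filter_upwards [Ioo_mem_nhdsLT htu] with x hx
    exact hmono t x ht hx.2.ne hx.1
  exact hmono t u ht hu htu

/-- The logarithm of `lam`. -/
noncomputable def loglam (t : ℝ) : ℝ := Real.log (lam t)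

theorem exp_loglam (t : ℝ) : Real.exp (loglam t) = lam t := Real.exp_log (lam_pos t)

theorem loglam_zero : loglam 0 = 0 := by simp [loglam, lam_zero]

theorem loglam_eq (t : ℝ) : loglam t = t + loglam (-t) := by
  rw [loglam, loglam, lam_eq_exp_mul, Real.log_mul (Real.exp_ne_zero t) (lam_pos _).ne',
    Real.log_exp]

theorem contDiff_loglam : ContDiff ℝ ∞ loglam := contDiff_lam.log fun t => (lam_pos t).ne'

theorem loglam_monotone : Monotone loglam := fun t _ h =>
  Real.log_le_log (lam_pos t) (lam_monotone h)

theorem hasDerivAt_loglam (t : ℝ) : HasDerivAt loglam (deriv loglam t) t :=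
  (contDiff_loglam.differentiable (by simp)).differentiableAt.hasDerivAt

/-- `loglam` is monotone, and `t - loglam t = -loglam (-t)` is monotone as well. -/
theorem abs_loglam_le (t : ℝ) : |loglam t| ≤ |t| := by
  have key : ∀ t : ℝ, 0 ≤ t → 0 ≤ loglam t ∧ loglam t ≤ t := by
    intro t ht
    have h1 := loglam_monotone ht
    have h2 := loglam_monotone (neg_nonpos.2 ht)
    rw [loglam_zero] at h1 h2
    exact ⟨h1, by linarith [loglam_eq t]⟩
  rcases le_total 0 t with ht | ht
  · rw [abs_of_nonneg ht, abs_of_nonneg (key t ht).1]; exact (key t ht).2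
  · have h := key (-t) (by linarith)
    have h2 := loglam_eq t
    rw [abs_of_nonpos ht, abs_of_nonpos (by linarith)]
    linarith

theorem deriv_loglam_mem (t : ℝ) : 0 ≤ deriv loglam t ∧ deriv loglam t ≤ 1 := by
  refine ⟨loglam_monotone.deriv_nonneg, ?_⟩
  have h1 : HasDerivAt (fun t => t + loglam (-t)) (1 + deriv loglam (-t) * (-1)) t :=
    (hasDerivAt_id t).add ((hasDerivAt_loglam (-t)).comp t (hasDerivAt_neg t))
  have h2 : loglam = fun t => t + loglam (-t) := funext loglam_eq
  have h3 : deriv loglam t = 1 + deriv loglam (-t) * (-1) := by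
    conv_lhs => rw [h2]
    exact h1.deriv
  have h4 : 0 ≤ deriv loglam (-t) := loglam_monotone.deriv_nonneg
  linarith

/-! ### Partial Fourier transforms of test functions on the plane -/

open scoped FourierTransform

/-- Smooth compactly supported functions on the plane. -/
def IsTest (g : ℝ × ℝ → ℂ) : Prop := ContDiff ℝ ∞ g ∧ HasCompactSupport g

/-- The Fourier transform in the first variable, `∫ exp (-2 π i x w) g (x, y) dx`. -/
noncomputable def pft (g : ℝ × ℝ → ℂ) (w y : ℝ) : ℂ := 𝓕 (fun x : ℝ => g (x, y)) w

/-- The partial derivative in the first variable. -/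
noncomputable def pd1 (g : ℝ × ℝ → ℂ) (z : ℝ × ℝ) : ℂ := fderiv ℝ g z (1, 0)

/-- The partial derivative in the second variable. -/
noncomputable def pd2 (g : ℝ × ℝ → ℂ) (z : ℝ × ℝ) : ℂ := fderiv ℝ g z (0, 1)

theorem pft_eq (g : ℝ × ℝ → ℂ) (w y : ℝ) :
    pft g w y = ∫ x : ℝ, Complex.exp (-(2 * Real.pi * Complex.I * x) * w) * g (x, y) := by
  rw [pft, Real.fourier_real_eq_integral_exp_smul]
  refine integral_congr_ae (Filter.Eventually.of_forall fun x => ?_)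
  simp only [smul_eq_mul]
  congr 2
  push_cast; ring

/-- Differentiation under the integral sign for a smooth integrand that vanishes off a fixed compact
interval. -/
theorem hasFDerivAt_integral_of_contDiff {F : ℝ → ℝ × ℝ → ℂ} {R : ℝ}
    (hF : ContDiff ℝ ∞ (Function.uncurry F)) (hsupp : ∀ x p, x ∉ Set.Icc (-R) R → F x p = 0)
    (p₀ : ℝ × ℝ) : Integrable (fun x => fderiv ℝ (F x) p₀) ∧
      HasFDerivAt (fun p => ∫ x, F x p) (∫ x, fderiv ℝ (F x) p₀) p₀ := by
  have hD : ∀ x p, HasFDerivAt (F x) (fderiv ℝ (F x) p) p := fun x p =>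
    (((hF.comp (contDiff_const.prodMk contDiff_id) : ContDiff ℝ ∞ fun p => F x p).differentiable
      (by simp)) p).hasFDerivAt
  have hD' : Continuous fun q : ℝ × (ℝ × ℝ) => fderiv ℝ (F q.1) q.2 := by
    have h1 : ContDiff ℝ ∞ (Function.uncurry fun (q : ℝ × (ℝ × ℝ)) (p : ℝ × ℝ) => F q.1 p) :=
      hF.comp (by fun_prop : ContDiff ℝ ∞ fun r : (ℝ × (ℝ × ℝ)) × (ℝ × ℝ) => (r.1.1, r.2))
    exact (ContDiff.fderiv (n := 0) h1 contDiff_snd (by simp)).continuous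
  have hsupp' : ∀ x p, x ∉ Set.Icc (-R) R → fderiv ℝ (F x) p = 0 := by
    intro x p hx
    have : F x = fun _ => 0 := funext fun p => hsupp x p hx
    rw [this]; simp
  obtain ⟨M, hM⟩ := ((isCompact_Icc (a := -R) (b := R)).prod
    (isCompact_closedBall p₀ 1)).exists_bound_of_continuousOn hD'.continuousOn
  have hc : Continuous fun x : ℝ => fderiv ℝ (F x) p₀ :=
    hD'.comp (by fun_prop : Continuous fun x : ℝ => (x, p₀))
  have hFc : ∀ p, Continuous fun x : ℝ => F x p := fun p =>
    hF.continuous.comp (by fun_prop : Continuous fun x : ℝ => (x, p))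
  refine ⟨hc.integrable_of_hasCompactSupport
    (HasCompactSupport.intro isCompact_Icc fun x hx => hsupp' x p₀ hx), ?_⟩
  refine hasFDerivAt_integral_of_dominated_of_fderiv_le (μ := volume)
    (F := fun p x => F x p) (F' := fun p x => fderiv ℝ (F x) p) (x₀ := p₀)
    (bound := (Set.Icc (-R) R).indicator fun _ => M)
    (Metric.ball_mem_nhds p₀ one_pos)
    (Filter.Eventually.of_forall fun p => (hFc p).aestronglyMeasurable)
    ((hFc p₀).integrable_of_hasCompactSupport
      (HasCompactSupport.intro isCompact_Icc fun x hx => hsupp x p₀ hx))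
    hc.aestronglyMeasurable
    (Filter.Eventually.of_forall fun x p hp => ?_)
    ((integrable_indicator_iff measurableSet_Icc).2 (integrableOn_const (by simp)))
    (Filter.Eventually.of_forall fun x p _ => hD x p)
  by_cases hx : x ∈ Set.Icc (-R) R
  · rw [Set.indicator_of_mem hx]
    exact hM (x, p) ⟨hx, Metric.ball_subset_closedBall hp⟩
  · rw [Set.indicator_of_notMem hx, hsupp' x p hx, norm_zero]

namespace IsTest

variable {g h : ℝ × ℝ → ℂ}

theorem pd1 (hg : IsTest g) : IsTest (pd1 g) :=
  ⟨(hg.1.fderiv_right (by simp)).clm_apply contDiff_const,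
    hg.2.fderiv_apply (𝕜 := ℝ) (1, 0)⟩

theorem pd2 (hg : IsTest g) : IsTest (pd2 g) :=
  ⟨(hg.1.fderiv_right (by simp)).clm_apply contDiff_const,
    hg.2.fderiv_apply (𝕜 := ℝ) (0, 1)⟩

theorem mul (hg : IsTest g) (hh : ContDiff ℝ ∞ h) : IsTest fun z => h z * g z :=
  ⟨hh.mul hg.1, hg.2.mul_left⟩

theorem add (hg : IsTest g) (hh : IsTest h) : IsTest fun z => g z + h z :=
  ⟨hg.1.add hh.1, hg.2.add hh.2⟩

theorem exists_bound (hg : IsTest g) :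
    ∃ R : ℝ, 0 < R ∧ ∀ x y, g (x, y) ≠ 0 → |x| ≤ R ∧ |y| ≤ R := by
  obtain ⟨R, hR⟩ := hg.2.isCompact.isBounded.exists_norm_le
  refine ⟨max R 1, by positivity, fun x y h => ?_⟩
  have h1 := hR (x, y) (subset_tsupport g h)
  rw [Prod.norm_def] at h1
  exact ⟨(le_max_left _ _).trans (h1.trans (le_max_left _ _)),
    (le_max_right _ _).trans (h1.trans (le_max_left _ _))⟩

theorem continuous_slice (hg : IsTest g) (y : ℝ) : Continuous fun x : ℝ => g (x, y) :=
  hg.1.continuous.comp (by fun_prop)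

theorem slice_support (hg : IsTest g) (y : ℝ) : HasCompactSupport fun x : ℝ => g (x, y) := by
  obtain ⟨R, -, hR⟩ := hg.exists_bound
  refine HasCompactSupport.intro (isCompact_Icc (a := -R) (b := R)) fun x hx => ?_
  by_contra h
  exact hx (abs_le.1 (hR x y h).1)

theorem integrable_slice (hg : IsTest g) (y : ℝ) : Integrable fun x : ℝ => g (x, y) :=
  (hg.continuous_slice y).integrable_of_hasCompactSupport (hg.slice_support y)

theorem hasDerivAt_slice (hg : IsTest g) (x y : ℝ) :
    HasDerivAt (fun x : ℝ => g (x, y)) (_root_.pd1 g (x, y)) x := by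
  have h1 : HasDerivAt (fun x : ℝ => (x, y)) ((1 : ℝ), (0 : ℝ)) x :=
    (hasDerivAt_id x).prodMk (hasDerivAt_const x y)
  exact ((hg.1.differentiable (by simp)) (x, y)).hasFDerivAt.comp_hasDerivAt x h1

theorem pft_pd1 (hg : IsTest g) (w y : ℝ) :
    pft (_root_.pd1 g) w y = 2 * Real.pi * Complex.I * w * pft g w y := by
  have hd : deriv (fun x : ℝ => g (x, y)) = fun x => _root_.pd1 g (x, y) :=
    funext fun x => (hg.hasDerivAt_slice x y).deriv
  have h := Real.fourier_deriv (hg.integrable_slice y)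
    (fun x => (hg.hasDerivAt_slice x y).differentiableAt)
    (by rw [hd]; exact hg.pd1.integrable_slice y)
  rw [hd] at h
  exact congrFun h w

theorem pft_add (hg : IsTest g) (hh : IsTest h) (w y : ℝ) :
    pft (fun z => g z + h z) w y = pft g w y + pft h w y := by
  have h1 : Integrable fun x : ℝ =>
      Complex.exp (-(2 * Real.pi * Complex.I * x) * w) * g (x, y) :=
    ((hg.continuous_slice y).mul (by fun_prop) |>.congr fun x => mul_comm _ _)
      |>.integrable_of_hasCompactSupport (hg.slice_support y).mul_left
  have h2 : Integrable fun x : ℝ =>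
      Complex.exp (-(2 * Real.pi * Complex.I * x) * w) * h (x, y) :=
    ((hh.continuous_slice y).mul (by fun_prop) |>.congr fun x => mul_comm _ _)
      |>.integrable_of_hasCompactSupport (hh.slice_support y).mul_left
  simp only [pft_eq, mul_add]
  exact integral_add h1 h2

theorem pft_const_mul (c : ℂ) (w y : ℝ) :
    pft (fun z => c * g z) w y = c * pft g w y := by
  simp only [pft_eq, ← integral_const_mul]
  exact integral_congr_ae (Filter.Eventually.of_forall fun x => by ring)

theorem norm_pft_le (g : ℝ × ℝ → ℂ) (w y : ℝ) : ‖pft g w y‖ ≤ ∫ x, ‖g (x, y)‖ := by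
  rw [pft_eq]
  refine (norm_integral_le_integral_norm _).trans (le_of_eq ?_)
  refine integral_congr_ae (Filter.Eventually.of_forall fun x => ?_)
  have : -(2 * Real.pi * Complex.I * x) * w = ((-(2 * Real.pi * x * w) : ℝ) : ℂ) * Complex.I := by
    push_cast; ring
  simp only [norm_mul, this, Complex.norm_exp_ofReal_mul_I, one_mul]

theorem integral_norm_slice_le (hg : IsTest g) :
    ∃ C : ℝ, ∀ y, ∫ x, ‖g (x, y)‖ ≤ C := by
  obtain ⟨R, hR0, hR⟩ := hg.exists_bound
  obtain ⟨M, hM⟩ := hg.1.continuous.bounded_above_of_compact_support hg.2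
  refine ⟨∫ _ in Set.Icc (-R) R, M, fun y => ?_⟩
  have h0 : ∫ x in Set.Icc (-R) R, ‖g (x, y)‖ = ∫ x, ‖g (x, y)‖ := by
    refine setIntegral_eq_integral_of_forall_compl_eq_zero fun x hx => ?_
    by_contra h
    exact hx (abs_le.1 (hR x y (norm_ne_zero_iff.1 h)).1)
  rw [← h0]
  exact integral_mono (hg.integrable_slice y).norm.integrableOn
    (integrableOn_const (by simp)) fun x => hM _

/-- Partial Fourier transforms decay rapidly, uniformly in the other variable. -/
theorem pft_decay (N : ℕ) : ∀ {g : ℝ × ℝ → ℂ}, IsTest g →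
    ∃ C : ℝ, 0 ≤ C ∧ ∀ w y, ‖pft g w y‖ ≤ C / (1 + w ^ 2) ^ N := by
  induction N with
  | zero =>
    intro g hg
    obtain ⟨C, hC⟩ := hg.integral_norm_slice_le
    refine ⟨C, (integral_nonneg fun x => norm_nonneg (g (x, 0))).trans (hC 0), fun w y => ?_⟩
    simpa using (norm_pft_le g w y).trans (hC y)
  | succ N ih =>
    intro g hg
    -- the operator `1 - (2 π)⁻² ∂²` multiplies the transform by `1 + w²`
    have hL := hg.add (hg.pd1.pd1.mul (contDiff_const (c := -(4 * (Real.pi : ℂ) ^ 2)⁻¹)))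
    obtain ⟨C, hC0, hC⟩ := ih hL
    refine ⟨C, hC0, fun w y => ?_⟩
    have h := hC w y
    rw [hg.pft_add (hg.pd1.pd1.mul contDiff_const), pft_const_mul, hg.pd1.pft_pd1,
      hg.pft_pd1] at h
    have e : pft g w y + -(4 * (Real.pi : ℂ) ^ 2)⁻¹ * (2 * Real.pi * Complex.I * w *
        (2 * Real.pi * Complex.I * w * pft g w y)) = ((1 + w ^ 2 : ℝ) : ℂ) * pft g w y := by
      have hpi : (Real.pi : ℂ) ≠ 0 := by exact_mod_cast Real.pi_ne_zero
      field_simp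
      push_cast
      linear_combination (-4 * (w : ℂ) ^ 2 * pft g w y) * Complex.I_sq
    have hw : 0 < 1 + w ^ 2 := by positivity
    rw [e, norm_mul, Complex.norm_real, Real.norm_of_nonneg hw.le] at h
    rw [le_div_iff₀ (by positivity)] at h ⊢
    calc _ = (1 + w ^ 2) * ‖pft g w y‖ * (1 + w ^ 2) ^ N := by ring
      _ ≤ C := h

theorem integrable_pft (hg : IsTest g) (y : ℝ) : Integrable fun w => pft g w y := by
  obtain ⟨C, -, hC⟩ := pft_decay 1 hg
  refine (integrable_inv_one_add_sq.const_mul C).mono' ?_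
    (Filter.Eventually.of_forall fun w => ?_)
  · exact (VectorFourier.fourierIntegral_continuous Real.continuous_fourierChar
      (by exact (innerSL ℝ).continuous₂) (hg.integrable_slice y)).aestronglyMeasurable
  · simpa [div_eq_mul_inv] using hC w y

theorem pft_inversion (hg : IsTest g) (x y : ℝ) :
    ∫ w : ℝ, Complex.exp (2 * Real.pi * Complex.I * x * w) * pft g w y = g (x, y) := by
  have h := congrFun ((hg.continuous_slice y).fourierInv_fourier_eq (hg.integrable_slice y)
    (hg.integrable_pft y)) x
  rw [Real.fourierInv_eq'] at h
  rw [← h]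
  refine integral_congr_ae (Filter.Eventually.of_forall fun w => ?_)
  simp only [smul_eq_mul]
  congr 2
  simp; ring

/-- The Fourier transform is symmetric for the bilinear pairing. -/
theorem integral_pft_mul (hg : IsTest g) (hh : IsTest h) (y : ℝ) :
    ∫ w, pft g w y * h (w, y) = ∫ x, g (x, y) * pft h x y := by
  have := VectorFourier.integral_fourierIntegral_smul_eq_flip (μ := volume) (ν := volume)
    (L := innerₗ ℝ) Real.continuous_fourierChar (by exact continuous_inner)
    (hg.integrable_slice y) (hh.integrable_slice y)
  simp only [flip_innerₗ, smul_eq_mul] at this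
  exact this

theorem fderiv_exp_mul (hg : IsTest g) (x : ℝ) (p v : ℝ × ℝ) :
    fderiv ℝ (fun p : ℝ × ℝ => Complex.exp (-(2 * Real.pi * Complex.I * x) * p.1) * g (x, p.2)) p v
      = v.1 * (Complex.exp (-(2 * Real.pi * Complex.I * x) * p.1) *
        ((-(2 * Real.pi * Complex.I * x)) * g (x, p.2)))
      + v.2 * (Complex.exp (-(2 * Real.pi * Complex.I * x) * p.1) * _root_.pd2 g (x, p.2)) := by
  have h1 : HasFDerivAt (fun p : ℝ × ℝ => (-(2 * Real.pi * Complex.I * x)) * (p.1 : ℂ))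
      ((-(2 * Real.pi * Complex.I * (x : ℂ))) •
        (Complex.ofRealCLM.comp (ContinuousLinearMap.fst ℝ ℝ ℝ))) p :=
    (Complex.ofRealCLM.comp (ContinuousLinearMap.fst ℝ ℝ ℝ)).hasFDerivAt.const_mul _
  have h2 : HasFDerivAt (fun p : ℝ × ℝ => g (x, p.2))
      ((fderiv ℝ g (x, p.2)).comp
        ((0 : ℝ × ℝ →L[ℝ] ℝ).prod (ContinuousLinearMap.snd ℝ ℝ ℝ))) p :=
    ((hg.1.differentiable (by simp)) (x, p.2)).hasFDerivAt.comp p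
      ((hasFDerivAt_const x p).prodMk hasFDerivAt_snd)
  have h3 : fderiv ℝ g (x, p.2) (0, v.2) = v.2 * _root_.pd2 g (x, p.2) := by
    have : ((0 : ℝ), v.2) = v.2 • ((0 : ℝ), (1 : ℝ)) := by simp
    rw [this, map_smul, Complex.real_smul, _root_.pd2]
  refine (congrArg (fun D : ℝ × ℝ →L[ℝ] ℂ => D v) (h1.cexp.mul h2).fderiv).trans ?_
  simp only [add_apply, smul_apply,
    ContinuousLinearMap.comp_apply, ContinuousLinearMap.prod_apply,
    zero_apply, ContinuousLinearMap.coe_snd',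
    ContinuousLinearMap.coe_fst', Complex.ofRealCLM_apply, smul_eq_mul, h3]
  ring

theorem hasFDerivAt_pft (hg : IsTest g) (p₀ : ℝ × ℝ) :
    ∃ D : ℝ × ℝ →L[ℝ] ℂ, HasFDerivAt (fun p : ℝ × ℝ => pft g p.1 p.2) D p₀ ∧
      ∀ v : ℝ × ℝ, D v = v.1 * pft (fun z => (-(2 * Real.pi * Complex.I * z.1)) * g z) p₀.1 p₀.2
        + v.2 * pft (_root_.pd2 g) p₀.1 p₀.2 := by
  have hF : ContDiff ℝ ∞ (Function.uncurry fun (x : ℝ) (p : ℝ × ℝ) =>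
      Complex.exp (-(2 * Real.pi * Complex.I * x) * p.1) * g (x, p.2)) := by
    have h1 : ContDiff ℝ ∞ fun q : ℝ × (ℝ × ℝ) => g (q.1, q.2.2) := hg.1.comp (by fun_prop)
    have h3 : ContDiff ℝ ∞ fun q : ℝ × (ℝ × ℝ) => (q.1 : ℂ) :=
      Complex.ofRealCLM.contDiff.comp contDiff_fst
    have h4 : ContDiff ℝ ∞ fun q : ℝ × (ℝ × ℝ) => (q.2.1 : ℂ) :=
      Complex.ofRealCLM.contDiff.comp (by fun_prop)
    exact ((contDiff_const.mul h3).neg.mul h4).cexp.mul h1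
  obtain ⟨R, hR0, hR⟩ := hg.exists_bound
  obtain ⟨hint, hderiv⟩ := hasFDerivAt_integral_of_contDiff (R := R) hF (fun x p hx => by
    have : g (x, p.2) = 0 := by
      by_contra h
      exact hx (abs_le.1 (hR x p.2 h).1)
    rw [this, mul_zero]) p₀
  refine ⟨∫ x : ℝ, fderiv ℝ (fun p : ℝ × ℝ =>
    Complex.exp (-(2 * Real.pi * Complex.I * x) * p.1) * g (x, p.2)) p₀, ?_, fun v => ?_⟩
  · simp only [pft_eq]; exact hderiv
  · rw [ContinuousLinearMap.integral_apply hint]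
    simp only [hg.fderiv_exp_mul, pft_eq, ← integral_const_mul]
    refine integral_add ?_ ?_
    · refine Continuous.integrable_of_hasCompactSupport (continuous_const.mul
        (Continuous.mul (by fun_prop) (Continuous.mul (by fun_prop)
          (hg.continuous_slice p₀.2)))) ?_
      exact ((hg.slice_support p₀.2).mul_left.mul_left).mul_left
    · have h0 := hg.pd2.continuous_slice p₀.2
      refine Continuous.integrable_of_hasCompactSupport (by fun_prop) ?_
      exact ((hg.pd2.slice_support p₀.2).mul_left).mul_left

theorem continuous_pft (hg : IsTest g) : Continuous fun p : ℝ × ℝ => pft g p.1 p.2 :=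
  continuous_iff_continuousAt.2 fun p =>
    let ⟨_, h, _⟩ := hg.hasFDerivAt_pft p
    h.continuousAt

theorem hasDerivAt_pft_comp (hg : IsTest g) {w y : ℝ → ℝ} {w' y' t : ℝ}
    (hw : HasDerivAt w w' t) (hy : HasDerivAt y y' t) :
    HasDerivAt (fun t => pft g (w t) (y t))
      (w' * pft (fun z => (-(2 * Real.pi * Complex.I * z.1)) * g z) (w t) (y t)
        + y' * pft (_root_.pd2 g) (w t) (y t)) t := by
  obtain ⟨D, hD, hv⟩ := hg.hasFDerivAt_pft (w t, y t)
  have := hD.comp_hasDerivAt t (hw.prodMk hy)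
  rw [hv] at this
  exact this

theorem fst_mul (hg : IsTest g) :
    IsTest fun z => (-(2 * Real.pi * Complex.I * z.1)) * g z :=
  hg.mul (contDiff_const.mul (Complex.ofRealCLM.contDiff.comp contDiff_fst)).neg

end IsTest

/-! ### Operators with integral kernels -/

theorem Aff.measurable_a : Measurable Aff.a :=
  measurable_fst.comp (comap_measurable fun g : Aff => (g.a, g.b))

theorem Aff.measurable_b : Measurable Aff.b :=
  measurable_snd.comp (comap_measurable fun g : Aff => (g.a, g.b))

theorem measurable_phase : Measurable fun p : ℝ × ℝ => phase p.1 p.2 := by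
  unfold phase
  exact Continuous.measurable (by fun_prop)

theorem measurable_sexp_comp {s : ℤˣ} (ψ : HilbK s) : Measurable fun p => ψ (sexp s p) :=
  (Lp.stronglyMeasurable ψ).measurable.comp (continuous_sexp s).measurable

/-- Every square integrable function of the logarithmic coordinate is a vector. -/
theorem exists_hilbK (s : ℤˣ) {F : ℝ → ℂ} (hF : Measurable F)
    (hF2 : Integrable fun p => ‖F p‖ ^ 2) :
    ∃ ψ : HilbK s, (∀ᵐ p : ℝ, ψ (sexp s p) = F p) ∧ ‖ψ‖ ^ 2 = ∫ p, ‖F p‖ ^ 2 := by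
  have h1 : MemLp F 2 volume :=
    (memLp_two_iff_integrable_sq_norm hF.aestronglyMeasurable).2 hF2
  have h2 : MemLp (fun r => F (Real.log |r|)) 2 (halfMeas s) := by
    rw [← (measurePreserving_sexp s).map_eq,
      (measurableEmbedding_sexp s).memLp_map_measure_iff]
    refine h1.congr_norm ?_ ?_
    · exact (hF.comp (Real.measurable_log.comp (continuous_abs.measurable.comp
        (continuous_sexp s).measurable))).aestronglyMeasurable
    · refine Filter.Eventually.of_forall fun p => ?_
      simp only [Function.comp_apply, abs_sexp, Real.log_exp]
  have hae : ∀ᵐ p : ℝ, (h2.toLp : HilbK s) (sexp s p) = F p := by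
    filter_upwards [ae_sexp h2.coeFn_toLp] with p hp
    rw [hp, abs_sexp, Real.log_exp]
  refine ⟨h2.toLp, hae, ?_⟩
  have h3 : inner ℂ (h2.toLp : HilbK s) h2.toLp = ((∫ p, ‖F p‖ ^ 2 : ℝ) : ℂ) := by
    rw [inner_hilbK, ← integral_complex_ofReal]
    refine integral_congr_ae ?_
    filter_upwards [hae] with p hp
    rw [hp, mul_comm, Complex.mul_conj, Complex.normSq_eq_norm_sq]
  rw [inner_self_eq_norm_sq_to_K] at h3
  exact Complex.ofReal_injective (by rw [← h3, Complex.ofReal_pow]; rfl)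

/-- The weight `1 / (1 + p²)` that controls kernels. -/
noncomputable def wt (p : ℝ) : ℝ := (1 + p ^ 2)⁻¹

theorem wt_pos (p : ℝ) : 0 < wt p := by unfold wt; positivity

theorem wt_le_one (p : ℝ) : wt p ≤ 1 := by
  unfold wt
  exact inv_le_one_of_one_le₀ (by nlinarith [sq_nonneg p])

theorem integrable_wt : Integrable wt := integrable_inv_one_add_sq

theorem measurable_wt : Measurable wt := by unfold wt; fun_prop

theorem integrable_wt_sq : Integrable fun p => wt p ^ 2 := by
  refine integrable_wt.mono' (measurable_wt.pow_const 2).aestronglyMeasurable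
    (Filter.Eventually.of_forall fun p => ?_)
  have := wt_pos p
  rw [Real.norm_of_nonneg (by positivity)]
  nlinarith [wt_le_one p]

/-- Kernels `K p q`, in logarithmic coordinates, with derivative `K' p q` in `p`, that decay
together with the derivative; such kernels define trace class operators. -/
structure IsTraceKernel (K K' : ℝ → ℝ → ℂ) : Prop where
  hasDerivAt : ∀ p q, HasDerivAt (fun p => K p q) (K' p q) p
  measurable : Measurable fun z : ℝ × ℝ => K z.1 z.2
  measurable' : Measurable fun z : ℝ × ℝ => K' z.1 z.2
  bound : ∃ C, 0 ≤ C ∧ ∀ p q, ‖K p q‖ ≤ C * (wt p * wt q) ∧ ‖K' p q‖ ≤ C * (wt p * wt q)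

/-- The function `e^(p-t)` of `p < t`, extended by zero. -/
noncomputable def expTail (t p : ℝ) : ℝ := if p < t then Real.exp (p - t) else 0

theorem expTail_nonneg (t p : ℝ) : 0 ≤ expTail t p := by
  unfold expTail; split_ifs <;> positivity

theorem expTail_le_one (t p : ℝ) : expTail t p ≤ 1 := by
  unfold expTail; split_ifs with h
  · exact Real.exp_le_one_iff.2 (by linarith)
  · exact zero_le_one

theorem measurable_expTail : Measurable fun z : ℝ × ℝ => expTail z.1 z.2 := by
  unfold expTail
  exact Measurable.ite (measurableSet_lt measurable_snd measurable_fst) (by fun_prop)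
    measurable_const

theorem expTail_eq (t p : ℝ) : expTail t p = expTail 0 (p - t) := by
  simp [expTail]

theorem integrable_expTail_sq : Integrable fun p => expTail 0 p ^ 2 := by
  have h1 : IntegrableOn Real.exp (Set.Iio 0) := integrableOn_exp_Iic 0 |>.mono_set
    Set.Iio_subset_Iic_self
  refine ((integrable_indicator_iff measurableSet_Iio).2 h1).mono'
    ((measurable_expTail.comp (by fun_prop : Measurable fun p : ℝ => ((0 : ℝ), p))).pow_const
      2).aestronglyMeasurable (Filter.Eventually.of_forall fun p => ?_)
  rw [Real.norm_of_nonneg (sq_nonneg _)]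
  by_cases h : p < 0
  · rw [Set.indicator_of_mem (show p ∈ Set.Iio 0 from h)]
    have h2 : expTail 0 p = Real.exp p := by simp [expTail, h]
    have h3 := expTail_le_one 0 p
    have h4 := expTail_nonneg 0 p
    rw [← h2]; nlinarith
  · rw [Set.indicator_of_notMem (show p ∉ Set.Iio 0 from h)]; simp [expTail, h]

theorem integral_expTail_sq (t : ℝ) :
    Integrable (fun p => expTail t p ^ 2) ∧
      ∫ p, expTail t p ^ 2 = ∫ p, expTail 0 p ^ 2 := by
  simp only [expTail_eq t]
  exact ⟨integrable_expTail_sq.comp_sub_right t,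
    integral_sub_right_eq_self (fun p => expTail 0 p ^ 2) t⟩

namespace IsTraceKernel

variable {K K' : ℝ → ℝ → ℂ}

theorem bound_sub (hK : IsTraceKernel K K') :
    ∃ C, 0 ≤ C ∧ ∀ p q, ‖K p q - K' p q‖ ≤ C * (wt p * wt q) := by
  obtain ⟨C, hC0, hC⟩ := hK.bound
  refine ⟨C + C, by positivity, fun p q => ?_⟩
  rw [add_mul]
  exact (norm_sub_le _ _).trans (add_le_add (hC p q).1 (hC p q).2)

/-- The kernel is a superposition of products of functions of `p` and of `q`: this is the
fundamental theorem of calculus for `t ↦ -e^(p-t) K t q`. -/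
theorem integral_expTail_mul (hK : IsTraceKernel K K') (p q : ℝ) :
    ∫ t, (expTail t p : ℂ) * (K t q - K' t q) = K p q := by
  obtain ⟨C, hC0, hC⟩ := hK.bound
  have h1 : ∀ t, (expTail t p : ℂ) * (K t q - K' t q) = (Set.Ioi p).indicator
      (fun t => Complex.exp (p - t) * (K t q - K' t q)) t := by
    intro t
    by_cases h : p < t
    · rw [Set.indicator_of_mem (by exact h), expTail, if_pos h]; push_cast; rfl
    · rw [Set.indicator_of_notMem (by exact h), expTail, if_neg h]; simp
  have hint : IntegrableOn (fun t : ℝ => Complex.exp (p - t) * (K t q - K' t q)) (Set.Ioi p) := by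
    rw [← integrable_indicator_iff measurableSet_Ioi]
    refine (integrable_wt.const_mul (C + C)).mono' ?_ (Filter.Eventually.of_forall fun t => ?_)
    · refine (Measurable.indicator ?_ measurableSet_Ioi).aestronglyMeasurable
      refine Measurable.mul (by fun_prop) (Measurable.sub ?_ ?_)
      · exact hK.measurable.comp (by fun_prop : Measurable fun t : ℝ => (t, q))
      · exact hK.measurable'.comp (by fun_prop : Measurable fun t : ℝ => (t, q))
    · rw [← h1, norm_mul, Complex.norm_real, Real.norm_of_nonneg (expTail_nonneg _ _)]
      have h2 : ‖K t q - K' t q‖ ≤ (C + C) * wt t := by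
        refine (norm_sub_le _ _).trans ?_
        rw [add_mul]
        have : C * (wt t * wt q) ≤ C * wt t := by
          gcongr
          have := wt_pos t
          have := wt_le_one q
          nlinarith
        exact add_le_add ((hC t q).1.trans this) ((hC t q).2.trans this)
      calc _ ≤ 1 * ‖K t q - K' t q‖ := by gcongr; exact expTail_le_one _ _
        _ ≤ _ := by rw [one_mul]; exact h2
  simp only [h1]
  rw [integral_indicator measurableSet_Ioi]
  have hd : ∀ t ∈ Set.Ici p, HasDerivAt (fun t : ℝ => -(Complex.exp (p - t) * K t q))
      (Complex.exp (p - t) * (K t q - K' t q)) t := by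
    intro t _
    have h2 : HasDerivAt (fun t : ℝ => Complex.exp (p - t)) (Complex.exp (p - t) * (-1)) t :=
      ((hasDerivAt_id t).ofReal_comp.const_sub (p : ℂ)).cexp
    refine (h2.mul (hK.hasDerivAt t q)).neg.congr_deriv ?_
    ring
  have hlim : Filter.Tendsto (fun t : ℝ => -(Complex.exp (p - t) * K t q)) Filter.atTop
      (nhds 0) := by
    rw [tendsto_zero_iff_norm_tendsto_zero]
    have h3 : Filter.Tendsto (fun t : ℝ => Real.exp (p - t) * C) Filter.atTop (nhds 0) := by
      have := (Real.tendsto_exp_atBot.comp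
        (Filter.tendsto_atBot_add_const_left Filter.atTop p Filter.tendsto_neg_atTop_atBot)).mul_const
          C
      simpa [sub_eq_add_neg] using this
    refine squeeze_zero (fun t => norm_nonneg _) (fun t => ?_) h3
    rw [norm_neg, norm_mul, Complex.norm_exp]
    have h4 : ‖K t q‖ ≤ C := by
      refine (hC t q).1.trans ?_
      have h5 := wt_pos t
      have h6 := wt_pos q
      have : wt t * wt q ≤ 1 := mul_le_one₀ (wt_le_one t) h6.le (wt_le_one q)
      nlinarith
    have h7 : ((p : ℂ) - t).re = p - t := by simp
    rw [h7]
    gcongr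
  rw [integral_Ioi_of_hasDerivAt_of_tendsto' hd hint hlim]
  simp

/-- A trace kernel defines an operator `T` that is trace class, together with its products with the
operators of the representation.  The traces are integrals of the kernel along shifted diagonals. -/
theorem exists_operator (s : ℤˣ) (hK : IsTraceKernel K K') :
    ∃ T : HilbK s →L[ℂ] HilbK s,
      (∀ φ ψ : HilbK s, Integrable (fun p => φ (sexp s p)) → Integrable (fun p => ψ (sexp s p)) →
        inner ℂ φ (T ψ) = ∫ z : ℝ × ℝ,
          (starRingEnd ℂ) (φ (sexp s z.1)) * K z.1 z.2 * ψ (sexp s z.2)) ∧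
      (∀ g : Aff, HasTrace (T.comp (rep s g))
        (∫ p, phase g.b (sexp s p) * K (p + Real.log g.a) p)) ∧
      (∀ (μ : Measure Aff) [SFinite μ] (F : Aff → ℂ) (A : HilbK s →L[ℂ] HilbK s),
        Integrable F μ → IsIntegratedRep s μ F A → HasTrace (T.comp A)
          (∫ g, F g * (∫ p, phase g.b (sexp s p) * K (p + Real.log g.a) p) ∂μ)) := by
  obtain ⟨C, hC0, hC⟩ := hK.bound_sub
  let B : ℝ → ℝ → ℂ := fun t q => K t q - K' t q
  have hBm : Measurable fun z : ℝ × ℝ => B z.1 z.2 := hK.measurable.sub hK.measurable'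
  have hBm' : ∀ t, Measurable (B t) := fun t =>
    hBm.comp (by fun_prop : Measurable fun q : ℝ => (t, q))
  have hαm : ∀ t, Measurable fun p => expTail t p := fun t =>
    measurable_expTail.comp (by fun_prop : Measurable fun p : ℝ => (t, p))
  have hwt := wt_pos
  have hBb : ∀ t q, ‖(starRingEnd ℂ) (B t q)‖ ^ 2 ≤ (C * wt t) ^ 2 * wt q ^ 2 := fun t q => by
    rw [RCLike.norm_conj, ← mul_pow, mul_assoc]
    exact pow_le_pow_left₀ (norm_nonneg _) (hC t q) 2
  have hB2 : ∀ t, Integrable fun q => ‖(starRingEnd ℂ) (B t q)‖ ^ 2 := fun t => by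
    refine (integrable_wt_sq.const_mul ((C * wt t) ^ 2)).mono' ?_
      (Filter.Eventually.of_forall fun q => ?_)
    · have := hBm' t
      exact Measurable.aestronglyMeasurable (by fun_prop)
    · rw [Real.norm_of_nonneg (by positivity)]
      exact hBb t q
  have exa := fun t => exists_hilbK s (F := fun p => (expTail t p : ℂ))
    (Complex.measurable_ofReal.comp (hαm t))
    (by
      have := (integral_expTail_sq t).1
      simpa [Complex.norm_real, sq_abs] using this)
  have exb := fun t => exists_hilbK s (F := fun q => (starRingEnd ℂ) (B t q))
    (by have := hBm' t; fun_prop) (hB2 t)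
  choose a ha ha2 using exa
  choose b hb hb2 using exb
  set V : ℝ := ∫ p, expTail 0 p ^ 2 with hV
  set W : ℝ := ∫ q, wt q ^ 2 with hW
  have hna : ∀ t, ‖a t‖ ≤ √V := fun t => by
    refine Real.le_sqrt_of_sq_le (le_of_eq ?_)
    rw [ha2, hV, ← (integral_expTail_sq t).2]
    refine integral_congr_ae (Filter.Eventually.of_forall fun p => ?_)
    simp [Complex.norm_real, sq_abs]
  have hnb : ∀ t, ‖b t‖ ≤ C * wt t * √W := fun t => by
    have h1 : ‖b t‖ ^ 2 ≤ (C * wt t) ^ 2 * W := by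
      rw [hb2, hW, ← integral_const_mul]
      exact integral_mono (hB2 t) (integrable_wt_sq.const_mul _) (hBb t)
    have h2 := Real.le_sqrt_of_sq_le h1
    rwa [Real.sqrt_mul (sq_nonneg _), Real.sqrt_sq (mul_nonneg hC0 (hwt t).le)] at h2
  have hc : Integrable fun t => √V * (C * wt t * √W) :=
    ((integrable_wt.const_mul C).mul_const _).const_mul _
  have hab : ∀ t, ‖a t‖ * ‖b t‖ ≤ √V * (C * wt t * √W) := fun t =>
    mul_le_mul (hna t) (hnb t) (norm_nonneg _) (Real.sqrt_nonneg _)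
  have hia : ∀ φ t, inner ℂ φ (a t) = ∫ p, (starRingEnd ℂ) (φ (sexp s p)) * expTail t p := by
    intro φ t
    rw [inner_hilbK]
    refine integral_congr_ae ?_
    filter_upwards [ha t] with p hp
    rw [hp]
  have hib : ∀ φ t, inner ℂ (b t) φ = ∫ q, B t q * φ (sexp s q) := by
    intro φ t
    rw [inner_hilbK]
    refine integral_congr_ae ?_
    filter_upwards [hb t] with p hp
    rw [hp, Complex.conj_conj]
  have hma : ∀ φ : HilbK s, AEStronglyMeasurable (fun t => inner ℂ φ (a t)) := by
    intro φ
    simp only [hia]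
    have h1 : Measurable fun z : ℝ × ℝ =>
        (starRingEnd ℂ) (φ (sexp s z.2)) * (expTail z.1 z.2 : ℂ) := by
      have := (measurable_sexp_comp φ).comp
        (measurable_snd : Measurable fun z : ℝ × ℝ => z.2)
      have := Complex.measurable_ofReal.comp measurable_expTail
      fun_prop
    exact h1.stronglyMeasurable.integral_prod_right.aestronglyMeasurable
  have hmb : ∀ φ : HilbK s, AEStronglyMeasurable (fun t => inner ℂ (b t) φ) := by
    intro φ
    simp only [hib]
    have h1 : Measurable fun z : ℝ × ℝ => B z.1 z.2 * φ (sexp s z.2) :=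
      hBm.mul ((measurable_sexp_comp φ).comp measurable_snd)
    exact h1.stronglyMeasurable.integral_prod_right.aestronglyMeasurable
  obtain ⟨T, hT⟩ := exists_weakIntegral (μ := volume)
    (fun t => (innerSL ℂ (b t)).smulRight (a t)) hc
    (fun t => by
      rw [ContinuousLinearMap.norm_smulRight_apply, innerSL_apply_norm, mul_comm]
      exact hab t)
    (fun φ ψ => by
      simp only [ContinuousLinearMap.smulRight_apply, inner_smul_right]
      exact (hmb ψ).mul (hma φ))
  have hT' : ∀ φ ψ : HilbK s, ∫ t, inner ℂ φ (a t) * inner ℂ (b t) ψ = inner ℂ φ (T ψ) := by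
    intro φ ψ
    rw [← hT]
    refine integral_congr_ae (Filter.Eventually.of_forall fun t => ?_)
    simp only [ContinuousLinearMap.smulRight_apply, inner_smul_right, innerSL_apply_apply]
    exact mul_comm _ _
  have htr := hasTrace_comp_of_rankOne hc hab hma hmb hT'
  -- the matrix elements of the representation between the factors of the kernel
  have hrep : ∀ g t, inner ℂ (b t) (rep s g (a t))
      = ∫ p, phase g.b (sexp s p) * ((expTail t (p + Real.log g.a) : ℂ) * B t p) := by
    intro g t
    rw [inner_rep]
    refine integral_congr_ae ?_
    have h1 := (measurePreserving_add_right volume (Real.log g.a)).quasiMeasurePreserving.ae (ha t)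
    filter_upwards [hb t, h1] with p hp hp1
    rw [hp, hp1, Complex.conj_conj]
    ring
  have hdiag : ∀ g, ∫ t, inner ℂ (b t) (rep s g (a t))
      = ∫ p, phase g.b (sexp s p) * K (p + Real.log g.a) p := by
    intro g
    simp only [hrep]
    rw [integral_integral_swap]
    · refine integral_congr_ae (Filter.Eventually.of_forall fun p => ?_)
      simp only
      rw [integral_const_mul, hK.integral_expTail_mul]
    · refine ((integrable_wt.mul_prod integrable_wt).const_mul C).mono' ?_
        (Filter.Eventually.of_forall fun z => ?_)
      · refine Measurable.aestronglyMeasurable (Measurable.mul ?_ (Measurable.mul ?_ hBm))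
        · exact ((continuous_phase g.b).comp (continuous_sexp s)).measurable.comp measurable_snd
        · exact Complex.measurable_ofReal.comp (measurable_expTail.comp
            (by fun_prop : Measurable fun z : ℝ × ℝ => (z.1, z.2 + Real.log g.a)))
      · simp only [Function.uncurry, norm_mul, norm_phase, one_mul, Complex.norm_real]
        rw [Real.norm_of_nonneg (expTail_nonneg _ _)]
        calc _ ≤ 1 * ‖B z.1 z.2‖ := by gcongr; exact expTail_le_one _ _
          _ ≤ _ := by rw [one_mul]; exact hC _ _
  refine ⟨T, fun φ ψ hφ hψ => ?_, fun g => ?_, fun μ _ F A hF hA => ?_⟩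
  · rw [← hT']
    simp only [hia, hib, ← integral_prod_mul]
    rw [← Measure.volume_eq_prod, integral_integral_swap]
    · refine integral_congr_ae (Filter.Eventually.of_forall fun z => ?_)
      simp only
      rw [← hK.integral_expTail_mul z.1 z.2, ← integral_const_mul, ← integral_mul_const]
      refine integral_congr_ae (Filter.Eventually.of_forall fun t => ?_)
      simp only [B]; ring
    · refine ((integrable_wt.const_mul C).mul_prod (hφ.norm.mul_prod hψ.norm)).mono' ?_
        (Filter.Eventually.of_forall fun z => ?_)
      · refine Measurable.aestronglyMeasurable (Measurable.mul (Measurable.mul ?_ ?_)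
          (Measurable.mul ?_ ?_))
        · have := (measurable_sexp_comp φ).comp
            (measurable_fst.comp measurable_snd : Measurable fun z : ℝ × (ℝ × ℝ) => z.2.1)
          exact (Complex.continuous_conj.measurable).comp this
        · exact Complex.measurable_ofReal.comp (measurable_expTail.comp
            (by fun_prop : Measurable fun z : ℝ × (ℝ × ℝ) => (z.1, z.2.1)))
        · exact hBm.comp (by fun_prop : Measurable fun z : ℝ × (ℝ × ℝ) => (z.1, z.2.2))
        · exact (measurable_sexp_comp ψ).comp
            (measurable_snd.comp measurable_snd : Measurable fun z : ℝ × (ℝ × ℝ) => z.2.2)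
      · simp only [Function.uncurry, norm_mul, RCLike.norm_conj, Complex.norm_real]
        rw [Real.norm_of_nonneg (expTail_nonneg _ _)]
        have h1 : ‖B z.1 z.2.2‖ ≤ C * wt z.1 := by
          refine (hC _ _).trans ?_
          have := hwt z.1
          have := wt_le_one z.2.2
          gcongr
          nlinarith
        calc _ ≤ ‖φ (sexp s z.2.1)‖ * 1 * (C * wt z.1 * ‖ψ (sexp s z.2.2)‖) := by
              gcongr; exact expTail_le_one _ _
          _ = _ := by ring
  · rw [← hdiag]
    exact htr (rep s g)
  · have h1 : ∫ g, F g * (∫ p, phase g.b (sexp s p) * K (p + Real.log g.a) p) ∂μ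
        = ∫ t, inner ℂ (b t) (A (a t)) := by
      simp only [← hdiag, ← integral_const_mul, ← (hA _ _).2]
      rw [integral_integral_swap]
      refine (hF.norm.mul_prod hc).mono' ?_ (Filter.Eventually.of_forall fun z => ?_)
      · refine hF.1.comp_fst.mul ?_
        have h2 : Measurable fun z : (Aff × ℝ) × ℝ => phase z.1.1.b (sexp s z.2) *
            ((expTail z.1.2 (z.2 + Real.log z.1.1.a) : ℂ) * B z.1.2 z.2) := by
          have m1 : Measurable fun z : (Aff × ℝ) × ℝ => z.1.1.a :=
            Aff.measurable_a.comp (measurable_fst.comp measurable_fst)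
          have m2 : Measurable fun z : (Aff × ℝ) × ℝ => z.1.1.b :=
            Aff.measurable_b.comp (measurable_fst.comp measurable_fst)
          have m3 := (continuous_sexp s).measurable
          refine Measurable.mul ?_ (Measurable.mul ?_ ?_)
          · exact measurable_phase.comp (m2.prodMk (m3.comp measurable_snd))
          · exact Complex.measurable_ofReal.comp (measurable_expTail.comp
              (Measurable.prodMk (by fun_prop) (measurable_snd.add (Real.measurable_log.comp m1))))
          · exact hBm.comp (by fun_prop :
              Measurable fun z : (Aff × ℝ) × ℝ => (z.1.2, z.2))
        have h3 := h2.stronglyMeasurable.integral_prod_right' (ν := volume)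
        simp only [hrep]
        exact h3.aestronglyMeasurable
      · simp only [Function.uncurry, norm_mul]
        gcongr
        calc _ ≤ ‖b z.2‖ * ‖rep s z.1 (a z.2)‖ := norm_inner_le_norm _ _
          _ ≤ ‖b z.2‖ * (1 * ‖a z.2‖) := by
              gcongr
              exact (rep s z.1).le_of_opNorm_le (norm_rep_le s z.1) _
          _ = ‖a z.2‖ * ‖b z.2‖ := by ring
          _ ≤ _ := hab z.2
    rw [h1]
    exact htr A

end IsTraceKernel

/-! ### The quantizer on test vectors -/

/-- Smooth functions with compact support in the open half-line. -/
structure IsHalfTest (s : ℤˣ) (f : ℝ → ℂ) : Prop where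
  contDiff : ContDiff ℝ ∞ f
  compact : HasCompactSupport f
  subset : tsupport f ⊆ halfLine s

namespace IsHalfTest

variable {s : ℤˣ} {f : ℝ → ℂ}

theorem eq_zero (hf : IsHalfTest s f) {r : ℝ} (hr : r ∉ halfLine s) : f r = 0 :=
  image_eq_zero_of_notMem_tsupport fun h => hr (hf.subset h)

theorem exists_log_bound (hf : IsHalfTest s f) :
    ∃ M : ℝ, 0 ≤ M ∧ ∀ p, f (sexp s p) ≠ 0 → |p| ≤ M := by
  have hc : ContinuousOn (fun r : ℝ => Real.log |r|) (tsupport f) := by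
    refine ContinuousOn.log continuous_abs.continuousOn fun r hr h0 => ?_
    have := hf.subset hr
    rw [abs_eq_zero.1 h0] at this
    simp [halfLine] at this
  obtain ⟨M, hM⟩ := hf.compact.isCompact.exists_bound_of_continuousOn hc
  refine ⟨max M 0, le_max_right _ _, fun p hp => ?_⟩
  have := hM _ (subset_tsupport f hp)
  rw [abs_sexp, Real.log_exp] at this
  exact this.trans (le_max_left _ _)

theorem comp_sexp (hf : IsHalfTest s f) :
    Continuous (fun p => f (sexp s p)) ∧ HasCompactSupport fun p => f (sexp s p) := by
  obtain ⟨M, -, hM⟩ := hf.exists_log_bound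
  refine ⟨hf.contDiff.continuous.comp (continuous_sexp s),
    HasCompactSupport.intro (isCompact_Icc (a := -M) (b := M)) fun p hp => ?_⟩
  by_contra h
  exact hp (abs_le.1 (hM p h))

theorem integrable_comp_sexp (hf : IsHalfTest s f) : Integrable fun p => f (sexp s p) :=
  hf.comp_sexp.1.integrable_of_hasCompactSupport hf.comp_sexp.2

/-- Division by `|r|` preserves test functions of the open half-line. -/
theorem div_abs (hf : IsHalfTest s f) : IsHalfTest s fun r => ((sgnR s / r : ℝ) : ℂ) * f r := by
  have hsub : tsupport (fun r => ((sgnR s / r : ℝ) : ℂ) * f r) ⊆ tsupport f :=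
    closure_mono (Function.support_mul_subset_right _ _)
  refine ⟨contDiff_iff_contDiffAt.2 fun r => ?_, hf.compact.mul_left, hsub.trans hf.subset⟩
  by_cases hr : r ∈ tsupport f
  · have h0 : r ≠ 0 := by
      rintro rfl
      simpa [halfLine] using hf.subset hr
    exact (Complex.ofRealCLM.contDiff.contDiffAt.comp r
      (contDiffAt_const.div contDiffAt_id h0)).mul hf.contDiff.contDiffAt
  · refine (contDiffAt_const (c := (0 : ℂ))).congr_of_eventuallyEq ?_
    filter_upwards [(isClosed_tsupport f).isOpen_compl.mem_nhds hr] with x hx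
    rw [image_eq_zero_of_notMem_tsupport hx, mul_zero]

end IsHalfTest

/-- The function `conj φ (y λ(-u)) ψ (y λ(u))`; its Fourier transform in `u` is the matrix element
of the quantizer between `φ` and `ψ`. -/
noncomputable def weylFun (φ ψ : ℝ → ℂ) (z : ℝ × ℝ) : ℂ :=
  (starRingEnd ℂ) (φ (z.2 * lam (-z.1))) * ψ (z.2 * lam z.1)

theorem sexp_mul_lam (s : ℤˣ) (η t : ℝ) : sexp s η * lam t = sexp s (η + loglam t) := by
  rw [sexp_add, exp_loglam, mul_comm]

theorem mul_lam_mem_halfLine {s : ℤˣ} {y t : ℝ} :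
    y * lam t ∈ halfLine s ↔ y ∈ halfLine s := by
  change 0 < sgnR s * (y * lam t) ↔ 0 < sgnR s * y
  rw [← mul_assoc, mul_pos_iff_of_pos_right (lam_pos t)]

theorem weylFun_sexp (s : ℤˣ) (φ ψ : ℝ → ℂ) (u η : ℝ) :
    weylFun φ ψ (u, sexp s η) = (starRingEnd ℂ) (φ (sexp s (η + loglam (-u)))) *
      ψ (sexp s (η + loglam (-u) + u)) := by
  have h : η + loglam (-u) + u = η + loglam u := by rw [loglam_eq u]; ring
  rw [weylFun, sexp_mul_lam, sexp_mul_lam, h]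

theorem weylFun_eq_zero {s : ℤˣ} {φ ψ : ℝ → ℂ} (hφ : IsHalfTest s φ) {u y : ℝ}
    (hy : y ∉ halfLine s) : weylFun φ ψ (u, y) = 0 := by
  rw [weylFun, hφ.eq_zero (mt mul_lam_mem_halfLine.1 hy), map_zero, zero_mul]

theorem weylFun_bound {s : ℤˣ} {φ ψ : ℝ → ℂ} (hφ : IsHalfTest s φ) (hψ : IsHalfTest s ψ) :
    ∃ M : ℝ, 0 ≤ M ∧ ∀ u η, weylFun φ ψ (u, sexp s η) ≠ 0 → |u| ≤ M ∧ |η| ≤ M := by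
  obtain ⟨M, hM0, hM⟩ := hφ.exists_log_bound
  obtain ⟨N, hN0, hN⟩ := hψ.exists_log_bound
  refine ⟨2 * M + N, by positivity, fun u η h => ?_⟩
  rw [weylFun_sexp] at h
  have h1 := abs_le.1 (hM _ fun h0 => h (by rw [h0, map_zero, zero_mul]))
  have h2 := abs_le.1 (hN _ (right_ne_zero_of_mul h))
  have hu : |u| ≤ M + N := abs_le.2 ⟨by linarith, by linarith⟩
  have h3 := abs_loglam_le (-u)
  rw [abs_neg] at h3
  have h4 := abs_le.1 (h3.trans hu)
  exact ⟨by linarith, abs_le.2 ⟨by linarith, by linarith⟩⟩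

theorem isTest_weylFun {s : ℤˣ} {φ ψ : ℝ → ℂ} (hφ : IsHalfTest s φ) (hψ : IsHalfTest s ψ) :
    IsTest (weylFun φ ψ) := by
  have hl := contDiff_lam
  constructor
  · have h1 : ContDiff ℝ ∞ fun z : ℝ × ℝ => φ (z.2 * lam (-z.1)) :=
      hφ.contDiff.comp (contDiff_snd.mul (hl.comp contDiff_fst.neg))
    have h2 : ContDiff ℝ ∞ fun z : ℝ × ℝ => ψ (z.2 * lam z.1) :=
      hψ.contDiff.comp (contDiff_snd.mul (hl.comp contDiff_fst))
    exact (Complex.conjCLE.contDiff.comp h1).mul h2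
  · obtain ⟨M, hM0, hM⟩ := weylFun_bound hφ hψ
    refine HasCompactSupport.intro
      ((isCompact_Icc (a := -M) (b := M)).prod
        (isCompact_Icc (a := -Real.exp M) (b := Real.exp M))) fun z hz => ?_
    obtain ⟨u, y⟩ := z
    by_contra h
    by_cases hy : y ∈ halfLine s
    · rw [← sexp_log_abs hy] at h hz
      obtain ⟨h1, h2⟩ := hM _ _ h
      refine hz ⟨abs_le.1 h1, abs_le.1 ?_⟩
      rw [abs_sexp]
      exact Real.exp_le_exp.2 ((le_abs_self _).trans h2)
    · exact h (weylFun_eq_zero hφ hy)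

theorem inner_rep_test {s : ℤˣ} {φ ψ : HilbK s} {φ' ψ' : ℝ → ℂ} (hφ : φ =ᵐ[halfMeas s] φ')
    (hψ : ψ =ᵐ[halfMeas s] ψ') (g : Aff) :
    inner ℂ φ (rep s g ψ) = ∫ p, (starRingEnd ℂ) (φ' (sexp s p)) *
      (phase g.b (sexp s p) * ψ' (sexp s (p + Real.log g.a))) := by
  rw [inner_rep]
  refine integral_congr_ae ?_
  have h1 := (measurePreserving_add_right volume
    (Real.log g.a)).quasiMeasurePreserving.ae (ae_sexp hψ)
  filter_upwards [ae_sexp hφ, h1] with p hp hp1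
  rw [hp, hp1]

theorem phase_mul (b r c : ℝ) : phase b (r * c) = phase (b * c) r := by
  rw [phase, phase]
  congr 3
  ring

/-- Matrix elements of the representation, as integrals over the horizontal line `u = log a`. -/
theorem inner_rep_weylFun {s : ℤˣ} {φ ψ : HilbK s} {φ' ψ' : ℝ → ℂ} (hφ : φ =ᵐ[halfMeas s] φ')
    (hψ : ψ =ᵐ[halfMeas s] ψ') (g : Aff) :
    inner ℂ φ (rep s g ψ) = ∫ η, phase (g.b * lam (-Real.log g.a)) (sexp s η) *
      weylFun φ' ψ' (Real.log g.a, sexp s η) := by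
  rw [inner_rep_test hφ hψ, ← integral_add_right_eq_self _ (loglam (-Real.log g.a))]
  refine integral_congr_ae (Filter.Eventually.of_forall fun η => ?_)
  simp only
  rw [weylFun_sexp, ← phase_mul, sexp_mul_lam]
  ring

/-- `weylFun φ ψ (u, y) / |y|` with the variables exchanged. -/
theorem isTest_weylFun_div {s : ℤˣ} {φ ψ : ℝ → ℂ} (hφ : IsHalfTest s φ) (hψ : IsHalfTest s ψ) :
    ∃ H : ℝ × ℝ → ℂ, IsTest H ∧ (∀ y u, y ∉ halfLine s → H (y, u) = 0) ∧
      ∀ y u, y ∈ halfLine s → ((|y| : ℝ) : ℂ) * H (y, u) = weylFun φ ψ (u, y) := by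
  have h1 := (isTest_weylFun hφ.div_abs hψ).mul (Complex.ofRealCLM.contDiff.comp
    (contDiff_lam.comp contDiff_fst.neg) : ContDiff ℝ ∞ fun z : ℝ × ℝ => ((lam (-z.1) : ℝ) : ℂ))
  let e : ℝ × ℝ ≃ₜ ℝ × ℝ := Homeomorph.prodComm ℝ ℝ
  refine ⟨fun z => ((lam (-z.2) : ℝ) : ℂ) *
      weylFun (fun r => ((sgnR s / r : ℝ) : ℂ) * φ r) ψ (z.2, z.1),
    ⟨h1.1.comp (contDiff_snd.prodMk contDiff_fst), h1.2.comp_homeomorph e⟩,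
    fun y u hy => ?_, fun y u hy => ?_⟩
  · simp only
    rw [weylFun_eq_zero hφ.div_abs hy, mul_zero]
  · have h0 : y ≠ 0 := by
      rintro rfl
      simp [halfLine] at hy
    have h2 : |y| = sgnR s * y := by
      rw [← abs_of_pos (show 0 < sgnR s * y from hy), abs_mul, abs_sgnR, one_mul]
    have h3 := (lam_pos (-u)).ne'
    have h4 : |y| * (lam (-u) * (sgnR s / (y * lam (-u)))) = 1 := by
      rw [h2]
      field_simp
      rw [pow_two]
      exact sgnR_mul_self s
    simp only [weylFun, map_mul, Complex.conj_ofReal]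
    have h5 : ((|y| : ℝ) : ℂ) * ((lam (-u) : ℝ) * ((sgnR s / (y * lam (-u)) : ℝ) : ℂ)) = 1 := by
      exact_mod_cast h4
    calc _ = (((|y| : ℝ) : ℂ) * ((lam (-u) : ℝ) * ((sgnR s / (y * lam (-u)) : ℝ) : ℂ))) *
          ((starRingEnd ℂ) (φ (y * lam (-u))) * ψ (y * lam u)) := by ring
      _ = _ := by rw [h5, one_mul]

theorem integral_halfLine (s : ℤˣ) (F : ℝ → ℂ) (hF : ∀ y, y ∉ halfLine s → F y = 0) :
    ∫ y, F y = ∫ η, ((|sexp s η| : ℝ) : ℂ) * F (sexp s η) := by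
  have h := integral_image_eq_integral_abs_deriv_smul (f := sexp s) (f' := sexp s)
    MeasurableSet.univ (fun p _ => (hasDerivAt_sexp s p).hasDerivWithinAt)
    (sexp_injective s).injOn F
  rw [Set.image_univ, range_sexp, setIntegral_eq_integral_of_forall_compl_eq_zero hF,
    Measure.restrict_univ] at h
  rw [h]
  simp

theorem IsTest.exists_pft_bound {H : ℝ × ℝ → ℂ} (hH : IsTest H) (N : ℕ) :
    ∃ C R : ℝ, 0 ≤ C ∧ ∀ w y,
      ‖pft H w y‖ ≤ (Set.Icc (-R) R).indicator (fun _ => C) y * ((1 + w ^ 2)⁻¹) ^ N := by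
  obtain ⟨R, hR0, hR⟩ := hH.exists_bound
  obtain ⟨C, hC0, hC⟩ := IsTest.pft_decay N hH
  refine ⟨C, R, hC0, fun w y => ?_⟩
  by_cases hy : y ∈ Set.Icc (-R) R
  · rw [Set.indicator_of_mem hy, inv_pow, ← div_eq_mul_inv]
    exact hC w y
  · have h0 : ∀ x : ℝ, H (x, y) = 0 := fun x => by
      by_contra h
      exact hy (abs_le.1 (hR x y h).2)
    rw [Set.indicator_of_notMem hy, zero_mul, pft_eq]
    simp [h0]

theorem IsTest.integrable_pft_neg {H : ℝ × ℝ → ℂ} (hH : IsTest H) :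
    Integrable fun X : ℝ × ℝ => pft H (-X.2) X.1 := by
  obtain ⟨C, R, -, hC⟩ := hH.exists_pft_bound 1
  have hbd : Integrable fun X : ℝ × ℝ =>
      (Set.Icc (-R) R).indicator (fun _ => C) X.1 * (1 + X.2 ^ 2)⁻¹ :=
    ((integrable_indicator_iff measurableSet_Icc).2
      (integrableOn_const (by simp))).mul_prod integrable_inv_one_add_sq
  refine hbd.mono' ?_ (Filter.Eventually.of_forall fun X => ?_)
  · exact (hH.continuous_pft.comp
      (by fun_prop : Continuous fun X : ℝ × ℝ => (-X.2, X.1))).aestronglyMeasurable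
  · have h := hC (-X.2) X.1
    rwa [neg_sq, pow_one] at h

/-- On test vectors, the quantizer is the Fourier transform of `weylFun` in the first variable. -/
theorem quantL_eq {s : ℤˣ} {φ ψ : HilbK s} {φ' ψ' : ℝ → ℂ} (hφ : φ =ᵐ[halfMeas s] φ')
    (hψ : ψ =ᵐ[halfMeas s] ψ') (hφ' : IsHalfTest s φ') (hψ' : IsHalfTest s ψ') {z : ℝ × ℝ}
    (hz : z ∈ orbit s) : quantL s z φ ψ = pft (weylFun φ' ψ') z.1 z.2 := by
  obtain ⟨H, hH, hH0, hHG⟩ := isTest_weylFun_div hφ' hψ'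
  have hy : z.2 ∈ halfLine s := hz
  have hin : ∀ u v : ℝ, inner ℂ φ (rep s (expAff (u, v)) ψ) = pft H (-v) u := by
    intro u v
    have hl := (lam_pos (-u)).ne'
    rw [inner_rep_weylFun hφ hψ, pft_eq, integral_halfLine s
      (fun y : ℝ => Complex.exp (-(2 * Real.pi * Complex.I * y) * (-v : ℝ)) * H (y, u))]
    · simp only [expAff, Real.log_exp, div_mul_cancel₀ _ hl]
      refine integral_congr_ae (Filter.Eventually.of_forall fun η => ?_)
      simp only
      rw [← hHG _ _ (sexp_mem_halfLine s η), phase, mul_left_comm]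
      congr 3
      push_cast; ring
    · intro y hy
      rw [hH0 y u hy, mul_zero]
  have hint : Integrable fun X : ℝ × ℝ =>
      Complex.exp (-(2 * Real.pi * Complex.I * (pairing z X : ℂ))) * pft H (-X.2) X.1 := by
    have h1 : Continuous fun X : ℝ × ℝ =>
        Complex.exp (-(2 * Real.pi * Complex.I * (pairing z X : ℂ))) := by
      unfold pairing; fun_prop
    refine hH.integrable_pft_neg.bdd_mul (c := 1) h1.aestronglyMeasurable
      (Filter.Eventually.of_forall fun X => le_of_eq ?_)
    have h2 : -(2 * Real.pi * Complex.I * (pairing z X : ℂ))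
        = ((-(2 * Real.pi * pairing z X) : ℝ) : ℂ) * Complex.I := by push_cast; ring
    rw [h2, Complex.norm_exp_ofReal_mul_I]
  have hfun : ∀ X : ℝ × ℝ, inner ℂ φ (rep s (expAff X) ψ) = pft H (-X.2) X.1 :=
    fun X => hin X.1 X.2
  rw [quantL]
  simp only [hfun]
  rw [Measure.volume_eq_prod, integral_prod _ hint, pft_eq, ← integral_const_mul]
  refine integral_congr_ae (Filter.Eventually.of_forall fun u => ?_)
  simp only
  have hinv : ∫ v : ℝ, Complex.exp (-(2 * Real.pi * Complex.I * (pairing z (u, v) : ℂ))) *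
      pft H (-v) u = Complex.exp (-(2 * Real.pi * Complex.I * u) * z.1) * H (z.2, u) := by
    rw [← hH.pft_inversion z.2 u, ← integral_const_mul, ← integral_neg_eq_self]
    refine integral_congr_ae (Filter.Eventually.of_forall fun v => ?_)
    simp only [pairing, neg_neg]
    rw [← mul_assoc, ← Complex.exp_add]
    congr 2
    push_cast; ring
  rw [hinv, ← hHG _ _ hy, mul_left_comm]

/-! ### Quantization of test functions -/

/-- The phase `exp (2 π i (x log a + y b λ(log a) / a))`. -/
noncomputable def kerE (z : ℝ × ℝ) (g : Aff) : ℂ :=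
  Complex.exp (2 * Real.pi * Complex.I *
    ((z.1 * Real.log g.a + z.2 * g.b * lam (Real.log g.a) / g.a : ℝ) : ℂ))

theorem norm_kerE (z : ℝ × ℝ) (g : Aff) : ‖kerE z g‖ = 1 := by
  have h : ∀ t : ℝ, 2 * Real.pi * Complex.I * (t : ℂ) = ((2 * Real.pi * t : ℝ) : ℂ) * Complex.I :=
    fun t => by push_cast; ring
  rw [kerE, h, Complex.norm_exp_ofReal_mul_I]

theorem continuous_kerE (g : Aff) : Continuous fun z => kerE z g := by
  unfold kerE; fun_prop

theorem measurable_kerE : Measurable fun p : (ℝ × ℝ) × Aff => kerE p.1 p.2 := by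
  have h1 : Measurable fun p : (ℝ × ℝ) × Aff => p.2.a := Aff.measurable_a.comp measurable_snd
  have h2 : Measurable fun p : (ℝ × ℝ) × Aff => p.2.b := Aff.measurable_b.comp measurable_snd
  have h3 : Measurable lam := contDiff_lam.continuous.measurable
  have h4 : Measurable fun p : (ℝ × ℝ) × Aff => lam (Real.log p.2.a) :=
    h3.comp (Real.measurable_log.comp h1)
  have h5 : Measurable fun p : (ℝ × ℝ) × Aff =>
      (p.1.1 * Real.log p.2.a + p.1.2 * p.2.b * lam (Real.log p.2.a) / p.2.a : ℝ) := by
    have h6 : Measurable fun p : (ℝ × ℝ) × Aff => Real.log p.2.a := Real.measurable_log.comp h1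
    exact ((measurable_fst.fst).mul h6).add (((measurable_fst.snd.mul h2).mul h4).div h1)
  unfold kerE
  exact Complex.measurable_exp.comp (measurable_const.mul (Complex.measurable_ofReal.comp h5))

theorem kerE_orbitParam (s : ℤˣ) (x η : ℝ) (g : Aff) :
    kerE (orbitParam s (x, η)) g = Complex.exp (-(2 * Real.pi * Complex.I * x) *
      ((-Real.log g.a : ℝ) : ℂ)) * phase (g.b * lam (-Real.log g.a)) (sexp s η) := by
  rw [kerE, phase, ← Complex.exp_add, ← lam_log_mul g.a_pos]
  congr 1
  simp only [orbitParam]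
  push_cast
  ring

/-- Continuous functions on the plane that vanish off a square are integrable. -/
theorem integrable_of_square {F : ℝ × ℝ → ℂ} (hF : Continuous F) {M : ℝ}
    (hM : ∀ z, F z ≠ 0 → |z.1| ≤ M ∧ |z.2| ≤ M) : Integrable F := by
  refine hF.integrable_of_hasCompactSupport (HasCompactSupport.intro
    ((isCompact_Icc (a := -M) (b := M)).prod (isCompact_Icc (a := -M) (b := M))) fun z hz => ?_)
  by_contra h
  exact hz ⟨abs_le.1 (hM z h).1, abs_le.1 (hM z h).2⟩

/-- The logarithmic coordinate of the support of a test function on an orbit is bounded. -/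
theorem exists_log_bound_of_orbit {s : ℤˣ} {f : ℝ × ℝ → ℂ} (hf : IsTest f)
    (hs : tsupport f ⊆ orbit s) :
    ∃ M : ℝ, 0 ≤ M ∧ ∀ x η, (x, sexp s η) ∈ tsupport f → |x| ≤ M ∧ |η| ≤ M := by
  have hc : ContinuousOn (fun z : ℝ × ℝ => Real.log |z.2|) (tsupport f) := by
    refine ContinuousOn.log (by fun_prop) fun z hz h0 => ?_
    have := hs hz
    simp [orbit, abs_eq_zero.1 h0] at this
  obtain ⟨M, hM⟩ := hf.2.isCompact.exists_bound_of_continuousOn hc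
  obtain ⟨R, hR⟩ := hf.2.isCompact.exists_bound_of_continuousOn continuousOn_fst
  refine ⟨max M R ⊔ 0, le_max_right _ _, fun x η hp => ?_⟩
  have h1 := hM _ hp
  have h2 := hR _ hp
  simp only [abs_sexp, Real.log_exp] at h1
  exact ⟨(h2.trans (le_max_right M R)).trans (le_max_left _ _),
    (h1.trans (le_max_left M R)).trans (le_max_left _ _)⟩

theorem pd2_support {f : ℝ × ℝ → ℂ} {z : ℝ × ℝ} (h : pd2 f z ≠ 0) : z ∈ tsupport f := by
  by_contra hz
  refine h ?_
  rw [pd2, image_eq_zero_of_notMem_tsupport fun h' => hz (tsupport_fderiv_subset ℝ h')]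
  rfl

/-- In the coordinates `p = η + log λ(-u)`, `q = η + log λ(u)`, functions of bounded `η` with
quadratic decay in `1 + u²` are dominated by the weight. -/
theorem wt_bound {M u η : ℝ} (hη : |η| ≤ M) :
    ((1 + u ^ 2)⁻¹) ^ 2 ≤ (2 + 2 * M ^ 2) ^ 2 * (wt (η + loglam (-u)) * wt (η + loglam u)) := by
  have key : ∀ v : ℝ, |v| = |u| → (1 + u ^ 2)⁻¹ ≤ (2 + 2 * M ^ 2) * wt (η + loglam v) := by
    intro v hv
    have h1 : |η + loglam v| ≤ M + |u| :=
      (abs_add_le _ _).trans (add_le_add hη ((abs_loglam_le v).trans hv.le))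
    have h2 : (η + loglam v) ^ 2 ≤ (M + |u|) ^ 2 := sq_le_sq.2 (h1.trans (le_abs_self _))
    have h3 : (M + |u|) ^ 2 ≤ 2 * M ^ 2 + 2 * u ^ 2 := by
      rw [← sq_abs u]; nlinarith [sq_nonneg (M - |u|)]
    rw [wt, ← div_eq_mul_inv, inv_eq_one_div, div_le_div_iff₀ (by positivity) (by positivity)]
    have h4 : (2 + 2 * M ^ 2) * (1 + u ^ 2)
        = 2 + 2 * M ^ 2 + 2 * u ^ 2 + 2 * (M ^ 2 * u ^ 2) := by ring
    have h5 : 0 ≤ M ^ 2 * u ^ 2 := by positivity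
    rw [h4]
    linarith
  calc ((1 + u ^ 2)⁻¹) ^ 2 = (1 + u ^ 2)⁻¹ * (1 + u ^ 2)⁻¹ := pow_two _
    _ ≤ ((2 + 2 * M ^ 2) * wt (η + loglam (-u))) * ((2 + 2 * M ^ 2) * wt (η + loglam u)) :=
        mul_le_mul (key _ (abs_neg u)) (key u rfl) (by positivity)
          (mul_nonneg (by positivity) (wt_pos _).le)
    _ = _ := by ring

/-- The integral kernel, in logarithmic coordinates, of the quantization of `f`. -/
noncomputable def quantKer (s : ℤˣ) (f : ℝ × ℝ → ℂ) (p q : ℝ) : ℂ :=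
  pft f (q - p) (sexp s (p - loglam (p - q)))

theorem continuous_quantKer (s : ℤˣ) {f : ℝ × ℝ → ℂ} (hf : IsTest f) :
    Continuous fun z : ℝ × ℝ => quantKer s f z.1 z.2 := by
  have h1 := contDiff_loglam.continuous
  have h2 := continuous_sexp s
  have h3 : Continuous fun z : ℝ × ℝ => (z.2 - z.1, sexp s (z.1 - loglam (z.1 - z.2))) := by
    fun_prop
  have h4 := hf.continuous_pft.comp h3
  simpa only [quantKer, Function.comp_def] using h4

theorem quantKer_bound {s : ℤˣ} {f g : ℝ × ℝ → ℂ} (hf : IsTest f) (hs : tsupport f ⊆ orbit s)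
    (hg : IsTest g) (hgf : ∀ z, g z ≠ 0 → z ∈ tsupport f) :
    ∃ C, 0 ≤ C ∧ ∀ p q, ‖quantKer s g p q‖ ≤ C * (wt p * wt q) := by
  obtain ⟨M, hM0, hM⟩ := exists_log_bound_of_orbit hf hs
  obtain ⟨C, hC0, hC⟩ := IsTest.pft_decay 2 hg
  refine ⟨C * (2 + 2 * M ^ 2) ^ 2, by positivity, fun p q => ?_⟩
  have hp := wt_pos p
  have hq := wt_pos q
  by_cases hη : |p - loglam (p - q)| ≤ M
  · have h1 := wt_bound (u := q - p) hη
    have e1 : p - loglam (p - q) + loglam (-(q - p)) = p := by rw [neg_sub]; ring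
    have e2 : p - loglam (p - q) + loglam (q - p) = q := by
      rw [loglam_eq (q - p), neg_sub]; ring
    rw [e1, e2] at h1
    calc ‖quantKer s g p q‖ ≤ C / (1 + (q - p) ^ 2) ^ 2 := hC _ _
      _ = C * ((1 + (q - p) ^ 2)⁻¹) ^ 2 := by rw [inv_pow, div_eq_mul_inv]
      _ ≤ C * ((2 + 2 * M ^ 2) ^ 2 * (wt p * wt q)) := by gcongr
      _ = _ := by ring
  · have h0 : ∀ x : ℝ, g (x, sexp s (p - loglam (p - q))) = 0 := fun x => by
      by_contra h
      exact hη (hM _ _ (hgf _ h)).2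
    rw [quantKer, pft_eq]
    simp only [h0, mul_zero, integral_zero, norm_zero]
    positivity

/-- The derivative of `quantKer` in the first variable. -/
noncomputable def quantKer' (s : ℤˣ) (f : ℝ × ℝ → ℂ) (p q : ℝ) : ℂ :=
  -quantKer s (fun z => (-(2 * Real.pi * Complex.I * z.1)) * f z) p q
    + ((1 - deriv loglam (p - q) : ℝ) : ℂ) * quantKer s (fun z => (z.2 : ℂ) * pd2 f z) p q

theorem isTest_snd_mul {g : ℝ × ℝ → ℂ} (hg : IsTest g) : IsTest fun z => (z.2 : ℂ) * g z :=
  hg.mul (Complex.ofRealCLM.contDiff.comp contDiff_snd)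

theorem isTraceKernel_quantKer {s : ℤˣ} {f : ℝ × ℝ → ℂ} (hf : IsTest f)
    (hs : tsupport f ⊆ orbit s) : IsTraceKernel (quantKer s f) (quantKer' s f) := by
  have hf1 := hf.fst_mul
  have hf2 := isTest_snd_mul hf.pd2
  have hdl : Continuous (deriv loglam) := contDiff_loglam.continuous_deriv (by simp)
  refine ⟨fun p q => ?_, (continuous_quantKer s hf).measurable, ?_, ?_⟩
  · have h1 : HasDerivAt (fun p => q - p) (-1) p := (hasDerivAt_id p).const_sub q
    have h2 : HasDerivAt (fun p => p - loglam (p - q)) (1 - deriv loglam (p - q)) p := by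
      have := (hasDerivAt_loglam (p - q)).comp p ((hasDerivAt_id p).sub_const q)
      rw [mul_one] at this
      exact (hasDerivAt_id p).sub this
    have h3 : HasDerivAt (fun p => sexp s (p - loglam (p - q)))
        (sexp s (p - loglam (p - q)) * (1 - deriv loglam (p - q))) p :=
      (hasDerivAt_sexp s _).comp p h2
    refine (hf.hasDerivAt_pft_comp h1 h3).congr_deriv ?_
    have h4 : ∀ w y : ℝ, pft (fun z => (z.2 : ℂ) * pd2 f z) w y = y * pft (pd2 f) w y := by
      intro w y
      simp only [pft_eq, ← integral_const_mul]
      exact integral_congr_ae (Filter.Eventually.of_forall fun x => by ring)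
    rw [quantKer', quantKer, quantKer, h4]
    push_cast
    ring
  · have h1 := continuous_quantKer s hf1
    have h2 := continuous_quantKer s hf2
    unfold quantKer'
    exact Continuous.measurable (by fun_prop)
  · have hsub : ∀ z, f z ≠ 0 → z ∈ tsupport f := fun z h => subset_tsupport f h
    obtain ⟨C0, h00, h0⟩ := quantKer_bound hf hs hf hsub
    obtain ⟨C1, h10, h1⟩ := quantKer_bound hf hs hf1
      fun z h => hsub z (right_ne_zero_of_mul h)
    obtain ⟨C2, h20, h2⟩ := quantKer_bound hf hs hf2
      fun z h => pd2_support (right_ne_zero_of_mul h)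
    refine ⟨C0 + (C1 + C2), by positivity, fun p q => ?_⟩
    have hw : 0 ≤ wt p * wt q := mul_nonneg (wt_pos p).le (wt_pos q).le
    constructor
    · exact (h0 p q).trans (mul_le_mul_of_nonneg_right (by linarith) hw)
    · have hd : ‖((1 - deriv loglam (p - q) : ℝ) : ℂ)‖ ≤ 1 := by
        rw [Complex.norm_real, Real.norm_eq_abs, abs_le]
        have := deriv_loglam_mem (p - q)
        constructor <;> linarith
      calc ‖quantKer' s f p q‖ ≤ _ := norm_add_le _ _
        _ ≤ C1 * (wt p * wt q) + 1 * (C2 * (wt p * wt q)) := by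
            rw [norm_neg, norm_mul]
            exact add_le_add (h1 p q) (mul_le_mul hd (h2 p q) (norm_nonneg _) zero_le_one)
        _ = (C1 + C2) * (wt p * wt q) := by ring
        _ ≤ _ := mul_le_mul_of_nonneg_right (by linarith) hw

/-- The change of variables `p = η + log λ(-u)`, `q = η + log λ(u)` turns the pairing of the
symbol with `weylFun` into the sesquilinear form with kernel `quantKer`. -/
theorem integral_pft_mul_weylFun {s : ℤˣ} {f : ℝ × ℝ → ℂ} {φ ψ : ℝ → ℂ} (hf : IsTest f)
    (hφ : IsHalfTest s φ) (hψ : IsHalfTest s ψ) :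
    ∫ η, ∫ u, pft f u (sexp s η) * weylFun φ ψ (u, sexp s η)
      = ∫ z : ℝ × ℝ, (starRingEnd ℂ) (φ (sexp s z.1)) * quantKer s f z.1 z.2 *
        ψ (sexp s z.2) := by
  obtain ⟨M, hM0, hM⟩ := weylFun_bound hφ hψ
  obtain ⟨N, hN0, hN⟩ := hφ.exists_log_bound
  obtain ⟨L, hL0, hL⟩ := hψ.exists_log_bound
  have hGc := (isTest_weylFun hφ hψ).1.continuous
  have hsc := continuous_sexp s
  have hlc := contDiff_loglam.continuous
  have hpc := hf.continuous_pft
  have hφc := hφ.comp_sexp.1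
  have hψc := hψ.comp_sexp.1
  rw [integral_integral_swap]
  swap
  · refine integrable_of_square (M := M) ?_ fun z hz => ?_
    · exact (hpc.comp (by fun_prop : Continuous fun z : ℝ × ℝ => (z.2, sexp s z.1))).mul
        (hGc.comp (by fun_prop : Continuous fun z : ℝ × ℝ => (z.2, sexp s z.1)))
    · exact (hM _ _ (right_ne_zero_of_mul hz)).symm
  have h1 : ∀ u : ℝ, ∫ η, pft f u (sexp s η) * weylFun φ ψ (u, sexp s η)
      = ∫ p, pft f u (sexp s (p - loglam (-u))) *
        ((starRingEnd ℂ) (φ (sexp s p)) * ψ (sexp s (p + u))) := by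
    intro u
    rw [← integral_sub_right_eq_self _ (loglam (-u))]
    refine integral_congr_ae (Filter.Eventually.of_forall fun p => ?_)
    simp only
    rw [weylFun_sexp, sub_add_cancel]
  simp only [h1]
  rw [integral_integral_swap]
  swap
  · refine integrable_of_square (M := N + L) ?_ fun z hz => ?_
    · exact (hpc.comp (by fun_prop :
        Continuous fun z : ℝ × ℝ => (z.1, sexp s (z.2 - loglam (-z.1))))).mul
        ((Complex.continuous_conj.comp (hφc.comp continuous_snd)).mul
          (hψc.comp (by fun_prop : Continuous fun z : ℝ × ℝ => z.2 + z.1)))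
    · have h2 := right_ne_zero_of_mul hz
      have h3 := abs_le.1 (hN z.2 fun h0 => h2 (by simp only [h0, map_zero, zero_mul]))
      have h4 := abs_le.1 (hL _ (right_ne_zero_of_mul h2))
      exact ⟨abs_le.2 ⟨by linarith, by linarith⟩, abs_le.2 ⟨by linarith, by linarith⟩⟩
  rw [Measure.volume_eq_prod, integral_prod]
  swap
  · have hk := continuous_quantKer s hf
    refine integrable_of_square (M := N + L) ?_ fun z hz => ?_
    · exact ((Complex.continuous_conj.comp (hφc.comp continuous_fst)).mul hk).mul
        (hψc.comp continuous_snd)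
    · have h3 := hN z.1 fun h0 => hz (by simp only [h0, map_zero, zero_mul])
      have h4 := hL z.2 (right_ne_zero_of_mul hz)
      exact ⟨by linarith, by linarith⟩
  refine integral_congr_ae (Filter.Eventually.of_forall fun p => ?_)
  simp only
  rw [← integral_sub_right_eq_self _ p]
  refine integral_congr_ae (Filter.Eventually.of_forall fun q => ?_)
  simp only
  rw [quantKer, neg_sub, add_sub_cancel]
  ring

/-- Test vectors and their smooth representatives. -/
theorem IsTestVector.exists_rep {s : ℤˣ} {ψ : HilbK s} (h : IsTestVector s ψ) :
    ∃ f, IsHalfTest s f ∧ ψ =ᵐ[halfMeas s] f :=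
  let ⟨f, h1, h2, h3, h4⟩ := h
  ⟨f, ⟨h1, h2, h3⟩, h4⟩

/-- The quantization of a test function on an orbit is trace class; its product with an operator of
the group has the trace prescribed by the kernel `kerE`. -/
theorem exists_quantization {s : ℤˣ} {f : ℝ × ℝ → ℂ} (hf : IsTest f)
    (hs : tsupport f ⊆ orbit s) :
    ∃ Q : HilbK s →L[ℂ] HilbK s, IsQuantization quantL leftMeas s f Q ∧
      (∀ g : Aff, HasTrace (Q.comp (rep s g)) (∫ z in orbit s, f z * kerE z g ∂leftMeas)) ∧
      ∀ (μ : Measure Aff) [SFinite μ] (F : Aff → ℂ) (A : HilbK s →L[ℂ] HilbK s),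
        Integrable F μ → IsIntegratedRep s μ F A →
          HasTrace (Q.comp A) (∫ z in orbit s, f z * fourierMoyal kerE μ F z ∂leftMeas) := by
  obtain ⟨M, hM0, hM⟩ := exists_log_bound_of_orbit hf hs
  obtain ⟨Q, hQ1, hQ2, hQ3⟩ := (isTraceKernel_quantKer hf hs).exists_operator s
  have hfc : Continuous fun p => f (orbitParam s p) :=
    hf.1.continuous.comp (continuous_orbitParam s)
  have hsupp : ∀ p, f (orbitParam s p) ≠ 0 → |p.1| ≤ M ∧ |p.2| ≤ M := fun p hp =>
    hM _ _ (subset_tsupport f hp)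
  have hfi : IntegrableOn f (orbit s) leftMeas := by
    rw [integrableOn_leftMeas]
    exact integrable_of_square hfc hsupp
  have hdiag : ∀ g : Aff, ∫ p, phase g.b (sexp s p) * quantKer s f (p + Real.log g.a) p
      = ∫ z in orbit s, f z * kerE z g ∂leftMeas := by
    intro g
    have hc := continuous_kerE g
    rw [integral_leftMeas, Measure.volume_eq_prod, integral_prod_symm]
    swap
    · exact integrable_of_square (hfc.mul (hc.comp (continuous_orbitParam s)))
        fun p hp => hsupp p (left_ne_zero_of_mul hp)
    rw [← integral_add_right_eq_self _ (loglam (-Real.log g.a))]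
    refine integral_congr_ae (Filter.Eventually.of_forall fun p => ?_)
    simp only [kerE_orbitParam]
    have e1 : p + loglam (-Real.log g.a) - (p + loglam (-Real.log g.a) + Real.log g.a)
        = -Real.log g.a := by ring
    have e2 : p + loglam (-Real.log g.a) + Real.log g.a - (p + loglam (-Real.log g.a))
        = Real.log g.a := by ring
    have e3 : p + loglam (-Real.log g.a) + Real.log g.a - loglam (Real.log g.a) = p := by
      rw [loglam_eq (Real.log g.a)]; ring
    rw [quantKer, pft_eq, e1, e2, e3, ← phase_mul, sexp_mul_lam, ← integral_const_mul]
    refine integral_congr_ae (Filter.Eventually.of_forall fun x => ?_)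
    simp only [orbitParam]
    ring
  refine ⟨Q, fun φ ψ hφ hψ => ?_, fun g => ?_, fun μ _ F A hF hA => ?_⟩
  · obtain ⟨φ', hφ', hφe⟩ := hφ.exists_rep
    obtain ⟨ψ', hψ', hψe⟩ := hψ.exists_rep
    have hG := isTest_weylFun hφ' hψ'
    have hΩ : ∀ p, quantL s (orbitParam s p) φ ψ = pft (weylFun φ' ψ') p.1 (sexp s p.2) :=
      fun p => quantL_eq hφe hψe hφ' hψ' (orbitParam_mem s p)
    have hint : Integrable fun p : ℝ × ℝ =>
        f (orbitParam s p) * pft (weylFun φ' ψ') p.1 (sexp s p.2) := by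
      have hsc := continuous_sexp s
      exact integrable_of_square (hfc.mul (hG.continuous_pft.comp
        (by fun_prop : Continuous fun p : ℝ × ℝ => (p.1, sexp s p.2))))
        fun p hp => hsupp p (left_ne_zero_of_mul hp)
    have hi : ∀ {χ : HilbK s} {χ' : ℝ → ℂ}, IsHalfTest s χ' → χ =ᵐ[halfMeas s] χ' →
        Integrable fun p => χ (sexp s p) := fun h h' =>
      h.integrable_comp_sexp.congr ((ae_sexp h').mono fun p hp => hp.symm)
    rw [integrableOn_leftMeas, integral_leftMeas]
    simp only [hΩ]
    refine ⟨hint, ?_⟩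
    rw [hQ1 φ ψ (hi hφ' hφe) (hi hψ' hψe), Measure.volume_eq_prod, integral_prod_symm _ hint]
    have h1 : ∀ η : ℝ, ∫ x, f (orbitParam s (x, η)) * pft (weylFun φ' ψ') x (sexp s η)
        = ∫ u, pft f u (sexp s η) * weylFun φ' ψ' (u, sexp s η) := fun η =>
      (hf.integral_pft_mul hG (sexp s η)).symm
    simp only [h1]
    rw [integral_pft_mul_weylFun hf hφ' hψ', Measure.volume_eq_prod]
    refine integral_congr_ae ?_
    have a1 := Measure.quasiMeasurePreserving_fst (μ := (volume : Measure ℝ))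
      (ν := (volume : Measure ℝ)) |>.ae (ae_sexp hφe)
    have a2 := Measure.quasiMeasurePreserving_snd (μ := (volume : Measure ℝ))
      (ν := (volume : Measure ℝ)) |>.ae (ae_sexp hψe)
    filter_upwards [a1, a2] with z h1 h2
    rw [h1, h2]
  · rw [← hdiag]
    exact hQ2 g
  · have h := hQ3 μ F A hF hA
    simp only [hdiag] at h
    have e : ∫ g, F g * ∫ z in orbit s, f z * kerE z g ∂leftMeas ∂μ
        = ∫ z in orbit s, f z * fourierMoyal kerE μ F z ∂leftMeas := by
      have : SFinite (leftMeas.restrict (orbit s)) := by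
        rw [leftMeas_restrict]; infer_instance
      simp only [fourierMoyal, ← integral_const_mul]
      rw [integral_integral_swap]
      · refine integral_congr_ae (Filter.Eventually.of_forall fun z => ?_)
        refine integral_congr_ae (Filter.Eventually.of_forall fun g => ?_)
        simp only
        ring
      · refine (hF.mul_prod hfi).norm.mono' ?_ (Filter.Eventually.of_forall fun p => ?_)
        · exact hF.1.comp_fst.mul (hfi.1.comp_snd.mul
            (measurable_kerE.comp measurable_swap).aestronglyMeasurable)
        · simp only [Function.uncurry, norm_mul, norm_kerE, mul_one]
          exact le_rfl
    rwa [e] at h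

/-! ### Haar measures in logarithmic coordinates -/

namespace Aff

/-- The global chart `(t, b) ↦ (e^t, b)`. -/
noncomputable def param (p : ℝ × ℝ) : Aff := ⟨Real.exp p.1, p.2, Real.exp_pos _⟩

theorem measurable_iff_pair {X : Type*} [MeasurableSpace X] {f : X → Aff} :
    Measurable f ↔ Measurable fun x => ((f x).a, (f x).b) :=
  measurable_comap_iff

theorem measurable_param : Measurable param :=
  measurable_iff_pair.2 (by simp only [param]; fun_prop)

theorem param_log (g : Aff) : param (Real.log g.a, g.b) = g := by
  ext
  · exact Real.exp_log g.a_pos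
  · rfl

instance : MeasurableMul₂ Aff :=
  ⟨measurable_iff_pair.2 <| by
    have h1 : Measurable fun p : Aff × Aff => p.1.a := measurable_a.comp measurable_fst
    have h2 : Measurable fun p : Aff × Aff => p.2.a := measurable_a.comp measurable_snd
    have h3 : Measurable fun p : Aff × Aff => p.1.b := measurable_b.comp measurable_fst
    have h4 : Measurable fun p : Aff × Aff => p.2.b := measurable_b.comp measurable_snd
    exact (h1.mul h2).prodMk ((h1.mul h4).add h3)⟩

instance : MeasurableInv Aff :=
  ⟨measurable_iff_pair.2 <| measurable_a.inv.prodMk (measurable_b.neg.div measurable_a)⟩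

theorem measurableEmbedding_pair : MeasurableEmbedding fun g : Aff => (g.a, g.b) := by
  have hr : Set.range (fun g : Aff => (g.a, g.b)) = Set.Ioi 0 ×ˢ Set.univ := by
    ext p
    constructor
    · rintro ⟨g, rfl⟩
      exact ⟨g.a_pos, trivial⟩
    · rintro ⟨h, -⟩
      exact ⟨⟨p.1, p.2, h⟩, rfl⟩
  refine ⟨fun g h e => Aff.ext (congrArg Prod.fst e) (congrArg Prod.snd e),
    comap_measurable _, ?_⟩
  rintro _ ⟨T, hT, rfl⟩
  rw [Set.image_preimage_eq_inter_range, hr]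
  exact hT.inter (measurableSet_Ioi.prod MeasurableSet.univ)

theorem lintegral_comap_pair {D : ℝ × ℝ → ENNReal} (hD : Measurable D) {F : Aff → ENNReal}
    (hF : Measurable F) :
    ∫⁻ g, F g ∂(Measure.comap (fun g : Aff => (g.a, g.b))
        ((volume : Measure (ℝ × ℝ)).withDensity D))
      = ∫⁻ t, ENNReal.ofReal (Real.exp t) *
          ∫⁻ b, D (Real.exp t, b) * F (param (t, b)) := by
  have hr : Set.range (fun g : Aff => (g.a, g.b)) = Set.Ioi 0 ×ˢ Set.univ := by
    ext p
    constructor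
    · rintro ⟨g, rfl⟩
      exact ⟨g.a_pos, trivial⟩
    · rintro ⟨h, -⟩
      exact ⟨⟨p.1, p.2, h⟩, rfl⟩
  have hF' : Measurable fun p : ℝ × ℝ => F (param (Real.log p.1, p.2)) :=
    hF.comp (measurable_param.comp (by fun_prop))
  have e1 : ∀ g : Aff, F g = (fun p : ℝ × ℝ => F (param (Real.log p.1, p.2))) (g.a, g.b) :=
    fun g => by simp only [param_log]
  rw [lintegral_congr e1, ← lintegral_map hF' (comap_measurable _),
    measurableEmbedding_pair.map_comap, hr,
    restrict_withDensity (measurableSet_Ioi.prod MeasurableSet.univ),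
    lintegral_withDensity_eq_lintegral_mul _ hD hF', Measure.volume_eq_prod,
    ← Measure.prod_restrict, Measure.restrict_univ,
    lintegral_prod _ (hD.mul hF').aemeasurable]
  have h := lintegral_image_eq_lintegral_abs_deriv_mul (f := Real.exp) (f' := Real.exp)
    MeasurableSet.univ (fun p _ => (Real.hasDerivAt_exp p).hasDerivWithinAt)
    Real.exp_injective.injOn
    (fun a => ∫⁻ b, (D * fun p : ℝ × ℝ => F (param (Real.log p.1, p.2))) (a, b))
  rw [Set.image_univ, Real.range_exp, Measure.restrict_univ] at h
  rw [h]
  simp [Real.abs_exp]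

theorem lintegral_rightHaar {F : Aff → ENNReal} (hF : Measurable F) :
    ∫⁻ g, F g ∂rightHaar = ∫⁻ t, ∫⁻ b, F (param (t, b)) := by
  rw [rightHaar, lintegral_comap_pair (by fun_prop) hF]
  refine lintegral_congr fun t => ?_
  simp only
  rw [lintegral_const_mul' _ _ ENNReal.ofReal_ne_top, ← mul_assoc,
    ← ENNReal.ofReal_mul (Real.exp_pos t).le, mul_one_div_cancel (Real.exp_ne_zero t)]
  simp

theorem lintegral_leftHaar {F : Aff → ENNReal} (hF : Measurable F) :
    ∫⁻ g, F g ∂leftHaar = ∫⁻ t, ENNReal.ofReal (Real.exp (-t)) * ∫⁻ b, F (param (t, b)) := by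
  rw [leftHaar, lintegral_comap_pair (by fun_prop) hF]
  refine lintegral_congr fun t => ?_
  simp only
  rw [lintegral_const_mul' _ _ ENNReal.ofReal_ne_top, ← mul_assoc,
    ← ENNReal.ofReal_mul (Real.exp_pos t).le]
  congr 2
  rw [Real.exp_neg]
  have := Real.exp_pos t
  field_simp

theorem measurePreserving_param : MeasurePreserving param volume rightHaar := by
  refine ⟨measurable_param, ?_⟩
  refine Measure.ext_of_lintegral _ fun F hF => ?_
  rw [lintegral_map hF measurable_param, lintegral_rightHaar hF, Measure.volume_eq_prod,
    lintegral_prod (fun p => F (param p)) (hF.comp measurable_param).aemeasurable]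

theorem leftHaar_eq : leftHaar = rightHaar.withDensity fun g => ENNReal.ofReal (1 / g.a) := by
  have ha := measurable_a
  have hm : Measurable fun g : Aff => ENNReal.ofReal (1 / g.a) := by fun_prop
  refine Measure.ext_of_lintegral _ fun F hF => ?_
  rw [lintegral_withDensity_eq_lintegral_mul _ hm hF, lintegral_rightHaar (hm.mul hF),
    lintegral_leftHaar hF]
  refine lintegral_congr fun t => ?_
  rw [← lintegral_const_mul' _ _ ENNReal.ofReal_ne_top]
  refine lintegral_congr fun b => ?_
  simp only [Pi.mul_apply, param]
  rw [Real.exp_neg, one_div]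

instance : SFinite rightHaar := by
  rw [← measurePreserving_param.map_eq]; infer_instance

instance : SFinite leftHaar := by
  rw [leftHaar_eq]; infer_instance

theorem lintegral_comp_affine {c : ℝ} (hc : c ≠ 0) (d : ℝ) {G : ℝ → ENNReal} (hG : Measurable G) :
    ∫⁻ b, G (c * b + d) = ENNReal.ofReal |c⁻¹| * ∫⁻ b, G b := by
  have h1 := lintegral_map (μ := volume) (f := fun b => G (b + d)) (by fun_prop)
    (measurable_const_mul c)
  rw [Real.map_volume_mul_left hc, lintegral_smul_measure,
    lintegral_add_right_eq_self (fun b => G b) d] at h1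
  exact h1.symm

theorem measurePreserving_mul_left (k : Aff) :
    MeasurePreserving (fun g => k * g) leftHaar leftHaar := by
  have hk : Measurable fun g : Aff => k * g := measurable_const_mul k
  refine ⟨hk, Measure.ext_of_lintegral _ fun F hF => ?_⟩
  have hm : ∀ t, Measurable fun b => F (param (t, b)) := fun t =>
    hF.comp (measurable_param.comp (by fun_prop))
  have e : ∀ t b, k * param (t, b) = param (t + Real.log k.a, k.a * b + k.b) := by
    intro t b
    ext
    · simp [param, Real.exp_add, Real.exp_log k.a_pos, mul_comm]
    · simp [param]
  rw [lintegral_map hF hk, lintegral_leftHaar (F := fun g => F (k * g)) (hF.comp hk), lintegral_leftHaar hF,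
    ← lintegral_add_right_eq_self
      (fun t => ENNReal.ofReal (Real.exp (-t)) * ∫⁻ b, F (param (t, b))) (Real.log k.a)]
  refine lintegral_congr fun t => ?_
  simp only [e]
  rw [lintegral_comp_affine k.a_pos.ne' k.b (hm _), ← mul_assoc,
    ← ENNReal.ofReal_mul (Real.exp_pos _).le, neg_add, Real.exp_add, Real.exp_neg (Real.log k.a),
    Real.exp_log k.a_pos, abs_of_pos (inv_pos.2 k.a_pos)]

theorem measurePreserving_inv : MeasurePreserving (fun g : Aff => g⁻¹) leftHaar rightHaar := by
  refine ⟨measurable_inv, Measure.ext_of_lintegral _ fun F hF => ?_⟩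
  have hm : ∀ t, Measurable fun b => F (param (t, b)) := fun t =>
    hF.comp (measurable_param.comp (by fun_prop))
  have e : ∀ t b, (param (t, b))⁻¹ = param (-t, -Real.exp (-t) * b + 0) := by
    intro t b
    ext
    · simp [param, Real.exp_neg]
    · simp only [param, inv_b, Real.exp_neg]
      field_simp
      simp
  rw [lintegral_map hF measurable_inv, lintegral_leftHaar (F := fun g => F g⁻¹) (hF.comp measurable_inv),
    lintegral_rightHaar hF, ← lintegral_neg_eq_self (fun t => ∫⁻ b, F (param (t, b)))]
  refine lintegral_congr fun t => ?_
  simp only [e]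
  rw [lintegral_comp_affine (neg_ne_zero.2 (Real.exp_ne_zero _)) 0 (hm _), ← mul_assoc,
    ← ENNReal.ofReal_mul (Real.exp_pos _).le, abs_inv, abs_neg, Real.abs_exp,
    mul_inv_cancel₀ (Real.exp_ne_zero _), ENNReal.ofReal_one, one_mul]

theorem measurableEmbedding_param : MeasurableEmbedding param := by
  have h : Function.LeftInverse (fun g : Aff => (Real.log g.a, g.b)) param := fun p => by
    simp [param]
  refine MeasurableEquiv.measurableEmbedding
    ⟨⟨param, fun g => (Real.log g.a, g.b), h, param_log⟩, measurable_param,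
      (Real.measurable_log.comp measurable_a).prodMk measurable_b⟩

/-- Passing from right to left Haar measure multiplies the density by `a`. -/
theorem integral_rightHaar_eq (F : Aff → ℂ) :
    ∫ g, F g ∂rightHaar = ∫ g, (g.a : ℂ) * F g ∂leftHaar := by
  have ha := measurable_a
  rw [leftHaar_eq, integral_withDensity_eq_integral_toReal_smul (by fun_prop)
    (Filter.Eventually.of_forall fun g => ENNReal.ofReal_lt_top)]
  refine integral_congr_ae (Filter.Eventually.of_forall fun g => ?_)
  have h := g.a_pos
  simp only
  rw [ENNReal.toReal_ofReal (by positivity), Complex.real_smul, ← mul_assoc, ← Complex.ofReal_mul,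
    one_div_mul_cancel h.ne', Complex.ofReal_one, one_mul]

theorem integrable_rightHaar_iff {F : Aff → ℂ} :
    Integrable F rightHaar ↔ Integrable (fun g => (g.a : ℂ) * F g) leftHaar := by
  have ha := measurable_a
  rw [leftHaar_eq, integrable_withDensity_iff_integrable_smul' (by fun_prop)
    (Filter.Eventually.of_forall fun g => ENNReal.ofReal_lt_top)]
  refine integrable_congr (Filter.Eventually.of_forall fun g => ?_)
  have h := g.a_pos
  simp only
  rw [ENNReal.toReal_ofReal (by positivity), Complex.real_smul, ← mul_assoc, ← Complex.ofReal_mul,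
    one_div_mul_cancel h.ne', Complex.ofReal_one, one_mul]

/-- Both convolutions are the same function on the group. -/
theorem rightConv_eq_leftConv (f h : Aff → ℂ) : rightConv f h = leftConv f h := by
  ext g
  have e1 := measurePreserving_inv.integral_comp
    (MeasurableEquiv.inv Aff).measurableEmbedding (fun k => f (g * k⁻¹) * h k)
  have e2 := (measurePreserving_mul_left g⁻¹).integral_comp
    (MeasurableEquiv.mulLeft g⁻¹).measurableEmbedding (fun k => f (g * k) * h k⁻¹)
  rw [rightConv, leftConv, ← e1]
  simp only [inv_inv]
  rw [← e2]
  simp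

end Aff

/-! ### Integrated representations and quantization of Fourier–Moyal transforms -/

theorem rep_mul (s : ℤˣ) (k g : Aff) (ψ : HilbK s) : rep s (k * g) ψ = rep s k (rep s g ψ) := by
  apply Lp.ext
  have h1 := (halfMeas_dilation s k.a k.a_pos).quasiMeasurePreserving.ae (rep_coe s g ψ)
  filter_upwards [rep_coe s (k * g) ψ, rep_coe s k (rep s g ψ), h1] with r h2 h3 h4
  rw [h2, h3, h4, ← mul_assoc, phase, phase, phase, ← Complex.exp_add]
  congr 2
  · rw [Aff.mul_b]; push_cast; ring
  · rw [Aff.mul_a, mul_assoc, mul_left_comm]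

theorem measurable_inner_rep {s : ℤˣ} (φ ψ : HilbK s) :
    Measurable fun g => inner ℂ φ (rep s g ψ) := by
  have m1 : Measurable fun z : Aff × ℝ => z.1.a := Aff.measurable_a.comp measurable_fst
  have m2 : Measurable fun z : Aff × ℝ => z.1.b := Aff.measurable_b.comp measurable_fst
  have m3 := (continuous_sexp s).measurable
  have h : Measurable fun z : Aff × ℝ => (starRingEnd ℂ) (φ (sexp s z.2)) *
      (phase z.1.b (sexp s z.2) * ψ (sexp s (z.2 + Real.log z.1.a))) := by
    refine Measurable.mul ?_ (Measurable.mul ?_ ?_)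
    · exact Complex.continuous_conj.measurable.comp
        ((measurable_sexp_comp φ).comp measurable_snd)
    · exact measurable_phase.comp (m2.prodMk (m3.comp measurable_snd))
    · exact (measurable_sexp_comp ψ).comp (measurable_snd.add (Real.measurable_log.comp m1))
  simp only [inner_rep]
  exact h.stronglyMeasurable.integral_prod_right'.measurable

theorem norm_inner_rep_le {s : ℤˣ} (φ ψ : HilbK s) (g : Aff) :
    ‖inner ℂ φ (rep s g ψ)‖ ≤ ‖φ‖ * ‖ψ‖ := by
  refine (norm_inner_le_norm _ _).trans ?_
  gcongr
  simpa using (rep s g).le_of_opNorm_le (norm_rep_le s g) ψ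

theorem integrable_mul_inner_rep {s : ℤˣ} {μ : Measure Aff} {F : Aff → ℂ} (hF : Integrable F μ)
    (φ ψ : HilbK s) : Integrable (fun g => F g * inner ℂ φ (rep s g ψ)) μ :=
  hF.mul_bdd (c := ‖φ‖ * ‖ψ‖) (measurable_inner_rep φ ψ).aestronglyMeasurable
    (Filter.Eventually.of_forall fun g => norm_inner_rep_le φ ψ g)

theorem exists_integratedRep (s : ℤˣ) {μ : Measure Aff} {F : Aff → ℂ} (hF : Integrable F μ) :
    ∃ A : HilbK s →L[ℂ] HilbK s, IsIntegratedRep s μ F A := by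
  obtain ⟨A, hA⟩ := exists_weakIntegral (fun g => F g • rep s g) hF.norm
    (fun g => by
      rw [norm_smul]
      exact mul_le_of_le_one_right (norm_nonneg _) (norm_rep_le s g))
    (fun φ ψ => by
      simp only [smul_apply, inner_smul_right]
      exact (integrable_mul_inner_rep hF φ ψ).1)
  refine ⟨A, fun φ ψ => ⟨integrable_mul_inner_rep hF φ ψ, ?_⟩⟩
  rw [← hA]
  simp only [smul_apply, inner_smul_right]

theorem continuous_fourierMoyal {μ : Measure Aff} {F : Aff → ℂ} (hF : Integrable F μ) :
    Continuous (fourierMoyal kerE μ F) := by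
  refine continuous_of_dominated (bound := fun g => ‖F g‖) (fun z => ?_) (fun z => ?_) hF.norm ?_
  · exact (measurable_kerE.comp measurable_prodMk_left).aestronglyMeasurable.mul hF.1
  · exact Filter.Eventually.of_forall fun g => by rw [norm_mul, norm_kerE, one_mul]
  · exact Filter.Eventually.of_forall fun g => (continuous_kerE g).mul continuous_const

/-- By Fourier inversion, the matrix elements of the representation are the pairings of the kernel
`kerE` with the quantizer. -/
theorem integral_kerE_mul_pft {s : ℤˣ} {φ ψ : HilbK s} {φ' ψ' : ℝ → ℂ} (hφ : φ =ᵐ[halfMeas s] φ')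
    (hψ : ψ =ᵐ[halfMeas s] ψ') (hφ' : IsHalfTest s φ') (hψ' : IsHalfTest s ψ') (g : Aff) :
    ∫ η, ∫ x, kerE (orbitParam s (x, η)) g * pft (weylFun φ' ψ') x (sexp s η)
      = inner ℂ φ (rep s g ψ) := by
  rw [inner_rep_weylFun hφ hψ]
  refine integral_congr_ae (Filter.Eventually.of_forall fun η => ?_)
  simp only [kerE_orbitParam]
  rw [← (isTest_weylFun hφ' hψ').pft_inversion (Real.log g.a) (sexp s η), ← integral_const_mul]
  refine integral_congr_ae (Filter.Eventually.of_forall fun x => ?_)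
  have e : -(2 * Real.pi * Complex.I * (x : ℂ)) * ((-Real.log g.a : ℝ) : ℂ)
      = 2 * Real.pi * Complex.I * ((Real.log g.a : ℝ) : ℂ) * x := by push_cast; ring
  simp only [e]
  ring

theorem integrable_pft_weylFun {s : ℤˣ} {φ ψ : ℝ → ℂ} (hφ : IsHalfTest s φ)
    (hψ : IsHalfTest s ψ) :
    Integrable fun p : ℝ × ℝ => pft (weylFun φ ψ) p.1 (sexp s p.2) := by
  obtain ⟨M, hM0, hM⟩ := weylFun_bound hφ hψ
  have hG := isTest_weylFun hφ hψ
  obtain ⟨C, hC0, hC⟩ := IsTest.pft_decay 1 hG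
  have hsc := continuous_sexp s
  have hbd : Integrable fun p : ℝ × ℝ =>
      (1 + p.1 ^ 2)⁻¹ * (Set.Icc (-M) M).indicator (fun _ => C) p.2 :=
    integrable_inv_one_add_sq.mul_prod ((integrable_indicator_iff measurableSet_Icc).2
      (integrableOn_const (by simp)))
  refine hbd.mono' ?_ (Filter.Eventually.of_forall fun p => ?_)
  · exact (hG.continuous_pft.comp
      (by fun_prop : Continuous fun p : ℝ × ℝ => (p.1, sexp s p.2))).aestronglyMeasurable
  · by_cases hp : p.2 ∈ Set.Icc (-M) M
    · rw [Set.indicator_of_mem hp, mul_comm, ← div_eq_mul_inv]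
      simpa using hC p.1 (sexp s p.2)
    · have h0 : ∀ u : ℝ, weylFun φ ψ (u, sexp s p.2) = 0 := fun u => by
        by_contra h
        exact hp (abs_le.1 (hM u p.2 h).2)
      rw [Set.indicator_of_notMem hp, mul_zero, pft_eq]
      simp [h0]

/-- The operator `U(F)` is the quantization of the transform of `F`. -/
theorem isQuantization_fourierMoyal {s : ℤˣ} {μ : Measure Aff} [SFinite μ] {F : Aff → ℂ}
    (hF : Integrable F μ) {A : HilbK s →L[ℂ] HilbK s} (hA : IsIntegratedRep s μ F A) :
    IsQuantization quantL leftMeas s (fourierMoyal kerE μ F) A := by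
  intro φ ψ hφ hψ
  obtain ⟨φ', hφ', hφe⟩ := hφ.exists_rep
  obtain ⟨ψ', hψ', hψe⟩ := hψ.exists_rep
  have hΩ : ∀ p, quantL s (orbitParam s p) φ ψ = pft (weylFun φ' ψ') p.1 (sexp s p.2) :=
    fun p => quantL_eq hφe hψe hφ' hψ' (orbitParam_mem s p)
  have hI := integrable_pft_weylFun hφ' hψ'
  have hcp := (continuous_orbitParam s).measurable
  have hint : Integrable (fun q : (ℝ × ℝ) × Aff =>
      kerE (orbitParam s q.1) q.2 * F q.2 * pft (weylFun φ' ψ') q.1.1 (sexp s q.1.2))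
      (volume.prod μ) := by
    refine (hI.mul_prod hF).norm.mono' ?_ (Filter.Eventually.of_forall fun q => ?_)
    · exact (((measurable_kerE.comp ((hcp.comp measurable_fst).prodMk
        measurable_snd)).aestronglyMeasurable).mul hF.1.comp_snd).mul hI.1.comp_fst
    · rw [norm_mul, norm_mul, norm_kerE, one_mul, norm_mul, mul_comm]
  rw [integrableOn_leftMeas, integral_leftMeas]
  simp only [hΩ, fourierMoyal, ← integral_mul_const]
  refine ⟨hint.integral_prod_left, ?_⟩
  rw [integral_integral_swap hint, ← (hA φ ψ).2]
  refine integral_congr_ae (Filter.Eventually.of_forall fun g => ?_)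
  simp only
  have hE : Integrable fun p : ℝ × ℝ =>
      kerE (orbitParam s p) g * pft (weylFun φ' ψ') p.1 (sexp s p.2) :=
    hI.bdd_mul (c := 1) (((continuous_kerE g).comp
      (continuous_orbitParam s)).aestronglyMeasurable)
      (Filter.Eventually.of_forall fun p => (norm_kerE _ g).le)
  rw [← integral_kerE_mul_pft hφe hψe hφ' hψ' g, ← integral_prod_symm _ hE,
    ← Measure.volume_eq_prod, ← integral_const_mul]
  refine integral_congr_ae (Filter.Eventually.of_forall fun p => ?_)
  simp only
  ring

theorem isSymbol_kerE (s : ℤˣ) (g : Aff) :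
    IsSymbol quantL leftMeas s (rep s g) fun z => kerE z g := by
  refine ⟨(continuous_kerE g).locallyIntegrable.locallyIntegrableOn _, fun f h1 h2 h3 => ?_⟩
  obtain ⟨Q, hQ, hQ1, -⟩ := exists_quantization ⟨h1, h2⟩ h3
  exact ⟨Q, hQ, hQ1 g⟩

/-- The transform of `F` is the dequantization of `U(F)`. -/
theorem isSymbol_fourierMoyal {s : ℤˣ} {μ : Measure Aff} [SFinite μ] {F : Aff → ℂ}
    (hF : Integrable F μ) {A : HilbK s →L[ℂ] HilbK s} (hA : IsIntegratedRep s μ F A) :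
    IsSymbol quantL leftMeas s A (fourierMoyal kerE μ F) := by
  refine ⟨(continuous_fourierMoyal hF).locallyIntegrable.locallyIntegrableOn _,
    fun f h1 h2 h3 => ?_⟩
  obtain ⟨Q, hQ, -, hQ2⟩ := exists_quantization ⟨h1, h2⟩ h3
  exact ⟨Q, hQ, hQ2 μ F A hF hA⟩

theorem integrable_conv_prod {f h : Aff → ℂ} (hf : Integrable f Aff.leftHaar)
    (hh : Integrable h Aff.leftHaar) :
    Integrable (fun p : Aff × Aff => f p.1 * h (p.1⁻¹ * p.2))
      (Aff.leftHaar.prod Aff.leftHaar) := by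
  have hmp : MeasurePreserving (fun p : Aff × Aff => (p.1, p.1⁻¹ * p.2))
      (Aff.leftHaar.prod Aff.leftHaar) (Aff.leftHaar.prod Aff.leftHaar) :=
    (MeasurePreserving.id Aff.leftHaar).skew_product
      (measurable_fst.inv.mul measurable_snd)
      (Filter.Eventually.of_forall fun k => (Aff.measurePreserving_mul_left k⁻¹).map_eq)
  exact hmp.integrable_comp_of_integrable (hf.mul_prod hh)

theorem integrable_leftConv {f h : Aff → ℂ} (hf : Integrable f Aff.leftHaar)
    (hh : Integrable h Aff.leftHaar) : Integrable (Aff.leftConv f h) Aff.leftHaar :=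
  (integrable_conv_prod hf hh).integral_prod_right

/-- The integrated representation is multiplicative. -/
theorem isIntegratedRep_leftConv {s : ℤˣ} {f h : Aff → ℂ} (hf : Integrable f Aff.leftHaar)
    (hh : Integrable h Aff.leftHaar) {A B : HilbK s →L[ℂ] HilbK s}
    (hA : IsIntegratedRep s Aff.leftHaar f A) (hB : IsIntegratedRep s Aff.leftHaar h B) :
    IsIntegratedRep s Aff.leftHaar (Aff.leftConv f h) (A.comp B) := by
  intro φ ψ
  refine ⟨integrable_mul_inner_rep (integrable_leftConv hf hh) φ ψ, ?_⟩
  have hint : Integrable (fun p : Aff × Aff =>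
      f p.1 * h (p.1⁻¹ * p.2) * inner ℂ φ (rep s p.2 ψ)) (Aff.leftHaar.prod Aff.leftHaar) :=
    (integrable_conv_prod hf hh).mul_bdd (c := ‖φ‖ * ‖ψ‖)
      ((measurable_inner_rep φ ψ).comp measurable_snd).aestronglyMeasurable
      (Filter.Eventually.of_forall fun p => norm_inner_rep_le φ ψ p.2)
  simp only [Aff.leftConv, ← integral_mul_const]
  rw [← integral_integral_swap hint, ContinuousLinearMap.comp_apply, ← (hA φ (B ψ)).2]
  refine integral_congr_ae (Filter.Eventually.of_forall fun k => ?_)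
  simp only
  rw [← (Aff.measurePreserving_mul_left k).integral_comp
    (MeasurableEquiv.mulLeft k).measurableEmbedding,
    ← ContinuousLinearMap.adjoint_inner_left, ← (hB _ ψ).2, ← integral_const_mul]
  refine integral_congr_ae (Filter.Eventually.of_forall fun g => ?_)
  simp only [inv_mul_cancel_left]
  rw [rep_mul, ContinuousLinearMap.adjoint_inner_left]
  ring

/-! ### Density of test vectors -/

theorem isHalfTest_comp_log {s : ℤˣ} {g : ℝ → ℝ} (hg : ContDiff ℝ ∞ g)
    (hc : HasCompactSupport g) :
    ∃ f : ℝ → ℂ, IsHalfTest s f ∧ ∀ p, f (sexp s p) = g p := by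
  classical
  let f : ℝ → ℂ := fun r => if r ∈ halfLine s then (g (Real.log r) : ℂ) else 0
  have hlog : ∀ p, Real.log (sexp s p) = p := fun p => by
    rw [← Real.log_abs, abs_sexp, Real.log_exp]
  have hf : ∀ p, f (sexp s p) = g p := fun p => by
    simp only [f, if_pos (sexp_mem_halfLine s p), hlog]
  have hK : IsCompact (sexp s '' tsupport g) := hc.isCompact.image (continuous_sexp s)
  have hsub : tsupport f ⊆ sexp s '' tsupport g := by
    refine closure_minimal (fun r hr => ?_) hK.isClosed
    have hr' : r ∈ halfLine s := by
      by_contra h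
      exact hr (if_neg h)
    refine ⟨Real.log |r|, subset_tsupport g fun h => hr ?_, sexp_log_abs hr'⟩
    rw [← sexp_log_abs hr', hf, h, Complex.ofReal_zero]
  have hsub' : tsupport f ⊆ halfLine s := fun r hr => by
    obtain ⟨p, -, rfl⟩ := hsub hr
    exact sexp_mem_halfLine s p
  refine ⟨f, ⟨contDiff_iff_contDiffAt.2 fun r => ?_, hK.of_isClosed_subset
    (isClosed_tsupport f) hsub, hsub'⟩, hf⟩
  by_cases hr : r ∈ halfLine s
  · have h0 : r ≠ 0 := by
      rintro rfl
      simp [halfLine] at hr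
    have h1 : ContDiffAt ℝ ∞ (fun r => (g (Real.log r) : ℂ)) r :=
      Complex.ofRealCLM.contDiff.contDiffAt.comp r
        (hg.contDiffAt.comp r (Real.contDiffAt_log.2 h0))
    refine h1.congr_of_eventuallyEq ?_
    have ho : IsOpen (halfLine s) := isOpen_lt continuous_const (continuous_const.mul continuous_id)
    filter_upwards [ho.mem_nhds hr] with x hx
    exact if_pos hx
  · refine (contDiffAt_const (c := (0 : ℂ))).congr_of_eventuallyEq ?_
    filter_upwards [(isClosed_tsupport f).isOpen_compl.mem_nhds fun h => hr (hsub' h)] with x hx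
    exact image_eq_zero_of_notMem_tsupport hx

theorem IsHalfTest.exists_vector {s : ℤˣ} {f : ℝ → ℂ} (hf : IsHalfTest s f) :
    ∃ φ : HilbK s, IsTestVector s φ ∧ ∀ᵐ p : ℝ, φ (sexp s p) = f (sexp s p) := by
  have h1 : MemLp (fun p => f (sexp s p)) 2 volume :=
    hf.comp_sexp.1.memLp_of_hasCompactSupport hf.comp_sexp.2
  have h2 : MemLp f 2 (halfMeas s) := by
    rw [← (measurePreserving_sexp s).map_eq,
      (measurableEmbedding_sexp s).memLp_map_measure_iff]
    exact h1
  exact ⟨h2.toLp, ⟨f, hf.contDiff, hf.compact, hf.subset, h2.coeFn_toLp⟩,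
    ae_sexp h2.coeFn_toLp⟩

/-- A vector orthogonal to all test vectors vanishes: test vectors are dense. -/
theorem eq_zero_of_inner_test {s : ℤˣ} {χ : HilbK s}
    (h : ∀ φ : HilbK s, IsTestVector s φ → inner ℂ φ χ = 0) : χ = 0 := by
  have h1 : MemLp (fun p => χ (sexp s p)) 2 volume :=
    (Lp.memLp χ).comp_measurePreserving (measurePreserving_sexp s)
  have h2 : ∀ᵐ p : ℝ, χ (sexp s p) = 0 := by
    refine ae_eq_zero_of_integral_contDiff_smul_eq_zero
      (h1.locallyIntegrable (by norm_num)) fun g hg hc => ?_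
    obtain ⟨f, hf, hfg⟩ := isHalfTest_comp_log (s := s) hg hc
    obtain ⟨φ, hφ, hφf⟩ := hf.exists_vector
    rw [← h φ hφ, inner_hilbK]
    refine integral_congr_ae ?_
    filter_upwards [hφf] with p hp
    rw [hp, hfg, Complex.conj_ofReal, Complex.real_smul]
  rw [← inner_self_eq_zero (𝕜 := ℂ), inner_hilbK]
  refine integral_eq_zero_of_ae ?_
  filter_upwards [h2] with p hp
  simp [hp]

/-- A bounded operator is determined by its matrix elements between test vectors. -/
theorem ext_of_inner_test {s : ℤˣ} {T A : HilbK s →L[ℂ] HilbK s}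
    (h : ∀ φ ψ : HilbK s, IsTestVector s φ → IsTestVector s ψ →
      inner ℂ φ (T ψ) = inner ℂ φ (A ψ)) : T = A := by
  have h1 : ∀ ψ, IsTestVector s ψ → T ψ = A ψ := fun ψ hψ => by
    rw [← sub_eq_zero]
    refine eq_zero_of_inner_test fun φ hφ => ?_
    rw [inner_sub_right, h φ ψ hφ hψ, sub_self]
  have h2 : ContinuousLinearMap.adjoint T = ContinuousLinearMap.adjoint A := by
    ext1 χ
    rw [← sub_eq_zero]
    refine eq_zero_of_inner_test fun φ hφ => ?_
    rw [inner_sub_right, ContinuousLinearMap.adjoint_inner_right,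
      ContinuousLinearMap.adjoint_inner_right, h1 φ hφ, sub_self]
  exact ContinuousLinearMap.adjoint.injective h2

theorem rep_one (s : ℤˣ) : rep s 1 = ContinuousLinearMap.id ℂ (HilbK s) := by
  ext1 ψ
  apply Lp.ext
  filter_upwards [rep_coe s 1 ψ] with r hr
  rw [hr]
  simp [phase]

/-! ### The kernel of the integrated representation -/

theorem le_exp_neg_abs {x C D ℓ : ℝ} (hC : 0 ≤ C) (hD : 0 ≤ D) (h1 : x ≤ C * Real.exp ℓ)
    (h2 : x ≤ D * Real.exp (-ℓ)) : x ≤ (C + D) * Real.exp (-|ℓ|) := by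
  have := Real.exp_pos ℓ
  have := Real.exp_pos (-ℓ)
  rcases le_total 0 ℓ with h | h
  · rw [abs_of_nonneg h]; nlinarith
  · rw [abs_of_nonpos h, neg_neg]; nlinarith

theorem inv_one_add_sq_le {w ℓ : ℝ} (hw : |w| = Real.exp ℓ) :
    (1 + w ^ 2)⁻¹ ≤ Real.exp (-ℓ) := by
  rw [Real.exp_neg, ← hw]
  have h0 : 0 < |w| := by rw [hw]; exact Real.exp_pos _
  refine inv_anti₀ h0 ?_
  nlinarith [sq_abs w, sq_nonneg (|w| - 1)]

theorem IsTest.exists_pft_mul_bound {m : ℝ × ℝ → ℂ} (hm : IsTest m) :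
    ∃ C, 0 ≤ C ∧ ∀ w t ℓ, |w| = Real.exp ℓ → ‖(w : ℂ) * pft m w t‖ ≤ C * Real.exp (-|ℓ|) := by
  obtain ⟨C, hC0, hC⟩ := IsTest.pft_decay 1 hm
  refine ⟨C + C, by positivity, fun w t ℓ hw => ?_⟩
  have h := hC w t
  rw [pow_one, div_eq_mul_inv] at h
  have h3 := inv_one_add_sq_le hw
  have h0 : (1 + w ^ 2)⁻¹ ≤ 1 := wt_le_one w
  have h4 := Real.exp_pos ℓ
  rw [norm_mul, Complex.norm_real, Real.norm_eq_abs, hw]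
  refine le_exp_neg_abs hC0 hC0 ?_ ?_
  · rw [mul_comm]
    exact mul_le_mul_of_nonneg_right (h.trans (mul_le_of_le_one_right hC0 h0)) h4.le
  · have h5 : Real.exp ℓ * (1 + w ^ 2)⁻¹ ≤ Real.exp (-ℓ) := by
      rw [Real.exp_neg, ← hw]
      have hw0 : 0 < |w| := by rw [hw]; exact h4
      rw [← div_eq_mul_inv, div_le_iff₀ (by positivity), ← div_eq_inv_mul, le_div_iff₀ hw0]
      nlinarith [sq_abs w]
    calc _ ≤ Real.exp ℓ * (C * (1 + w ^ 2)⁻¹) := by gcongr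
      _ = C * (Real.exp ℓ * (1 + w ^ 2)⁻¹) := by ring
      _ ≤ _ := by gcongr

/-- If `m (·, t)` has zero mean for every `t`, its transform vanishes at frequency zero to first
order. -/
theorem IsTest.exists_pft_zeroMean_bound {m : ℝ × ℝ → ℂ} (hm : IsTest m)
    (h0 : ∀ t, pft m 0 t = 0) :
    ∃ C, 0 ≤ C ∧ ∀ w t ℓ, |w| = Real.exp ℓ → ‖pft m w t‖ ≤ C * Real.exp (-|ℓ|) := by
  obtain ⟨C, hC0, hC⟩ := IsTest.pft_decay 1 hm
  obtain ⟨D, hD0, hD⟩ := IsTest.pft_decay 0 hm.fst_mul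
  refine ⟨D + C, by positivity, fun w t ℓ hw => le_exp_neg_abs hD0 hC0 ?_ ?_⟩
  · have hd : ∀ w : ℝ, HasDerivAt (fun w => pft m w t)
        (pft (fun z => (-(2 * Real.pi * Complex.I * z.1)) * m z) w t) w := fun w => by
      simpa using hm.hasDerivAt_pft_comp (hasDerivAt_id w) (hasDerivAt_const w t)
    have h := Convex.norm_image_sub_le_of_norm_hasDerivWithin_le (s := Set.univ) (C := D)
      (fun w _ => (hd w).hasDerivWithinAt) (fun w _ => by simpa using hD w t) convex_univ
      (Set.mem_univ 0) (Set.mem_univ w)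
    rw [h0, sub_zero, sub_zero, Real.norm_eq_abs, hw] at h
    exact h
  · have h := hC w t
    rw [pow_one, div_eq_mul_inv] at h
    exact h.trans (mul_le_mul_of_nonneg_left (inv_one_add_sq_le hw) hC0)

theorem IsTest.pft_pd2_zero {m : ℝ × ℝ → ℂ} (hm : IsTest m) (h0 : ∀ t, pft m 0 t = 0) (t : ℝ) :
    pft (_root_.pd2 m) 0 t = 0 := by
  have h1 := hm.hasDerivAt_pft_comp (hasDerivAt_const t (0 : ℝ)) (hasDerivAt_id t)
  simp only [id, h0] at h1
  simpa using h1.unique (hasDerivAt_const t (0 : ℂ))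

theorem IsTest.pft_eq_zero {m : ℝ × ℝ → ℂ} {t : ℝ} (h : ∀ x, m (x, t) = 0) (w : ℝ) :
    pft m w t = 0 := by
  rw [pft_eq]
  simp [h]

/-- Exponential decay in `p` on a strip `|q - p| ≤ R` is dominated by the weight. -/
theorem exp_neg_abs_le_wt {R p q : ℝ} (h : |q - p| ≤ R) :
    Real.exp (-|p|) ≤ 50 * (2 + 2 * R ^ 2) * (wt p * wt q) := by
  -- `(1 + p²)² ≤ 2 + 2 p⁴`, and `p⁴ / 4! ≤ e^|p|`
  have h1 : (1 + p ^ 2) ^ 2 ≤ 50 * Real.exp |p| := by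
    have h2 := Real.pow_div_factorial_le_exp |p| (abs_nonneg p) 4
    have h3 := Real.one_le_exp (abs_nonneg p)
    have h4 : |p| ^ 4 = (p ^ 2) ^ 2 := by rw [← sq_abs p]; ring
    rw [h4] at h2
    norm_num [Nat.factorial] at h2
    nlinarith [sq_nonneg (p ^ 2 - 1)]
  have h2 : 1 + q ^ 2 ≤ (2 + 2 * R ^ 2) * (1 + p ^ 2) := by
    have h3 : |q| ≤ |p| + R := by
      have := abs_add_le p (q - p)
      rw [add_sub_cancel] at this
      linarith
    have h4 : q ^ 2 ≤ (|p| + R) ^ 2 := by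
      rw [← sq_abs q]
      exact pow_le_pow_left₀ (abs_nonneg q) h3 2
    have h5 : (|p| + R) ^ 2 ≤ 2 * p ^ 2 + 2 * R ^ 2 := by
      rw [← sq_abs p]; nlinarith [sq_nonneg (|p| - R)]
    have h6 : (2 + 2 * R ^ 2) * (1 + p ^ 2)
        = 2 + 2 * R ^ 2 + 2 * p ^ 2 + 2 * (R ^ 2 * p ^ 2) := by ring
    have h7 : 0 ≤ R ^ 2 * p ^ 2 := by positivity
    rw [h6]; linarith
  rw [Real.exp_neg, wt, wt, ← mul_inv, ← div_eq_mul_inv, inv_eq_one_div,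
    div_le_div_iff₀ (Real.exp_pos _) (by positivity), one_mul]
  calc (1 + p ^ 2) * (1 + q ^ 2) ≤ (1 + p ^ 2) * ((2 + 2 * R ^ 2) * (1 + p ^ 2)) := by gcongr
    _ = (2 + 2 * R ^ 2) * (1 + p ^ 2) ^ 2 := by ring
    _ ≤ (2 + 2 * R ^ 2) * (50 * Real.exp |p|) := by gcongr
    _ = _ := by ring

/-- The integral kernel, in logarithmic coordinates, of the integrated representation. -/
noncomputable def repKer (s : ℤˣ) (m : ℝ × ℝ → ℂ) (p q : ℝ) : ℂ := pft m (-sexp s p) (q - p)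

theorem continuous_repKer (s : ℤˣ) {m : ℝ × ℝ → ℂ} (hm : IsTest m) :
    Continuous fun z : ℝ × ℝ => repKer s m z.1 z.2 := by
  have h2 := continuous_sexp s
  have h3 : Continuous fun z : ℝ × ℝ => (-sexp s z.1, z.2 - z.1) := by fun_prop
  have h4 := hm.continuous_pft.comp h3
  simpa only [repKer, Function.comp_def] using h4

theorem isTraceKernel_repKer (s : ℤˣ) {m : ℝ × ℝ → ℂ} (hm : IsTest m)
    (h0 : ∀ t, pft m 0 t = 0) :
    IsTraceKernel (repKer s m) fun p q =>
      (-sexp s p : ℝ) * repKer s (fun z => (-(2 * Real.pi * Complex.I * z.1)) * m z) p q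
        - repKer s (pd2 m) p q := by
  obtain ⟨R, hR0, hR⟩ := hm.exists_bound
  have hw : ∀ p, |-sexp s p| = Real.exp p := fun p => by rw [abs_neg, abs_sexp]
  refine ⟨fun p q => ?_, (continuous_repKer s hm).measurable, ?_, ?_⟩
  · refine (hm.hasDerivAt_pft_comp (hasDerivAt_sexp s p).neg
      ((hasDerivAt_id p).const_sub q)).congr_deriv ?_
    simp only [repKer]
    push_cast
    ring_nf
    rfl
  · have h1 := continuous_repKer s hm.fst_mul
    have h2 := continuous_repKer s hm.pd2
    have h3 := continuous_sexp s
    exact Continuous.measurable (by fun_prop)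
  · obtain ⟨C0, h00, hC0⟩ := hm.exists_pft_zeroMean_bound h0
    obtain ⟨C1, h10, hC1⟩ := hm.fst_mul.exists_pft_mul_bound
    obtain ⟨C2, h20, hC2⟩ := hm.pd2.exists_pft_zeroMean_bound (hm.pft_pd2_zero h0)
    refine ⟨(C0 + C1 + C2) * (50 * (2 + 2 * R ^ 2)), by positivity, fun p q => ?_⟩
    have hp := wt_pos p
    have hq := wt_pos q
    by_cases h : |q - p| ≤ R
    · have he := exp_neg_abs_le_wt h
      have he0 := Real.exp_pos (-|p|)
      have key : ∀ x, x ≤ (C0 + C1 + C2) * Real.exp (-|p|) →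
          x ≤ (C0 + C1 + C2) * (50 * (2 + 2 * R ^ 2)) * (wt p * wt q) := fun x hx =>
        hx.trans (by rw [mul_assoc]; exact mul_le_mul_of_nonneg_left he (by positivity))
      constructor
      · refine key _ ((hC0 _ _ _ (hw p)).trans ?_)
        nlinarith
      · refine key _ ((norm_sub_le _ _).trans ((add_le_add (hC1 _ _ _ (hw p))
          (hC2 _ _ _ (hw p))).trans ?_))
        nlinarith
    · have hz : ∀ x, m (x, q - p) = 0 := fun x => by
        by_contra h'
        exact h (hR _ _ h').2
      have hz2 : ∀ x, pd2 m (x, q - p) = 0 := fun x => by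
        by_contra h'
        have hcl : tsupport m ⊆ {z : ℝ × ℝ | |z.2| ≤ R} :=
          closure_minimal (fun z hz => (hR z.1 z.2 hz).2)
            (isClosed_le (by fun_prop) continuous_const)
        exact h (hcl (pd2_support h'))
      have e1 : repKer s m p q = 0 := IsTest.pft_eq_zero hz _
      have e2 : repKer s (fun z => (-(2 * Real.pi * Complex.I * z.1)) * m z) p q = 0 :=
        IsTest.pft_eq_zero (fun x => by simp only [hz, mul_zero]) _
      have e3 : repKer s (pd2 m) p q = 0 := IsTest.pft_eq_zero hz2 _
      rw [e1, e2, e3, mul_zero, sub_zero, norm_zero]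
      exact ⟨by positivity, by positivity⟩

/-! ### The character formula -/

/-- A function on the group in the logarithmic chart, translation parameter first. -/
noncomputable def chartFun (f : Aff → ℂ) (z : ℝ × ℝ) : ℂ := f (Aff.param (z.2, z.1))

/-- A function on the group in exponential coordinates, with the density of the right Haar measure
relative to these coordinates as a factor; the coordinate along `X₂` comes first. -/
noncomputable def expChartFun (f : Aff → ℂ) (z : ℝ × ℝ) : ℂ :=
  ((lam (-z.2))⁻¹ : ℝ) * chartFun f (z.1 / lam (-z.2), z.2)

theorem isTest_swap {g : ℝ × ℝ → ℂ} (hg : IsTest g) : IsTest fun z => g (z.2, z.1) :=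
  ⟨hg.1.comp (contDiff_snd.prodMk contDiff_fst),
    hg.2.comp_homeomorph (Homeomorph.prodComm ℝ ℝ)⟩

theorem isTest_chartFun {f : Aff → ℂ} (hf : Aff.IsTestFunction f) : IsTest (chartFun f) :=
  isTest_swap (g := fun p => f (Aff.param p)) hf

theorem isTest_expChartFun {f : Aff → ℂ} (hf : Aff.IsTestFunction f) : IsTest (expChartFun f) := by
  have hm := isTest_chartFun hf
  have hl : ContDiff ℝ ∞ fun z : ℝ × ℝ => lam (-z.2) := contDiff_lam.comp contDiff_snd.neg
  have hl0 : ∀ z : ℝ × ℝ, lam (-z.2) ≠ 0 := fun z => (lam_pos _).ne'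
  refine ⟨(Complex.ofRealCLM.contDiff.comp (hl.inv hl0)).mul
    (hm.1.comp ((contDiff_fst.div hl hl0).prodMk contDiff_snd)), ?_⟩
  obtain ⟨R, hR0, hR⟩ := hm.exists_bound
  refine HasCompactSupport.intro ((isCompact_Icc (a := -(R * Real.exp R))
    (b := R * Real.exp R)).prod (isCompact_Icc (a := -R) (b := R))) fun z hz => ?_
  by_contra h
  obtain ⟨h1, h2⟩ := hR _ _ (right_ne_zero_of_mul h)
  refine hz ⟨abs_le.1 ?_, abs_le.1 h2⟩
  have h3 : lam (-z.2) ≤ Real.exp R := by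
    rw [← exp_loglam, Real.exp_le_exp]
    refine (le_abs_self _).trans ((abs_loglam_le _).trans ?_)
    rwa [abs_neg]
  rw [abs_div, abs_of_pos (lam_pos _), div_le_iff₀ (lam_pos _)] at h1
  exact h1.trans (by gcongr)

theorem pft_expChartFun (f : Aff → ℂ) (w t : ℝ) :
    pft (expChartFun f) w t = pft (chartFun f) (w * lam (-t)) t := by
  have hl := lam_pos (-t)
  have h := Measure.integral_comp_div (fun b : ℝ =>
    Complex.exp (-(2 * Real.pi * Complex.I * b) * (w * lam (-t) : ℝ)) * chartFun f (b, t))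
    (lam (-t))
  rw [pft_eq, pft_eq]
  have hne : ((lam (-t) : ℝ) : ℂ) ≠ 0 := by exact_mod_cast hl.ne'
  rw [abs_of_pos hl, Complex.real_smul] at h
  rw [← mul_right_inj' hne, ← h, ← integral_const_mul]
  refine integral_congr_ae (Filter.Eventually.of_forall fun c => ?_)
  simp only [expChartFun]
  have e : -(2 * Real.pi * Complex.I * ((c / lam (-t) : ℝ) : ℂ)) * ((w * lam (-t) : ℝ) : ℂ)
      = -(2 * Real.pi * Complex.I * c) * w := by
    push_cast
    field_simp
  rw [e]
  push_cast
  field_simp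

theorem integrable_rightHaar_of_isTest {f : Aff → ℂ} (hf : Aff.IsTestFunction f) :
    Integrable f Aff.rightHaar :=
  (Aff.measurePreserving_param.integrable_comp_emb Aff.measurableEmbedding_param).1
    (hf.1.continuous.integrable_of_hasCompactSupport hf.2)

theorem integral_rightHaar (F : Aff → ℂ) :
    ∫ g, F g ∂Aff.rightHaar = ∫ p, F (Aff.param p) :=
  (Aff.measurePreserving_param.integral_comp Aff.measurableEmbedding_param F).symm

theorem phase_eq_exp (b r : ℝ) :
    phase b r = Complex.exp (-(2 * Real.pi * Complex.I * b) * ((-r : ℝ) : ℂ)) := by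
  rw [phase]
  congr 1
  push_cast
  ring

theorem integrable_mul_kerE_param {f : Aff → ℂ} (hf : Aff.IsTestFunction f) (z : ℝ × ℝ) :
    Integrable fun p => kerE z (Aff.param p) * f (Aff.param p) := by
  refine (hf.1.continuous.integrable_of_hasCompactSupport hf.2).bdd_mul (c := 1)
    (measurable_kerE.comp (measurable_const.prodMk Aff.measurable_param)).aestronglyMeasurable ?_
  exact Filter.Eventually.of_forall fun p => (norm_kerE _ _).le

/-- The transform of a test function on the orbit, as an iterated Fourier integral in exponential
coordinates. -/
theorem fourierMoyal_orbitParam {f : Aff → ℂ} (hf : Aff.IsTestFunction f) (s : ℤˣ) (x η : ℝ) :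
    fourierMoyal kerE Aff.rightHaar f (orbitParam s (x, η))
      = ∫ t : ℝ, Complex.exp (-(2 * Real.pi * Complex.I * x) * ((-t : ℝ) : ℂ)) *
          pft (expChartFun f) (-sexp s η) t := by
  have hc := (integrable_mul_kerE_param hf (orbitParam s (x, η))).swap
  rw [fourierMoyal, integral_rightHaar, Measure.volume_eq_prod, integral_prod]
  swap
  · exact hc.swap
  refine integral_congr_ae (Filter.Eventually.of_forall fun t => ?_)
  simp only
  rw [pft_expChartFun, pft_eq, ← integral_const_mul]
  refine integral_congr_ae (Filter.Eventually.of_forall fun b => ?_)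
  simp only [kerE_orbitParam, Aff.param, Real.log_exp, chartFun]
  have e : phase (b * lam (-t)) (sexp s η)
      = Complex.exp (-(2 * Real.pi * Complex.I * b) * ((-sexp s η * lam (-t) : ℝ) : ℂ)) := by
    rw [neg_mul (sexp s η), ← phase_eq_exp, phase_mul]
  rw [e]
  ring

/-- The transform of a test function on the orbit, with the integrations in the opposite order. -/
theorem fourierMoyal_orbitParam' {f : Aff → ℂ} (hf : Aff.IsTestFunction f) (s : ℤˣ) (x η : ℝ) :
    fourierMoyal kerE Aff.rightHaar f (orbitParam s (x, η))
      = ∫ c : ℝ, phase c (sexp s η) * pft (fun z => expChartFun f (z.2, z.1)) (-x) c := by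
  rw [fourierMoyal_orbitParam hf]
  simp only [pft_eq, ← integral_const_mul]
  rw [integral_integral_swap]
  swap
  · have hn := isTest_expChartFun hf
    obtain ⟨R, hR0, hR⟩ := hn.exists_bound
    refine integrable_of_square (M := R) ?_ fun z hz => ?_
    · have := hn.1.continuous
      simp only [Function.uncurry_def]
      fun_prop
    · exact (hR _ _ (right_ne_zero_of_mul (right_ne_zero_of_mul hz))).symm
  refine integral_congr_ae (Filter.Eventually.of_forall fun c => ?_)
  refine integral_congr_ae (Filter.Eventually.of_forall fun t => ?_)
  simp only
  rw [phase_eq_exp]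
  push_cast
  ring_nf

theorem pft_chartFun_zero {f : Aff → ℂ}
    (h0 : ∀ (a : ℝ) (ha : 0 < a), ∫ b : ℝ, f ⟨a, b, ha⟩ = 0) (t : ℝ) :
    pft (chartFun f) 0 t = 0 := by
  rw [pft_eq, ← h0 (Real.exp t) (Real.exp_pos t)]
  refine integral_congr_ae (Filter.Eventually.of_forall fun b => ?_)
  simp [chartFun, Aff.param]

/-- For a test function of zero mean, the transform is `ω`-integrable on the orbit: it decays
exponentially in `log |y|` by the zero mean and rapidly in `x` by smoothness, and the geometric mean
of the two bounds is integrable. -/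
theorem integrable_fourierMoyal_orbitParam {f : Aff → ℂ} (hf : Aff.IsTestFunction f)
    (h0 : ∀ (a : ℝ) (ha : 0 < a), ∫ b : ℝ, f ⟨a, b, ha⟩ = 0) (s : ℤˣ) :
    Integrable fun p => fourierMoyal kerE Aff.rightHaar f (orbitParam s p) := by
  have hn := isTest_expChartFun hf
  obtain ⟨R, hR0, hR⟩ := hn.exists_bound
  obtain ⟨C, hC0, hC⟩ := hn.exists_pft_zeroMean_bound fun t => by
    rw [pft_expChartFun, zero_mul, pft_chartFun_zero h0]
  obtain ⟨D, S, hD0, hD⟩ := (isTest_swap hn).exists_pft_bound 2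
  have hA : ∀ x η, ‖fourierMoyal kerE Aff.rightHaar f (orbitParam s (x, η))‖
      ≤ (C * (2 * R)) * (100 * wt η ^ 2) := by
    intro x η
    rw [fourierMoyal_orbitParam hf]
    refine (norm_integral_le_integral_norm _).trans ?_
    have hb : ∀ t : ℝ, ‖Complex.exp (-(2 * Real.pi * Complex.I * x) * ((-t : ℝ) : ℂ)) *
        pft (expChartFun f) (-sexp s η) t‖
        ≤ (Set.Icc (-R) R).indicator (fun _ => C * Real.exp (-|η|)) t := by
      intro t
      rw [norm_mul, ← phase_eq_exp, norm_phase, one_mul]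
      by_cases ht : t ∈ Set.Icc (-R) R
      · rw [Set.indicator_of_mem ht]
        exact hC _ _ _ (by rw [abs_neg, abs_sexp])
      · rw [Set.indicator_of_notMem ht, IsTest.pft_eq_zero (fun x => ?_), norm_zero]
        by_contra h
        exact ht (abs_le.1 (hR _ _ h).2)
    refine (integral_mono_of_nonneg (Filter.Eventually.of_forall fun t => norm_nonneg _)
      ((integrable_indicator_iff measurableSet_Icc).2 (integrableOn_const (by simp)))
      (Filter.Eventually.of_forall hb)).trans ?_
    rw [integral_indicator measurableSet_Icc, setIntegral_const, smul_eq_mul,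
      Real.volume_real_Icc_of_le (by linarith)]
    have he := exp_neg_abs_le_wt (R := 0) (p := η) (q := η) (by simp)
    calc (R - -R) * (C * Real.exp (-|η|)) = (C * (2 * R)) * Real.exp (-|η|) := by ring
      _ ≤ (C * (2 * R)) * (100 * wt η ^ 2) := by
          refine mul_le_mul_of_nonneg_left (he.trans (le_of_eq ?_)) (by positivity)
          ring
  have hB : ∀ x η, ‖fourierMoyal kerE Aff.rightHaar f (orbitParam s (x, η))‖
      ≤ (D * (2 * |S|)) * wt x ^ 2 := by
    intro x η
    rw [fourierMoyal_orbitParam' hf]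
    refine (norm_integral_le_integral_norm _).trans ?_
    have hb : ∀ c : ℝ, ‖phase c (sexp s η) *
        pft (fun z => expChartFun f (z.2, z.1)) (-x) c‖
        ≤ (Set.Icc (-S) S).indicator (fun _ => D) c * wt x ^ 2 := by
      intro c
      rw [norm_mul, norm_phase, one_mul]
      refine (hD _ _).trans (le_of_eq ?_)
      rw [neg_sq, wt]
    refine (integral_mono_of_nonneg (Filter.Eventually.of_forall fun t => norm_nonneg _)
      (((integrable_indicator_iff measurableSet_Icc).2 (integrableOn_const (by simp))).mul_const _)
      (Filter.Eventually.of_forall hb)).trans ?_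
    rw [integral_mul_const, integral_indicator measurableSet_Icc, setIntegral_const, smul_eq_mul,
      Real.volume_real_Icc]
    have : max (S - -S) 0 ≤ 2 * |S| :=
      max_le (by linarith [le_abs_self S]) (by positivity)
    refine mul_le_mul_of_nonneg_right ?_ (by positivity)
    rw [mul_comm]
    exact mul_le_mul_of_nonneg_left this hD0
  set K : ℝ := (C * (2 * R)) * 100 with hK
  set L : ℝ := D * (2 * |S|) with hL
  have hK0 : 0 ≤ K := by positivity
  have hL0 : 0 ≤ L := by positivity
  refine ((integrable_wt.mul_prod integrable_wt).const_mul (K + L)).mono'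
    ((continuous_fourierMoyal (integrable_rightHaar_of_isTest hf)).comp
      (continuous_orbitParam s)).aestronglyMeasurable (Filter.Eventually.of_forall fun p => ?_)
  have h1 := hA p.1 p.2
  have h2 := hB p.1 p.2
  have h3 := wt_pos p.1
  have h4 := wt_pos p.2
  refine abs_le_of_sq_le_sq' ?_ (by positivity) |>.2
  calc ‖fourierMoyal kerE Aff.rightHaar f (orbitParam s p)‖ ^ 2
      ≤ (C * (2 * R) * (100 * wt p.2 ^ 2)) * (L * wt p.1 ^ 2) := by
        rw [sq]; exact mul_le_mul h1 h2 (norm_nonneg _) (by positivity)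
    _ = K * L * (wt p.1 * wt p.2) ^ 2 := by rw [hK]; ring
    _ ≤ (K + L) ^ 2 * (wt p.1 * wt p.2) ^ 2 := by
        refine mul_le_mul_of_nonneg_right ?_ (by positivity)
        nlinarith
    _ = _ := by ring

/-- Fourier inversion at `t = 0`: the integral of the transform over a line `y = const` of the orbit
only sees the restriction of the function to the normal subgroup `a = 1`. -/
theorem integral_fourierMoyal_orbitParam {f : Aff → ℂ} (hf : Aff.IsTestFunction f) (s : ℤˣ)
    (η : ℝ) : ∫ x, fourierMoyal kerE Aff.rightHaar f (orbitParam s (x, η))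
      = pft (chartFun f) (-sexp s η) 0 := by
  have hn := isTest_swap (isTest_expChartFun hf)
  simp only [fourierMoyal_orbitParam' hf]
  rw [integral_integral_swap]
  swap
  · refine (hn.integrable_pft_neg.swap.bdd_mul (c := 1)
      (f := fun X : ℝ × ℝ => phase X.2 (sexp s η)) ?_ ?_)
    · exact (measurable_phase.comp (measurable_snd.prodMk measurable_const)).aestronglyMeasurable
    · exact Filter.Eventually.of_forall fun X => (norm_phase _ _).le
  have h1 : pft (chartFun f) (-sexp s η) 0 = pft (expChartFun f) (-sexp s η) 0 := by
    rw [pft_expChartFun, neg_zero, lam_zero, mul_one]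
  rw [h1, pft_eq]
  refine integral_congr_ae (Filter.Eventually.of_forall fun c => ?_)
  simp only
  rw [integral_const_mul, phase_eq_exp,
    integral_neg_eq_self (fun x => pft (fun z => expChartFun f (z.2, z.1)) x c)]
  have h2 := hn.pft_inversion 0 c
  simp only [Complex.ofReal_zero, mul_zero, zero_mul, Complex.exp_zero, one_mul] at h2
  rw [h2]

/-- In logarithmic coordinates, the integrated representation has the integral kernel `repKer`. -/
theorem inner_integratedRep {f : Aff → ℂ} (hf : Aff.IsTestFunction f) {s : ℤˣ}
    {φ ψ : HilbK s} {φ' ψ' : ℝ → ℂ} (hφ : φ =ᵐ[halfMeas s] φ') (hψ : ψ =ᵐ[halfMeas s] ψ')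
    (hφ' : IsHalfTest s φ') (hψ' : IsHalfTest s ψ') :
    ∫ g, f g * inner ℂ φ (rep s g ψ) ∂Aff.rightHaar = ∫ z : ℝ × ℝ,
      (starRingEnd ℂ) (φ' (sexp s z.1)) * repKer s (chartFun f) z.1 z.2 * ψ' (sexp s z.2) := by
  have hm := isTest_chartFun hf
  have hmc := hm.1.continuous
  obtain ⟨R, hR0, hR⟩ := hm.exists_bound
  obtain ⟨N, hN0, hN⟩ := hφ'.exists_log_bound
  obtain ⟨L, hL0, hL⟩ := hψ'.exists_log_bound
  have hφc := hφ'.comp_sexp.1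
  have hψc := hψ'.comp_sexp.1
  have hi := integrable_mul_inner_rep (integrable_rightHaar_of_isTest hf) φ ψ
  rw [← Aff.measurePreserving_param.integrable_comp_emb Aff.measurableEmbedding_param] at hi
  rw [integral_rightHaar, Measure.volume_eq_prod,
    integral_prod (fun p => f (Aff.param p) * inner ℂ φ (rep s (Aff.param p) ψ)) hi]
  have h1 : ∀ t : ℝ, ∫ b : ℝ, f (Aff.param (t, b)) * inner ℂ φ (rep s (Aff.param (t, b)) ψ)
      = ∫ p, (starRingEnd ℂ) (φ' (sexp s p)) * pft (chartFun f) (-sexp s p) t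
          * ψ' (sexp s (p + t)) := by
    intro t
    have h2 : ∀ b : ℝ, f (Aff.param (t, b)) * inner ℂ φ (rep s (Aff.param (t, b)) ψ)
        = ∫ p, chartFun f (b, t) * ((starRingEnd ℂ) (φ' (sexp s p)) *
          (phase b (sexp s p) * ψ' (sexp s (p + t)))) := by
      intro b
      rw [inner_rep_test hφ hψ, ← integral_const_mul]
      simp only [Aff.param, Real.log_exp, chartFun]
    simp only [h2]
    rw [integral_integral_swap]
    swap
    · have hs := continuous_sexp s
      refine integrable_of_square (M := R + N) ?_ fun z hz => ?_
      · have hp : Continuous fun z : ℝ × ℝ => phase z.1 (sexp s z.2) := by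
          unfold phase; fun_prop
        exact (hmc.comp (by fun_prop : Continuous fun z : ℝ × ℝ => (z.1, t))).mul
          ((Complex.continuous_conj.comp (hφc.comp continuous_snd)).mul
            (hp.mul (hψc.comp (by fun_prop : Continuous fun z : ℝ × ℝ => z.2 + t))))
      · have e1 := (hR _ _ (left_ne_zero_of_mul hz)).1
        have e2 := hN z.2 fun e => left_ne_zero_of_mul (right_ne_zero_of_mul hz) (by rw [e, map_zero])
        exact ⟨by linarith, by linarith⟩
    refine integral_congr_ae (Filter.Eventually.of_forall fun p => ?_)
    simp only
    rw [pft_eq, ← integral_const_mul, ← integral_mul_const]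
    refine integral_congr_ae (Filter.Eventually.of_forall fun b => ?_)
    simp only [phase_eq_exp]
    ring
  simp only [h1]
  have hk := continuous_repKer s hm
  rw [integral_integral_swap]
  swap
  · refine integrable_of_square (M := N + L) ?_ fun z hz => ?_
    · have hs := continuous_sexp s
      exact ((Complex.continuous_conj.comp (hφc.comp continuous_snd)).mul
        (hm.continuous_pft.comp (by fun_prop : Continuous fun z : ℝ × ℝ => (-sexp s z.2, z.1)))).mul
          (hψc.comp (by fun_prop : Continuous fun z : ℝ × ℝ => z.2 + z.1))
    · have h3 := abs_le.1 (hN z.2 fun h0 =>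
        left_ne_zero_of_mul (left_ne_zero_of_mul hz) (by simp only [h0, map_zero]))
      have h4 := abs_le.1 (hL _ (right_ne_zero_of_mul hz))
      exact ⟨abs_le.2 ⟨by linarith, by linarith⟩, abs_le.2 ⟨by linarith, by linarith⟩⟩
  rw [integral_prod]
  swap
  · refine integrable_of_square (M := N + L) ?_ fun z hz => ?_
    · exact ((Complex.continuous_conj.comp (hφc.comp continuous_fst)).mul hk).mul
        (hψc.comp continuous_snd)
    · have h3 := hN z.1 fun h0 =>
        left_ne_zero_of_mul (left_ne_zero_of_mul hz) (by simp only [h0, map_zero])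
      have h4 := hL z.2 (right_ne_zero_of_mul hz)
      exact ⟨by linarith, by linarith⟩
  refine integral_congr_ae (Filter.Eventually.of_forall fun p => ?_)
  simp only
  rw [← integral_sub_right_eq_self _ p]
  refine integral_congr_ae (Filter.Eventually.of_forall fun q => ?_)
  simp only
  rw [repKer, add_sub_cancel]

/-- The character formula for the explicit kernel, with right Haar measure on the group. -/
theorem exists_trace_integratedRep (s : ℤˣ) {f : Aff → ℂ} (hf : Aff.IsTestFunction f)
    (h0 : ∀ (a : ℝ) (ha : 0 < a), ∫ b : ℝ, f ⟨a, b, ha⟩ = 0) :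
    ∃ A : HilbK s →L[ℂ] HilbK s, IsIntegratedRep s Aff.rightHaar f A ∧
      IntegrableOn (fourierMoyal kerE Aff.rightHaar f) (orbit s) leftMeas ∧
      HasTrace A (∫ z in orbit s, fourierMoyal kerE Aff.rightHaar f z ∂leftMeas) := by
  have hm := isTest_chartFun hf
  have hI := integrable_fourierMoyal_orbitParam hf h0 s
  obtain ⟨A, hA⟩ := exists_integratedRep s (integrable_rightHaar_of_isTest hf)
  obtain ⟨T, hT1, hT2, -⟩ :=
    (isTraceKernel_repKer s hm (pft_chartFun_zero h0)).exists_operator s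
  refine ⟨A, hA, (integrableOn_leftMeas s _).2 hI, ?_⟩
  -- `U(f)` is the operator with kernel `repKer`, so that its trace is the integral over the diagonal
  have hTA : T = A := by
    refine ext_of_inner_test fun φ ψ hφ hψ => ?_
    obtain ⟨φ', hφ', hφe⟩ := hφ.exists_rep
    obtain ⟨ψ', hψ', hψe⟩ := hψ.exists_rep
    have e1 := ae_sexp hφe
    have e2 := ae_sexp hψe
    rw [hT1 φ ψ ((integrable_congr e1).2 hφ'.integrable_comp_sexp)
      ((integrable_congr e2).2 hψ'.integrable_comp_sexp), ← (hA φ ψ).2,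
      inner_integratedRep hf hφe hψe hφ' hψ']
    refine integral_congr_ae ?_
    have e3 := Measure.quasiMeasurePreserving_fst (μ := (volume : Measure ℝ))
      (ν := (volume : Measure ℝ)) |>.ae e1
    have e4 := Measure.quasiMeasurePreserving_snd (μ := (volume : Measure ℝ))
      (ν := (volume : Measure ℝ)) |>.ae e2
    rw [Measure.volume_eq_prod]
    filter_upwards [e3, e4] with z h3 h4
    rw [h3, h4]
  have h1 := hT2 1
  rw [rep_one, ContinuousLinearMap.comp_id, hTA] at h1
  have h2 : ∫ p, phase (1 : Aff).b (sexp s p) *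
      repKer s (chartFun f) (p + Real.log (1 : Aff).a) p
      = ∫ z in orbit s, fourierMoyal kerE Aff.rightHaar f z ∂leftMeas := by
    rw [integral_leftMeas, Measure.volume_eq_prod, integral_prod_symm _ hI]
    refine integral_congr_ae (Filter.Eventually.of_forall fun η => ?_)
    simp only [integral_fourierMoyal_orbitParam hf]
    simp [repKer, phase]
  rwa [h2] at h1

/-! ### Uniqueness of continuous symbols and transfer between the two pictures -/

section congr

variable {Ω : FormFamily} {m : Measure (ℝ × ℝ)} {s : ℤˣ} {A : HilbK s →L[ℂ] HilbK s}
  {F F' G G' P P' : ℝ × ℝ → ℂ}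

theorem IsQuantization.congr (hF : IsQuantization Ω m s F A) (h : Set.EqOn F F' (orbit s)) :
    IsQuantization Ω m s F' A := fun φ ψ hφ hψ => by
  have hs := (isOpen_orbit s).measurableSet
  have e : Set.EqOn (fun z => F z * Ω s z φ ψ) (fun z => F' z * Ω s z φ ψ) (orbit s) :=
    fun z hz => by simp only [h hz]
  exact ⟨(hF φ ψ hφ hψ).1.congr_fun e hs, (setIntegral_congr_fun hs e) ▸ (hF φ ψ hφ hψ).2⟩

theorem IsSymbol.congr (hF : IsSymbol Ω m s A F) (h : Set.EqOn F F' (orbit s)) :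
    IsSymbol Ω m s A F' := by
  have hs := (isOpen_orbit s).measurableSet
  refine ⟨hF.1.congr ((ae_restrict_iff' hs).2 (Filter.Eventually.of_forall h)),
    fun f h1 h2 h3 => ?_⟩
  obtain ⟨Q, hQ, hT⟩ := hF.2 f h1 h2 h3
  refine ⟨Q, hQ, ?_⟩
  rwa [← setIntegral_congr_fun hs (f := fun z => f z * F z) fun z hz => by simp only [h hz]]

theorem IsMoyalProduct.congr (hF : IsMoyalProduct Ω m s F G P) (h1 : Set.EqOn F F' (orbit s))
    (h2 : Set.EqOn G G' (orbit s)) (h3 : Set.EqOn P P' (orbit s)) :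
    IsMoyalProduct Ω m s F' G' P' :=
  let ⟨A, B, hA, hB, hP⟩ := hF
  ⟨A, B, hA.congr h1, hB.congr h2, hP.congr h3⟩

/-- The quantization of a function is unique. -/
theorem IsQuantization.unique {A' : HilbK s →L[ℂ] HilbK s} (hA : IsQuantization Ω m s F A)
    (hA' : IsQuantization Ω m s F A') : A = A' :=
  ext_of_inner_test fun φ ψ hφ hψ => (hA φ ψ hφ hψ).2.symm.trans (hA' φ ψ hφ hψ).2

theorem fourierMoyal_congr {E E' : ℝ × ℝ → Aff → ℂ} (h : ∀ z ∈ orbit s, ∀ g, E z g = E' z g)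
    (μ : Measure Aff) (f : Aff → ℂ) :
    Set.EqOn (fourierMoyal E μ f) (fourierMoyal E' μ f) (orbit s) := fun z hz => by
  simp only [fourierMoyal, h z hz]

theorem CharacterFormula.congr {μ : Measure Aff} {E E' : ℝ × ℝ → Aff → ℂ}
    (hE : CharacterFormula m μ E) (h : ∀ s, ∀ z ∈ orbit s, ∀ g, E z g = E' z g) :
    CharacterFormula m μ E' := fun s f hf h0 => by
  have hs := (isOpen_orbit s).measurableSet
  obtain ⟨A, hA, hi, hT⟩ := hE s f hf h0
  have e := fourierMoyal_congr (h s) μ f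
  exact ⟨A, hA, hi.congr_fun e hs, setIntegral_congr_fun hs e ▸ hT⟩

end congr

theorem orbit_snd_ne_zero {s : ℤˣ} {z : ℝ × ℝ} (hz : z ∈ orbit s) : z.2 ≠ 0 := by
  rintro h
  simp [orbit, h] at hz

theorem integrableOn_test_mul {s : ℤˣ} {f W : ℝ × ℝ → ℂ} (hf : IsTest f)
    (hs : tsupport f ⊆ orbit s) (hW : ContinuousOn W (orbit s)) :
    IntegrableOn (fun z => f z * W z) (orbit s) := by
  have h1 : IntegrableOn (fun z => f z * W z) (tsupport f) :=
    (hf.1.continuous.continuousOn.mul (hW.mono hs)).integrableOn_compact hf.2.isCompact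
  exact h1.of_forall_sdiff_eq_zero (isOpen_orbit s).measurableSet fun z hz => by
    rw [image_eq_zero_of_notMem_tsupport hz.2, zero_mul]

/-- Two continuous functions on the orbit which represent the same distribution agree. -/
theorem IsSymbol.eqOn {s : ℤˣ} {A : HilbK s →L[ℂ] HilbK s} {W W' : ℝ × ℝ → ℂ}
    (h : IsSymbol quantL leftMeas s A W) (h' : IsSymbol quantL leftMeas s A W')
    (hW : ContinuousOn W (orbit s)) (hW' : ContinuousOn W' (orbit s)) :
    Set.EqOn W W' (orbit s) := by
  have hms := (isOpen_orbit s).measurableSet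
  let D : ℝ × ℝ → ℂ := fun z => (((1 / |z.2| : ℝ)) : ℂ) * (W z - W' z)
  have hd : ContinuousOn (fun z : ℝ × ℝ => (((1 / |z.2| : ℝ)) : ℂ)) (orbit s) :=
    Complex.continuous_ofReal.comp_continuousOn (ContinuousOn.div continuousOn_const
      (by fun_prop) fun z hz => abs_ne_zero.2 (orbit_snd_ne_zero hz))
  have hD : ContinuousOn D (orbit s) := hd.mul (hW.sub hW')
  have hconv : ∀ F : ℝ × ℝ → ℂ, ∫ z in orbit s, F z ∂leftMeas
      = ∫ z in orbit s, (((1 / |z.2| : ℝ)) : ℂ) * F z := fun F => by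
    rw [leftMeas, setIntegral_withDensity_eq_setIntegral_toReal_smul (by fun_prop)
      (Filter.Eventually.of_forall fun z => ENNReal.ofReal_lt_top) _ hms]
    refine setIntegral_congr_fun hms fun z _ => ?_
    rw [ENNReal.toReal_ofReal (by positivity), Complex.real_smul]
  have hz : ∀ᵐ z : ℝ × ℝ, z ∈ orbit s → D z = 0 := by
    refine (isOpen_orbit s).ae_eq_zero_of_integral_contDiff_smul_eq_zero
      (hD.locallyIntegrableOn hms) fun g h1 h2 h3 => ?_
    let f : ℝ × ℝ → ℂ := fun z => (g z : ℂ)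
    have hf1 : ContDiff ℝ ∞ f := Complex.ofRealCLM.contDiff.comp h1
    have hf2 : HasCompactSupport f := h2.comp_left Complex.ofReal_zero
    have hf3 : tsupport f ⊆ orbit s := (closure_mono fun z hz => by
      intro h0
      exact hz (by simp only [f, h0, Complex.ofReal_zero])).trans h3
    obtain ⟨Q, hQ, hT⟩ := h.2 f hf1 hf2 hf3
    obtain ⟨Q', hQ', hT'⟩ := h'.2 f hf1 hf2 hf3
    rw [← hQ.unique hQ'] at hT'
    have he := hT.unique hT'
    rw [hconv, hconv, ← sub_eq_zero, ← integral_sub] at he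
    · rw [← setIntegral_eq_integral_of_forall_compl_eq_zero (s := orbit s), ← he]
      · refine setIntegral_congr_fun hms fun z _ => ?_
        simp only [D, f, Complex.real_smul]
        ring
      · intro z hz
        rw [image_eq_zero_of_notMem_tsupport (fun h => hz (h3 h)), zero_smul]
    · refine (integrableOn_test_mul ⟨hf1, hf2⟩ hf3 (hd.mul hW)).congr_fun (fun z _ => ?_) hms
      simp only [Pi.mul_apply]
      ring
    · refine (integrableOn_test_mul ⟨hf1, hf2⟩ hf3 (hd.mul hW')).congr_fun (fun z _ => ?_) hms
      simp only [Pi.mul_apply]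
      ring
  have h0 : Set.EqOn D (fun _ => 0) (orbit s) :=
    Measure.eqOn_open_of_ae_eq ((ae_restrict_iff' hms).2 hz) (isOpen_orbit s) hD
      continuousOn_const
  intro z hz
  have h1 := h0 hz
  have h2 : (((1 / |z.2| : ℝ)) : ℂ) ≠ 0 := by
    exact_mod_cast (one_div_pos.2 (abs_pos.2 (orbit_snd_ne_zero hz))).ne'
  exact sub_eq_zero.1 ((mul_eq_zero.1 h1).resolve_left h2)

/-! ### The right quantizer -/

theorem contDiffAt_orbInv {s : ℤˣ} {z : ℝ × ℝ} (hz : z ∈ orbit s) : ContDiffAt ℝ ∞ orbInv z := by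
  have h := orbit_snd_ne_zero hz
  exact (contDiffAt_fst.neg.div contDiffAt_snd h).prodMk (contDiffAt_const.div contDiffAt_snd h)

theorem continuousOn_orbInv (s : ℤˣ) : ContinuousOn orbInv (orbit s) := fun _ hz =>
  (contDiffAt_orbInv hz).continuousAt.continuousWithinAt

/-- The inversion of the orbit preserves test functions. -/
theorem isTest_comp_orbInv {s : ℤˣ} {f : ℝ × ℝ → ℂ} (hf : IsTest f) (hs : tsupport f ⊆ orbit s) :
    IsTest (fun z => f (orbInv z)) ∧ tsupport (fun z => f (orbInv z)) ⊆ orbit s := by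
  have hK : IsCompact (orbInv '' tsupport f) :=
    hf.2.isCompact.image_of_continuousOn ((continuousOn_orbInv s).mono hs)
  have hsub : Function.support (fun z => f (orbInv z)) ⊆ orbInv '' tsupport f := fun z hz => by
    have h1 : orbInv z ∈ orbit s := hs (subset_tsupport f hz)
    have h2 : z ∈ orbit s := by
      have h3 := orbInv_mem h1
      have h4 : orbInv (orbInv z) = z := by
        have h5 : z.2 ≠ 0 := fun h0 => orbit_snd_ne_zero h1 (by simp [orbInv, h0])
        ext <;> simp [orbInv, h5]
      rwa [h4] at h3
    exact ⟨orbInv z, subset_tsupport f hz, orbInv_orbInv h2⟩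
  have ht : tsupport (fun z => f (orbInv z)) ⊆ orbInv '' tsupport f :=
    closure_minimal hsub hK.isClosed
  have ho : tsupport (fun z => f (orbInv z)) ⊆ orbit s := ht.trans <| by
    rintro _ ⟨z, hz, rfl⟩
    exact orbInv_mem (hs hz)
  refine ⟨⟨contDiff_iff_contDiffAt.2 fun z => ?_,
    hK.of_isClosed_subset (isClosed_tsupport _) ht⟩, ho⟩
  by_cases hz : z ∈ tsupport fun z => f (orbInv z)
  · exact hf.1.contDiffAt.comp z (contDiffAt_orbInv (ho hz))
  · exact contDiffAt_const.congr_of_eventuallyEq (notMem_tsupport_iff_eventuallyEq.1 hz)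

/-- Quantization with the right quantizer is quantization with the left one after inversion of the
orbit. -/
theorem isQuantization_quantR_iff {s : ℤˣ} {F : ℝ × ℝ → ℂ} {A : HilbK s →L[ℂ] HilbK s} :
    IsQuantization quantR rightMeas s F A ↔
      IsQuantization quantL leftMeas s (fun z => F (orbInv z)) A := by
  have hs := (isOpen_orbit s).measurableSet
  refine forall₄_congr fun φ ψ _ _ => ?_
  have e : Set.EqOn (fun z => F (orbInv z) * quantR s (orbInv z) φ ψ)
      (fun z => F (orbInv z) * quantL s z φ ψ) (orbit s) := fun z hz => by
    simp only [quantR, orbInv_orbInv hz]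
  rw [integrableOn_rightMeas, integral_rightMeas, integrableOn_congr_fun e hs,
    setIntegral_congr_fun hs e]

theorem integral_rightMeas_mul_comp_orbInv (s : ℤˣ) (F G : ℝ × ℝ → ℂ) :
    ∫ z in orbit s, F z * G (orbInv z) ∂rightMeas
      = ∫ z in orbit s, F (orbInv z) * G z ∂leftMeas := by
  rw [integral_rightMeas]
  exact setIntegral_congr_fun (isOpen_orbit s).measurableSet fun z hz => by
    simp only [orbInv_orbInv hz]

theorem ContinuousOn.comp_orbInv {s : ℤˣ} {W : ℝ × ℝ → ℂ} (hW : ContinuousOn W (orbit s)) :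
    ContinuousOn (fun z => W (orbInv z)) (orbit s) :=
  hW.comp (continuousOn_orbInv s) fun _ hz => orbInv_mem hz

theorem IsSymbol.toRight {s : ℤˣ} {A : HilbK s →L[ℂ] HilbK s} {W : ℝ × ℝ → ℂ}
    (h : IsSymbol quantL leftMeas s A W) (hW : ContinuousOn W (orbit s)) :
    IsSymbol quantR rightMeas s A fun z => W (orbInv z) := by
  refine ⟨hW.comp_orbInv.locallyIntegrableOn (isOpen_orbit s).measurableSet,
    fun f h1 h2 h3 => ?_⟩
  obtain ⟨hf, hfs⟩ := isTest_comp_orbInv ⟨h1, h2⟩ h3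
  obtain ⟨Q, hQ, hT⟩ := h.2 _ hf.1 hf.2 hfs
  exact ⟨Q, isQuantization_quantR_iff.2 hQ, by rwa [integral_rightMeas_mul_comp_orbInv]⟩

theorem IsSymbol.toLeft {s : ℤˣ} {A : HilbK s →L[ℂ] HilbK s} {W : ℝ × ℝ → ℂ}
    (h : IsSymbol quantR rightMeas s A W) (hW : ContinuousOn W (orbit s)) :
    IsSymbol quantL leftMeas s A fun z => W (orbInv z) := by
  refine ⟨hW.comp_orbInv.locallyIntegrableOn (isOpen_orbit s).measurableSet,
    fun f h1 h2 h3 => ?_⟩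
  obtain ⟨hf, hfs⟩ := isTest_comp_orbInv ⟨h1, h2⟩ h3
  obtain ⟨Q, hQ, hT⟩ := h.2 _ hf.1 hf.2 hfs
  refine ⟨Q, (isQuantization_quantR_iff.1 hQ).congr fun z hz => by simp only [orbInv_orbInv hz], ?_⟩
  have e := setIntegral_congr_fun (μ := leftMeas) (isOpen_orbit s).measurableSet
    (f := fun z => f (orbInv (orbInv z)) * W (orbInv z)) (g := fun z => f z * W (orbInv z))
    fun z hz => by simp only [orbInv_orbInv hz]
  rwa [integral_rightMeas, e] at hT

/-! ### Identities for the explicit kernel -/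

theorem lam_mul_one_sub_exp (t : ℝ) : lam t * (1 - Real.exp (-t)) = t := by
  by_cases h : t = 0
  · simp [h]
  · have h2 : 1 - Real.exp (-t) ≠ 0 := fun h' =>
      h (neg_eq_zero.1 ((Real.exp_eq_one_iff (-t)).1 (by linarith)))
    rw [lam, if_neg h, div_mul_cancel₀ _ h2]

theorem kerE_expAff (z X : ℝ × ℝ) :
    kerE z (expAff X) = Complex.exp (2 * Real.pi * Complex.I * (pairing z X : ℂ)) := by
  have h1 := (lam_pos (-X.1)).ne'
  have h2 := Real.exp_ne_zero X.1
  rw [kerE]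
  congr 3
  simp only [expAff, Real.log_exp, pairing]
  rw [lam_eq_exp_mul X.1]
  field_simp

theorem conj_kerE (z : ℝ × ℝ) (g : Aff) : (starRingEnd ℂ) (kerE z g) = kerE z g⁻¹ := by
  have ha := g.a_pos.ne'
  rw [kerE, kerE, ← Complex.exp_conj]
  congr 1
  have e : z.1 * Real.log g⁻¹.a + z.2 * g⁻¹.b * lam (Real.log g⁻¹.a) / g⁻¹.a
      = -(z.1 * Real.log g.a + z.2 * g.b * lam (Real.log g.a) / g.a) := by
    rw [Aff.inv_a, Aff.inv_b, Real.log_inv, ← lam_log_mul g.a_pos]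
    field_simp
    ring
  rw [e]
  simp only [map_mul, Complex.conj_ofReal, Complex.conj_I, map_ofNat]
  push_cast
  ring

theorem kerE_coadj (z : ℝ × ℝ) (g h : Aff) : kerE z g = kerE (coadj h z) (h * g * h⁻¹) := by
  have ha := g.a_pos.ne'
  have hh := h.a_pos.ne'
  have e1 : (h * g * h⁻¹).a = g.a := by
    simp only [Aff.mul_a, Aff.inv_a]
    field_simp
  have e2 : (h * g * h⁻¹).b = h.a * g.b + h.b * (1 - g.a) := by
    simp only [Aff.mul_a, Aff.mul_b, Aff.inv_b]
    field_simp
    ring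
  have e3 := lam_mul_one_sub_exp (Real.log g.a)
  rw [Real.exp_neg, Real.exp_log g.a_pos] at e3
  rw [kerE, kerE, e1, e2]
  congr 3
  simp only [coadj]
  -- the two contributions of `h.b` cancel because `lam (log a) (1 - a) / a = -log a`
  have e4 : (z.1 + h.b * z.2 / h.a) * Real.log g.a
      + z.2 / h.a * (h.a * g.b + h.b * (1 - g.a)) * lam (Real.log g.a) / g.a
      = z.1 * Real.log g.a + z.2 * g.b * lam (Real.log g.a) / g.a
        + h.b * z.2 / h.a * (Real.log g.a - lam (Real.log g.a) * (1 - g.a⁻¹)) := by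
    field_simp
    ring
  rw [e4, e3, sub_self, mul_zero, add_zero]

theorem coadj_mem {s : ℤˣ} {z : ℝ × ℝ} (h : Aff) (hz : z ∈ orbit s) : coadj h z ∈ orbit s := by
  change 0 < ((s : ℤ) : ℝ) * (z.2 / h.a)
  rw [← mul_div_assoc]
  exact div_pos hz h.a_pos

theorem rightCoadj_mem {s : ℤˣ} {z : ℝ × ℝ} (h : Aff) (hz : z ∈ orbit s) :
    rightCoadj z h ∈ orbit s :=
  orbInv_mem (coadj_mem h⁻¹ (orbInv_mem hz))

theorem kerE_orbInv_rightCoadj {s : ℤˣ} {z : ℝ × ℝ} (hz : z ∈ orbit s) (g h : Aff) :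
    kerE (orbInv z) g = kerE (orbInv (rightCoadj z h)) (h⁻¹ * g * h) := by
  rw [rightCoadj, orbInv_orbInv (coadj_mem _ (orbInv_mem hz)), kerE_coadj (orbInv z) g h⁻¹,
    inv_inv]

theorem kerE_orbInv {s : ℤˣ} {z : ℝ × ℝ} (hz : z ∈ orbit s) (g : Aff) :
    kerE (orbInv z) g = Complex.exp (2 * Real.pi * Complex.I *
      (((-z.1 * Real.log g.a + g.b * lam (Real.log g.a) / g.a) / z.2 : ℝ) : ℂ)) := by
  have h := orbit_snd_ne_zero hz
  have ha := g.a_pos.ne'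
  rw [kerE]
  congr 3
  simp only [orbInv]
  field_simp

/-! ### Passing between the two Haar measures -/

theorem fourierMoyal_rightHaar (E : ℝ × ℝ → Aff → ℂ) (f : Aff → ℂ) :
    fourierMoyal E Aff.rightHaar f = fourierMoyal E Aff.leftHaar fun g => (g.a : ℂ) * f g := by
  ext z
  rw [fourierMoyal, Aff.integral_rightHaar_eq]
  exact integral_congr_ae (Filter.Eventually.of_forall fun g => by ring)

theorem isIntegratedRep_rightHaar_iff {s : ℤˣ} {f : Aff → ℂ} {A : HilbK s →L[ℂ] HilbK s} :
    IsIntegratedRep s Aff.rightHaar f A ↔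
      IsIntegratedRep s Aff.leftHaar (fun g => (g.a : ℂ) * f g) A := by
  refine forall₂_congr fun φ ψ => ?_
  rw [Aff.integrable_rightHaar_iff, Aff.integral_rightHaar_eq]
  simp only [mul_assoc]

/-- The modular function is multiplicative, so it can be distributed over the factors of a
convolution. -/
theorem mul_rightConv (f h : Aff → ℂ) (g : Aff) :
    (g.a : ℂ) * Aff.rightConv f h g
      = Aff.leftConv (fun g => (g.a : ℂ) * f g) (fun g => (g.a : ℂ) * h g) g := by
  rw [Aff.rightConv_eq_leftConv, Aff.leftConv, Aff.leftConv, ← integral_const_mul]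
  refine integral_congr_ae (Filter.Eventually.of_forall fun k => ?_)
  have hk : (k.a : ℂ) ≠ 0 := by exact_mod_cast k.a_pos.ne'
  simp only [Aff.mul_a, Aff.inv_a]
  push_cast
  field_simp

theorem isIntegratedRep_rightConv {s : ℤˣ} {f h : Aff → ℂ} (hf : Integrable f Aff.rightHaar)
    (hh : Integrable h Aff.rightHaar) {A B : HilbK s →L[ℂ] HilbK s}
    (hA : IsIntegratedRep s Aff.rightHaar f A) (hB : IsIntegratedRep s Aff.rightHaar h B) :
    IsIntegratedRep s Aff.rightHaar (Aff.rightConv f h) (A.comp B) := by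
  rw [Aff.integrable_rightHaar_iff] at hf hh
  rw [isIntegratedRep_rightHaar_iff] at hA hB ⊢
  simp only [mul_rightConv]
  exact isIntegratedRep_leftConv hf hh hA hB

theorem integrable_rightConv {f h : Aff → ℂ} (hf : Integrable f Aff.rightHaar)
    (hh : Integrable h Aff.rightHaar) : Integrable (Aff.rightConv f h) Aff.rightHaar := by
  rw [Aff.integrable_rightHaar_iff] at hf hh ⊢
  simp only [mul_rightConv]
  exact integrable_leftConv hf hh

/-! ### The Fourier–Moyal transformations -/

theorem characterFormula_kerE : CharacterFormula leftMeas Aff.leftHaar kerE := by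
  intro s f hf h0
  -- `f d_l g = (f / a) d_r g`, and `f / a` is again a test function of zero mean
  let f' : Aff → ℂ := fun g => ((g.a⁻¹ : ℝ) : ℂ) * f g
  have hff : (fun g : Aff => (g.a : ℂ) * f' g) = f := by
    ext g
    have hg : (g.a : ℂ) ≠ 0 := by exact_mod_cast g.a_pos.ne'
    simp only [f']
    push_cast
    field_simp
  have hf' : Aff.IsTestFunction f' := by
    refine ⟨?_, hf.2.mul_left⟩
    refine (Complex.ofRealCLM.contDiff.comp (ContDiff.inv (Real.contDiff_exp.comp contDiff_fst)
      fun p => Real.exp_ne_zero _)).mul hf.1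
  obtain ⟨A, hA, hi, hT⟩ := exists_trace_integratedRep s hf' fun a ha => by
    simp only [f']
    rw [integral_const_mul, h0 a ha, mul_zero]
  rw [isIntegratedRep_rightHaar_iff, hff] at hA
  rw [fourierMoyal_rightHaar, hff] at hi hT
  exact ⟨A, hA, hi, hT⟩

theorem isMoyalProduct_kerE {f h : Aff → ℂ} (hf : Integrable f Aff.leftHaar)
    (hh : Integrable h Aff.leftHaar) (s : ℤˣ) :
    IsMoyalProduct quantL leftMeas s (fourierMoyal kerE Aff.leftHaar f)
      (fourierMoyal kerE Aff.leftHaar h) (fourierMoyal kerE Aff.leftHaar (Aff.leftConv f h)) := by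
  obtain ⟨A, hA⟩ := exists_integratedRep s hf
  obtain ⟨B, hB⟩ := exists_integratedRep s hh
  exact ⟨A, B, isQuantization_fourierMoyal hf hA, isQuantization_fourierMoyal hh hB,
    isSymbol_fourierMoyal (integrable_leftConv hf hh) (isIntegratedRep_leftConv hf hh hA hB)⟩

theorem isFourierMoyalKernel_kerE : IsFourierMoyalKernel quantL leftMeas kerE := fun s g =>
  ⟨(continuous_kerE g).continuousOn, isSymbol_kerE s g⟩

/-- Uniqueness of the kernel of the left transformation. -/
theorem IsFourierMoyalKernel.eq_kerE {E : ℝ × ℝ → Aff → ℂ}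
    (hE : IsFourierMoyalKernel quantL leftMeas E) (s : ℤˣ) :
    ∀ z ∈ orbit s, ∀ g, E z g = kerE z g := fun _ hz g =>
  (hE s g).2.eqOn (isSymbol_kerE s g) (hE s g).1 (continuous_kerE g).continuousOn hz

/-- The kernel of the right transformation. -/
noncomputable def kerER (z : ℝ × ℝ) (g : Aff) : ℂ := kerE (orbInv z) g

theorem isFourierMoyalKernel_kerER : IsFourierMoyalKernel quantR rightMeas kerER := fun s g =>
  have hc : ContinuousOn (fun z => kerE z g) (orbit s) := (continuous_kerE g).continuousOn
  ⟨hc.comp_orbInv, (isSymbol_kerE s g).toRight hc⟩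

/-- Uniqueness of the kernel of the right transformation. -/
theorem IsFourierMoyalKernel.eq_kerER {E : ℝ × ℝ → Aff → ℂ}
    (hE : IsFourierMoyalKernel quantR rightMeas E) (s : ℤˣ) :
    ∀ z ∈ orbit s, ∀ g, E z g = kerER z g := fun z hz g => by
  have h := ((hE s g).2.toLeft (hE s g).1).eqOn (isSymbol_kerE s g) (hE s g).1.comp_orbInv
    (continuous_kerE g).continuousOn (orbInv_mem hz)
  simp only [orbInv_orbInv hz] at h
  exact h

theorem characterFormula_kerER : CharacterFormula rightMeas Aff.rightHaar kerER := by
  intro s f hf h0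
  have hs := (isOpen_orbit s).measurableSet
  obtain ⟨A, hA, hi, hT⟩ := exists_trace_integratedRep s hf h0
  have e : Set.EqOn (fun z => fourierMoyal kerER Aff.rightHaar f (orbInv z))
      (fourierMoyal kerE Aff.rightHaar f) (orbit s) := fun z hz => by
    simp only [fourierMoyal, kerER, orbInv_orbInv hz]
  refine ⟨A, hA, ?_, ?_⟩
  · rwa [integrableOn_rightMeas, integrableOn_congr_fun e hs]
  · rwa [integral_rightMeas, setIntegral_congr_fun hs e]

theorem isMoyalProduct_kerER {f h : Aff → ℂ} (hf : Integrable f Aff.rightHaar)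
    (hh : Integrable h Aff.rightHaar) (s : ℤˣ) :
    IsMoyalProduct quantR rightMeas s (fourierMoyal kerER Aff.rightHaar f)
      (fourierMoyal kerER Aff.rightHaar h)
      (fourierMoyal kerER Aff.rightHaar (Aff.rightConv f h)) := by
  obtain ⟨A, hA⟩ := exists_integratedRep s hf
  obtain ⟨B, hB⟩ := exists_integratedRep s hh
  have hfh := integrable_rightConv hf hh
  have key : ∀ {F : Aff → ℂ} {T : HilbK s →L[ℂ] HilbK s}, Integrable F Aff.rightHaar →
      IsIntegratedRep s Aff.rightHaar F T →
      IsQuantization quantR rightMeas s (fourierMoyal kerER Aff.rightHaar F) T :=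
    fun hF hT => isQuantization_quantR_iff.2 <|
      (isQuantization_fourierMoyal hF hT).congr fun z hz => by
        simp only [fourierMoyal, kerER, orbInv_orbInv hz]
  exact ⟨A, B, key hf hA, key hh hB,
    (isSymbol_fourierMoyal hfh (isIntegratedRep_rightConv hf hh hA hB)).toRight
      (continuous_fourierMoyal hfh).continuousOn⟩

theorem mainTheorem4 :
    (∃ E : ℝ × ℝ → Aff → ℂ, IsFourierMoyalKernel quantL leftMeas E) ∧
    (∀ E : ℝ × ℝ → Aff → ℂ, IsFourierMoyalKernel quantL leftMeas E →
      (∀ (s : ℤˣ) (z : ℝ × ℝ), z ∈ orbit s → ∀ g : Aff,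
        E z g = Complex.exp (2 * Real.pi * Complex.I *
          ((z.1 * Real.log g.a + z.2 * g.b * lam (Real.log g.a) / g.a : ℝ) : ℂ))) ∧
      (∀ (s : ℤˣ) (z : ℝ × ℝ), z ∈ orbit s → ∀ X : ℝ × ℝ,
        E z (expAff X) = Complex.exp (2 * Real.pi * Complex.I * (pairing z X : ℂ))) ∧
      (∀ (s : ℤˣ) (z : ℝ × ℝ), z ∈ orbit s → ∀ g : Aff,
        (starRingEnd ℂ) (E z g) = E z g⁻¹) ∧
      (∀ (s : ℤˣ) (z : ℝ × ℝ), z ∈ orbit s → ∀ g h : Aff,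
        E z g = E (coadj h z) (h * g * h⁻¹)) ∧
      CharacterFormula leftMeas Aff.leftHaar E ∧
      (∀ f h : Aff → ℂ, Integrable f Aff.leftHaar → Integrable h Aff.leftHaar → ∀ s : ℤˣ,
        IsMoyalProduct quantL leftMeas s
          (fourierMoyal E Aff.leftHaar f) (fourierMoyal E Aff.leftHaar h)
          (fourierMoyal E Aff.leftHaar (Aff.leftConv f h)))) ∧
    (∃ E : ℝ × ℝ → Aff → ℂ, IsFourierMoyalKernel quantR rightMeas E) ∧
    (∀ E : ℝ × ℝ → Aff → ℂ, IsFourierMoyalKernel quantR rightMeas E →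
      (∀ (s : ℤˣ) (z : ℝ × ℝ), z ∈ orbit s → ∀ g : Aff,
        E z g = Complex.exp (2 * Real.pi * Complex.I *
          (((-z.1 * Real.log g.a + g.b * lam (Real.log g.a) / g.a) / z.2 : ℝ) : ℂ))) ∧
      (∀ (s : ℤˣ) (z : ℝ × ℝ), z ∈ orbit s → ∀ X : ℝ × ℝ,
        E z (expAff X) = Complex.exp (2 * Real.pi * Complex.I * (pairing (orbInv z) X : ℂ))) ∧
      (∀ (s : ℤˣ) (z : ℝ × ℝ), z ∈ orbit s → ∀ g : Aff,
        (starRingEnd ℂ) (E z g) = E z g⁻¹) ∧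
      (∀ (s : ℤˣ) (z : ℝ × ℝ), z ∈ orbit s → ∀ g h : Aff,
        E z g = E (rightCoadj z h) (h⁻¹ * g * h)) ∧
      CharacterFormula rightMeas Aff.rightHaar E ∧
      (∀ f h : Aff → ℂ, Integrable f Aff.rightHaar → Integrable h Aff.rightHaar → ∀ s : ℤˣ,
        IsMoyalProduct quantR rightMeas s
          (fourierMoyal E Aff.rightHaar f) (fourierMoyal E Aff.rightHaar h)
          (fourierMoyal E Aff.rightHaar (Aff.rightConv f h)))) := by
  refine ⟨⟨kerE, isFourierMoyalKernel_kerE⟩, fun E hE => ?_,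
    ⟨kerER, isFourierMoyalKernel_kerER⟩, fun E hE => ?_⟩
  · have h := hE.eq_kerE
    have hsymm : ∀ s, ∀ z ∈ orbit s, ∀ g, kerE z g = E z g := fun s z hz g => (h s z hz g).symm
    refine ⟨fun s z hz g => h s z hz g, fun s z hz X => (h s z hz _).trans (kerE_expAff z X),
      fun s z hz g => ?_, fun s z hz g k => ?_, characterFormula_kerE.congr hsymm,
      fun f k hf hk s => (isMoyalProduct_kerE hf hk s).congr (fourierMoyal_congr (hsymm s) _ _)
        (fourierMoyal_congr (hsymm s) _ _) (fourierMoyal_congr (hsymm s) _ _)⟩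
    · rw [h s z hz, h s z hz, conj_kerE]
    · rw [h s z hz, h s _ (coadj_mem k hz), ← kerE_coadj]
  · have h := hE.eq_kerER
    have hsymm : ∀ s, ∀ z ∈ orbit s, ∀ g, kerER z g = E z g := fun s z hz g => (h s z hz g).symm
    refine ⟨fun s z hz g => (h s z hz g).trans (kerE_orbInv hz g),
      fun s z hz X => (h s z hz _).trans (kerE_expAff _ X),
      fun s z hz g => ?_, fun s z hz g k => ?_, characterFormula_kerER.congr hsymm,
      fun f k hf hk s => (isMoyalProduct_kerER hf hk s).congr (fourierMoyal_congr (hsymm s) _ _)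
        (fourierMoyal_congr (hsymm s) _ _) (fourierMoyal_congr (hsymm s) _ _)⟩
    · rw [h s z hz, h s z hz, kerER, conj_kerE, kerER]
    · rw [h s z hz, h s _ (rightCoadj_mem k hz)]
      exact kerE_orbInv_rightCoadj hz g k
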